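/- **Theorem (the Pfaffian is $\Sigma^B_1$-definable in $\mathbf{V\#L}$).** Work in two-sorted bounded arithmetic with the vocabulary $0,1,+,\cdot,|\ |,\in,\le,=_1,=_2$; in the standard model numbers are natural numbers, strings are finite sets of natural numbers, and $|X|$ is $0$ for $X=\emptyset$ and $1+\max X$ otherwise. Let $\langle x,y\rangle=(x+y)(x+y+1)+2y$. A $\Sigma^B_0$ formula has only bounded number quantifiers and no string quantifiers; a $\Sigma^B_1$ formula is a block of bounded string quantifiers $\exists X_1\le t_1\cdots\exists X_r\le t_r$ (no $X_i$ occurring in any $t_j$) followed by a $\Sigma^B_0$ formula. The theory $\mathbf{V\#L}$ consists of * the axioms 2-BASIC; * $\Sigma^B_0$-comprehension: $\exists X\le y\,\forall z<y\,(X(z)\leftrightarrow\varphi(z))$ for every $\Sigma^B_0$ formula $\varphi$ in which $X$ is not free; * string multiplication: for all strings $X,Y$ (read as binary numbers) there is a string $Z=X\cdot Y$; * matrix powering: for all numbers $n,k$ and every string $X$, read as an $n\times n$ matrix of binary integers, there is a string $Y$ that codes the powers $X^0,X^1,\dots,X^k$. In the last two axioms the graphs "$Z=X\cdot Y$" and "$Y=(X^0,\dots,X^k)$"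 are $\Sigma^B_0$ formulas in the strings and in bounded strings that record the intermediate results of the computation (the partial sums of the school multiplications and of the inner products). An integer is coded by a string $X$: it is negative (or zero) if $0\in X$, nonnegative otherwise, and its absolute value is $\sum_{x+1\in X}2^x$; the code of an integer is the unique such string, with $0$ coded by $\emptyset$. An integer matrix $A$ is coded by a string $X$ in which $\{x:\langle i,\langle j,x\rangle\rangle\in X\}$ represents the entry $A_{ij}$. For a skew symmetric integer matrix $A\in\mathrm{Mat}(2n,2n)$ let $$\mathrm{Pf}(A)=\sum_{\sigma}\mathrm{sgn}(\sigma)\,a_{\sigma(1)\sigma(2)}\cdots a_{\sigma(2n-1)\sigma(2n)},$$ where $\sigma$ ranges over the permutations of $\{1,\dots,2n\}$ with $\sigma(2i-1)<\sigma(2i)$ for all $i$ and $\sigma(1)<\sigma(3)<\dots<\sigma(2n-1)$, that is, over the perfect matchings of $\{1,\dots,2n\}$. Let $F(n,X)$ be the code of $\mathrm{Pf}(A)$ if the $2n\times 2n$ matrix $A$ coded by $X$ is skew symmetric, and $\emptyset$ (the code of $0$) otherwise. Then $F$ is $\Sigma^B_1$-definable in $\mathbf{V\#L}$: there is a $\Sigma^B_1$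 formula $\varphi(n,X,Y)$, with no other free variables, such that in the standard model $Y=F(n,X)$ if and only if $\varphi(n,X,Y)$, and $$\mathbf{V\#L}\vdash\forall n\,\forall X\,\exists!Y\,\varphi(n,X,Y).$$ -/

import Mathlib

/-! ### Two-sorted first-order syntax over the vocabulary `0, 1, +, ·, | |, ≤, ∈, =₁, =₂` -/

namespace TwoSorted

/-- Number terms. The only string terms are the string variables, named by natural numbers,
so `len X` is the term `|X|` for the string variable with name `X`. -/
inductive NTerm where
  | var (x : ℕ)
  | zero
  | one
  | add (t u : NTerm)
  | mul (t u : NTerm)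
  | len (X : ℕ)

instance : Zero NTerm := ⟨NTerm.zero⟩
instance : One NTerm := ⟨NTerm.one⟩
instance : Add NTerm := ⟨NTerm.add⟩
instance : Mul NTerm := ⟨NTerm.mul⟩

/-- The number variables that occur in a term. -/
def NTerm.numVars : NTerm → Set ℕ
  | .var x => {x}
  | .zero => ∅
  | .one => ∅
  | .add t u => t.numVars ∪ u.numVars
  | .mul t u => t.numVars ∪ u.numVars
  | .len _ => ∅

/-- The string variables that occur in a term. -/
def NTerm.strVars : NTerm → Set ℕ
  | .var _ => ∅
  | .zero => ∅
  | .one => ∅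
  | .add t u => t.strVars ∪ u.strVars
  | .mul t u => t.strVars ∪ u.strVars
  | .len X => {X}

/-- Two-sorted formulas; `mem t X` is the atomic formula `t ∈ X`, also written `X(t)`. -/
inductive Formula where
  | eqN (t u : NTerm)
  | eqS (X Y : ℕ)
  | le (t u : NTerm)
  | mem (t : NTerm) (X : ℕ)
  | neg (φ : Formula)
  | and (φ ψ : Formula)
  | or (φ ψ : Formula)
  | allN (x : ℕ) (φ : Formula)
  | exN (x : ℕ) (φ : Formula)
  | allS (X : ℕ) (φ : Formula)
  | exS (X : ℕ) (φ : Formula)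

namespace Formula

/-- `φ → ψ` abbreviates `¬φ ∨ ψ`. -/
def imp (φ ψ : Formula) : Formula := or (neg φ) ψ

def iff (φ ψ : Formula) : Formula := and (imp φ ψ) (imp ψ φ)

/-- `t < u` abbreviates `t ≤ u ∧ t ≠ u`. -/
def lt (t u : NTerm) : Formula := and (le t u) (neg (eqN t u))

/-- The bounded quantifier `∀ x ≤ t`. -/
def ballN (x : ℕ) (t : NTerm) (φ : Formula) : Formula := allN x (imp (le (.var x) t) φ)

/-- The bounded quantifier `∃ x ≤ t`. -/
def bexN (x : ℕ) (t : NTerm) (φ : Formula) : Formula := exN x (and (le (.var x) t) φ)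

/-- The bounded string quantifier `∃ X ≤ t`, that is, `∃ X, |X| ≤ t ∧ …`. -/
def bexS (X : ℕ) (t : NTerm) (φ : Formula) : Formula := exS X (and (le (.len X) t) φ)

/-- The free number variables. -/
def freeNum : Formula → Set ℕ
  | eqN t u => t.numVars ∪ u.numVars
  | eqS _ _ => ∅
  | le t u => t.numVars ∪ u.numVars
  | mem t _ => t.numVars
  | neg φ => φ.freeNum
  | and φ ψ => φ.freeNum ∪ ψ.freeNum
  | or φ ψ => φ.freeNum ∪ ψ.freeNum
  | allN x φ => φ.freeNum \ {x}
  | exN x φ => φ.freeNum \ {x}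
  | allS _ φ => φ.freeNum
  | exS _ φ => φ.freeNum

/-- The free string variables. -/
def freeStr : Formula → Set ℕ
  | eqN t u => t.strVars ∪ u.strVars
  | eqS X Y => {X, Y}
  | le t u => t.strVars ∪ u.strVars
  | mem t X => t.strVars ∪ {X}
  | neg φ => φ.freeStr
  | and φ ψ => φ.freeStr ∪ ψ.freeStr
  | or φ ψ => φ.freeStr ∪ ψ.freeStr
  | allN _ φ => φ.freeStr
  | exN _ φ => φ.freeStr
  | allS X φ => φ.freeStr \ {X}
  | exS X φ => φ.freeStr \ {X}

/-- `Σ^B_0` formulas: no string quantifiers, and every number quantifier is bounded by a term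
that does not contain the quantified variable. -/
inductive IsSigmaB0 : Formula → Prop
  | eqN (t u : NTerm) : IsSigmaB0 (eqN t u)
  | eqS (X Y : ℕ) : IsSigmaB0 (eqS X Y)
  | le (t u : NTerm) : IsSigmaB0 (le t u)
  | mem (t : NTerm) (X : ℕ) : IsSigmaB0 (mem t X)
  | neg {φ : Formula} : IsSigmaB0 φ → IsSigmaB0 (neg φ)
  | and {φ ψ : Formula} : IsSigmaB0 φ → IsSigmaB0 ψ → IsSigmaB0 (and φ ψ)
  | or {φ ψ : Formula} : IsSigmaB0 φ → IsSigmaB0 ψ → IsSigmaB0 (or φ ψ)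
  | ballN {x : ℕ} {t : NTerm} {φ : Formula} :
      x ∉ t.numVars → IsSigmaB0 φ → IsSigmaB0 (ballN x t φ)
  | bexN {x : ℕ} {t : NTerm} {φ : Formula} :
      x ∉ t.numVars → IsSigmaB0 φ → IsSigmaB0 (bexN x t φ)

/-- `Σ^B_1` formulas: `∃ X₁ ≤ t₁ … ∃ X_r ≤ t_r, ψ` with `ψ` a `Σ^B_0` formula, where no `X_i`
occurs in any `t_j`. -/
def IsSigmaB1 (φ : Formula) : Prop :=
  ∃ (l : List (ℕ × NTerm)) (ψ : Formula), ψ.IsSigmaB0 ∧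
    (∀ p ∈ l, ∀ q ∈ l, p.1 ∉ q.2.strVars) ∧
    φ = l.foldr (fun p χ => bexS p.1 p.2 χ) ψ

end Formula

/-! ### Semantics -/

/-- A two-sorted structure for the vocabulary; both equality symbols are read as equality. -/
structure Struct where
  Num : Type
  Str : Type
  zero : Num
  one : Num
  add : Num → Num → Num
  mul : Num → Num → Num
  len : Str → Num
  le : Num → Num → Prop
  mem : Num → Str → Prop
  str_nonempty : Nonempty Str

def NTerm.eval (M : Struct) (v : ℕ → M.Num) (s : ℕ → M.Str) : NTerm → M.Num
  | .var x => v x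
  | .zero => M.zero
  | .one => M.one
  | .add t u => M.add (t.eval M v s) (u.eval M v s)
  | .mul t u => M.mul (t.eval M v s) (u.eval M v s)
  | .len X => M.len (s X)

/-- Tarski satisfaction under an assignment `v` of numbers and `s` of strings. -/
def Formula.Sat (M : Struct) : (ℕ → M.Num) → (ℕ → M.Str) → Formula → Prop
  | v, s, .eqN t u => t.eval M v s = u.eval M v s
  | _, s, .eqS X Y => s X = s Y
  | v, s, .le t u => M.le (t.eval M v s) (u.eval M v s)
  | v, s, .mem t X => M.mem (t.eval M v s) (s X)
  | v, s, .neg φ => ¬ Formula.Sat M v s φ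
  | v, s, .and φ ψ => Formula.Sat M v s φ ∧ Formula.Sat M v s ψ
  | v, s, .or φ ψ => Formula.Sat M v s φ ∨ Formula.Sat M v s ψ
  | v, s, .allN x φ => ∀ a : M.Num, Formula.Sat M (Function.update v x a) s φ
  | v, s, .exN x φ => ∃ a : M.Num, Formula.Sat M (Function.update v x a) s φ
  | v, s, .allS X φ => ∀ A : M.Str, Formula.Sat M v (Function.update s X A) φ
  | v, s, .exS X φ => ∃ A : M.Str, Formula.Sat M v (Function.update s X A) φ

/-- A formula holds in a structure if its universal closure does. -/
def Struct.Models (M : Struct) (φ : Formula) : Prop :=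
  ∀ (v : ℕ → M.Num) (s : ℕ → M.Str), φ.Sat M v s

/-- `T ⊢ φ`, for the universal closures of the formulas involved. By the completeness theorem
(and Löwenheim–Skolem, since the vocabulary is finite) provability is truth of `φ` in all
models of `T`, and models on types in the lowest universe suffice. -/
def Proves (T : Set Formula) (φ : Formula) : Prop :=
  ∀ M : Struct, (∀ ψ ∈ T, M.Models ψ) → M.Models φ

/-- The standard model: numbers are natural numbers, strings are finite sets of natural numbers,
and `|X|` is `0` for `X = ∅` and `1 + max X` otherwise. -/
abbrev stdModel : Struct where
  Num := ℕ
  Str := Finset ℕ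
  zero := 0
  one := 1
  add := (· + ·)
  mul := (· * ·)
  len X := X.sup Nat.succ
  le := (· ≤ ·)
  mem x X := x ∈ X
  str_nonempty := ⟨∅⟩

/-- A string function `F` of `p` number and `q` string arguments is `Σ^B_1`-definable in `T`:
there is a `Σ^B_1` formula `φ(x₀,…,x_{p-1}, X₀,…,X_{q-1}, Y)`, where `Y` is the string variable
with name `q`, that defines the graph of `F` in the standard model and for which `T` proves
`∀ x ∀ X ∃! Y φ`. Here `∃! Y φ` is written `∃ Z ∀ Y (φ ↔ Y = Z)`, where `Z`, with name `q + 1`,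
is not free in `φ`. -/
def SigmaB1Definable (T : Set Formula) (p q : ℕ)
    (F : (Fin p → ℕ) → (Fin q → Finset ℕ) → Finset ℕ) : Prop :=
  ∃ φ : Formula, φ.IsSigmaB1 ∧ φ.freeNum ⊆ Set.Iio p ∧ φ.freeStr ⊆ Set.Iic q ∧
    (∀ (v : ℕ → ℕ) (s : ℕ → Finset ℕ),
      φ.Sat stdModel v s ↔ s q = F (fun i => v i) (fun i => s i)) ∧
    Proves T (.exS (q + 1) (.allS q (φ.iff (.eqS q (q + 1)))))

/-! ### The basic axioms and comprehension -/

section BasicAxioms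

open Formula NTerm

/-- The axioms `2-BASIC`. -/
inductive Basic2 : Formula → Prop
  | B1 : Basic2 (neg (eqN (var 0 + 1) 0))
  | B2 : Basic2 (imp (eqN (var 0 + 1) (var 1 + 1)) (eqN (var 0) (var 1)))
  | B3 : Basic2 (eqN (var 0 + 0) (var 0))
  | B4 : Basic2 (eqN (var 0 + (var 1 + 1)) (var 0 + var 1 + 1))
  | B5 : Basic2 (eqN (var 0 * 0) 0)
  | B6 : Basic2 (eqN (var 0 * (var 1 + 1)) (var 0 * var 1 + var 0))
  | B7 : Basic2 (imp (and (le (var 0) (var 1)) (le (var 1) (var 0))) (eqN (var 0) (var 1)))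
  | B8 : Basic2 (le (var 0) (var 0 + var 1))
  | B9 : Basic2 (le 0 (var 0))
  | B10 : Basic2 (or (le (var 0) (var 1)) (le (var 1) (var 0)))
  | B11 : Basic2 (iff (le (var 0) (var 1)) (lt (var 0) (var 1 + 1)))
  | B12 : Basic2 (imp (neg (eqN (var 0) 0)) (bexN 1 (var 0) (eqN (var 1 + 1) (var 0))))
  | L1 : Basic2 (imp (mem (var 0) 0) (lt (var 0) (len 0)))
  | L2 : Basic2 (imp (eqN (var 0 + 1) (len 0)) (mem (var 0) 0))
  | SE : Basic2 (imp (and (eqN (len 0) (len 1))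
      (ballN 0 (len 0) (imp (lt (var 0) (len 0)) (iff (mem (var 0) 0) (mem (var 0) 1)))))
      (eqS 0 1))

/-- The comprehension axioms `∃ X ≤ y ∀ z < y (X(z) ↔ φ)` for `Σ^B_0` formulas `φ` in which `X`
is not free. -/
inductive SigmaB0Comp : Formula → Prop
  | comp (φ : Formula) (X y z : ℕ) (hφ : φ.IsSigmaB0) (hX : X ∉ φ.freeStr) (hyz : y ≠ z) :
      SigmaB0Comp (bexS X (var y)
        (ballN z (var y) (imp (lt (var z) (var y)) (iff (mem (var z) X) φ))))

end BasicAxioms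

/-! ### Writing larger formulas

An `FB` is a formula together with a supply of fresh variables: `f i j` is the formula in which
bound number variables get names `i, i + 1, …` and bound string variables get names
`j, j + 1, …`. All free variables have smaller names, so that no variable is ever captured. -/

abbrev FB := ℕ → ℕ → Formula

namespace FB

def eq (t u : NTerm) : FB := fun _ _ => .eqN t u
def le (t u : NTerm) : FB := fun _ _ => .le t u
def lt (t u : NTerm) : FB := fun _ _ => .lt t u
def mem (t : NTerm) (X : ℕ) : FB := fun _ _ => .mem t X
def not (φ : FB) : FB := fun i j => (φ i j).neg
def and (φ ψ : FB) : FB := fun i j => (φ i j).and (ψ i j)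
def or (φ ψ : FB) : FB := fun i j => (φ i j).or (ψ i j)
def imp (φ ψ : FB) : FB := fun i j => (φ i j).imp (ψ i j)
def iff (φ ψ : FB) : FB := fun i j => (φ i j).iff (ψ i j)
def xor (φ ψ : FB) : FB := not (iff φ ψ)

/-- `∀ x ≤ t`. -/
def allLe (t : NTerm) (f : NTerm → FB) : FB := fun i j => .ballN i t (f (.var i) (i + 1) j)
/-- `∃ x ≤ t`. -/
def exLe (t : NTerm) (f : NTerm → FB) : FB := fun i j => .bexN i t (f (.var i) (i + 1) j)
/-- `∀ x < t`. -/
def allLt (t : NTerm) (f : NTerm → FB) : FB := allLe t fun x => imp (lt x t) (f x)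
/-- `∃ x < t`. -/
def exLt (t : NTerm) (f : NTerm → FB) : FB := exLe t fun x => and (lt x t) (f x)
/-- `∃ X ≤ t` for a string `X`. -/
def exStr (t : NTerm) (f : ℕ → FB) : FB := fun i j => .bexS j t (f j i (j + 1))

end FB

/-! ### Arithmetic on binary numbers by `Σ^B_0` formulas -/

section Arithmetic

open FB

/-- The term for the pairing function `⟨x, y⟩ = (x + y)(x + y + 1) + 2y`. -/
def NTerm.pair (x y : NTerm) : NTerm := (x + y) * (x + y + 1) + (1 + 1) * y

/-- A finite set of numbers given by a formula. It is read as the natural number with these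
binary digits. -/
abbrev Bits := NTerm → FB

/-- The set `X`. -/
def bits (X : ℕ) : Bits := fun x => mem x X

/-- The row `{x : ⟨i, x⟩ ∈ a}`. -/
def Bits.row (a : Bits) (i : NTerm) : Bits := fun x => a (i.pair x)

/-- `a` has no element `≤ b`. -/
def isZero (b : NTerm) (a : Bits) : FB := allLe b fun x => not (a x)

/-- `a` and `c` have the same elements `≤ b`. -/
def sameBits (b : NTerm) (a c : Bits) : FB := allLe b fun x => iff (a x) (c x)

/-- There is a carry into position `x` when `a` and `c` are added. -/
def carry (a c : Bits) (x : NTerm) : FB :=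
  exLt x fun k => and (and (a k) (c k)) (allLt x fun j => imp (lt k j) (or (a j) (c j)))

/-- `e = a + c`, if all elements of `a`, `c` and `e` are less than `b`. -/
def isSum (b : NTerm) (a c e : Bits) : FB :=
  allLe b fun x => iff (e x) (xor (xor (a x) (c x)) (carry a c x))

/-- `a · 2 ^ i`. -/
def shift (a : Bits) (i : NTerm) : Bits := fun x => exLe x fun y => and (eq (y + i) x) (a y)

/-- The numbers `w 0, …, w m` are the partial sums `w i = ∑ j < i, c(j) · a · 2 ^ j` of the school
algorithm; so `w m = a · c` if all elements of `c` are less than `m`. -/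
def isMulRun (b m : NTerm) (a c : Bits) (w : NTerm → Bits) : FB :=
  and (isZero b (w 0)) (allLt m fun i =>
    and (imp (c i) (isSum b (w i) (shift a i) (w (i + 1))))
      (imp (not (c i)) (sameBits b (w i) (w (i + 1)))))

/-- An integer, given by its sign (`neg` holds for negative integers) and absolute value. -/
structure IntBits where
  neg : FB
  abs : Bits

/-- A string `a` codes an integer: `0 ∈ a` says that it is negative, and the digit of its absolute
value at position `x` is `a(x + 1)`. -/
def Bits.int (a : Bits) : IntBits := ⟨a 0, fun x => a (x + 1)⟩

/-- `e = a + c` for integers, where `e` is not a negative zero. -/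
def isIntSum (b : NTerm) (a c e : IntBits) : FB :=
  let hasSign (s : FB) : FB := iff e.neg (and s (not (isZero b e.abs)))
  or (and (iff a.neg c.neg) (and (isSum b a.abs c.abs e.abs) (hasSign a.neg)))
    (and (xor a.neg c.neg)
      (or (and (isSum b e.abs c.abs a.abs) (hasSign a.neg))
        (and (isSum b e.abs a.abs c.abs) (hasSign c.neg))))

end Arithmetic

/-! ### The theory -/

section Theory

open FB NTerm

/-- String multiplication `∀ X, Y ∃ Z (Z = X · Y)`. The record `W` of the school algorithm makes
the graph of multiplication a `Σ^B_0` formula. -/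
def mulAxiom : Formula :=
  let X := 0
  let Y := 1
  let axiomFB : FB :=
    exStr (len X + len Y) fun Z => exStr (pair (len Y) (len X + len Y) + 1) fun W =>
      let b := len X + len Y + len Z + len W
      and (isMulRun b (len Y) (bits X) (bits Y) (bits W).row)
        (sameBits b (bits Z) ((bits W).row (len Y)))
  axiomFB 0 2

/-- `Y` codes the sequence `X ^ 0, …, X ^ k` of powers of the integer `n × n` matrix `X`.
The entry of `X` in row `i` and column `j` (both less than `n`) is coded by the row
`{x : ⟨i, ⟨j, x⟩⟩ ∈ X}` as an integer, and `X ^ i` is coded by the row `i` of `Y`. For `i < k`,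
the rows of `U` record the computations of all products `(X ^ i) a l · X l c` of absolute values,
and the rows of `S` record the partial sums `∑ l' < l, (X ^ i) a l' · X l' c`. -/
def isPowSeq (n k : NTerm) (X Y S U : ℕ) : FB :=
  let b := len X + len Y + len S + len U
  let x (i j : NTerm) : Bits := ((bits X).row i).row j
  let y (i a c : NTerm) : Bits := (((bits Y).row i).row a).row c
  let s (i a c l : NTerm) : Bits := ((((bits S).row i).row a).row c).row l
  let u (i a c l m : NTerm) : Bits := (((((bits U).row i).row a).row c).row l).row m
  and
    (allLt n fun a => allLt n fun c => allLe b fun z => iff (y 0 a c z) (and (eq a c) (eq z 1)))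
    (allLt k fun i => allLt n fun a => allLt n fun c =>
      and (isZero b (s i a c 0))
        (and
          (allLt n fun l =>
            and (isMulRun b (len X) (y i a l).int.abs (x l c).int.abs (u i a c l))
              (isIntSum b (s i a c l).int
                ⟨xor (y i a l).int.neg (x l c).int.neg, u i a c l (len X)⟩
                (s i a c (l + 1)).int))
          (sameBits b (y (i + 1) a c) (s i a c n))))

/-- Matrix powering: `∀ X ∀ n ∀ k`, the powers `X ^ 0, …, X ^ k` of the integer `n × n`
matrix `X` exist. All indices and digit positions that occur are at most
`B = (k + 1)(n + |X| + 1)`. -/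
def powAxiom : Formula :=
  let n := var 0
  let k := var 1
  let X := 0
  let B := (k + 1) * (n + len X + 1)
  let t := pair B (pair B (pair B (pair B (pair B B)))) + 1
  let axiomFB : FB :=
    exStr t fun Y => exStr t fun S => exStr t fun U => isPowSeq n k X Y S U
  axiomFB 2 1

/-- The theory `V#L`. -/
def VSharpL : Set Formula :=
  {φ | Basic2 φ} ∪ {φ | SigmaB0Comp φ} ∪ {mulAxiom, powAxiom}

end Theory

/-! ### The Pfaffian as a function on strings -/

/-- The permutations `σ` of `{0, …, 2n - 1}` that list the perfect matching
`{σ 0, σ 1}, {σ 2, σ 3}, …` in normal form: `σ (2i) < σ (2i + 1)` and `σ 0 < σ 2 < σ 4 < ⋯`.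
Each perfect matching is listed by exactly one such permutation. -/
def IsMatching {n : ℕ} (σ : Equiv.Perm (Fin (2 * n))) : Prop :=
  (∀ i : Fin n, σ ⟨2 * i, by omega⟩ < σ ⟨2 * i + 1, by omega⟩) ∧
    ∀ i j : Fin n, i < j → σ ⟨2 * i, by omega⟩ < σ ⟨2 * j, by omega⟩

open Classical in
/-- The Pfaffian. -/
noncomputable def pfaffian {n : ℕ} (A : Matrix (Fin (2 * n)) (Fin (2 * n)) ℤ) : ℤ :=
  ∑ σ : Equiv.Perm (Fin (2 * n)) with IsMatching σ,
    (Equiv.Perm.sign σ : ℤ) * ∏ i : Fin n, A (σ ⟨2 * i, by omega⟩) (σ ⟨2 * i + 1, by omega⟩)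

/-- The pairing function on natural numbers. -/
def natPair (x y : ℕ) : ℕ := (x + y) * (x + y + 1) + 2 * y

/-- The integer coded by a string: `0 ∈ X` says that it is not positive, and its absolute value
is `∑ 2 ^ x` over the `x` with `x + 1 ∈ X`. -/
def decodeInt (X : Finset ℕ) : ℤ :=
  (if 0 ∈ X then -1 else 1) * ∑ x ∈ X.erase 0, 2 ^ (x - 1)

/-- The code of an integer; `0` is coded by the empty string. -/
def encodeInt (z : ℤ) : Finset ℕ :=
  (z.natAbs.bitIndices.toFinset.image Nat.succ) ∪ (if z < 0 then {0} else ∅)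

/-- The integer `d × d` matrix coded by a string: the entry `(i, j)` is coded by
`{x : ⟨i, ⟨j, x⟩⟩ ∈ X}`. -/
def decodeMatrix (d : ℕ) (X : Finset ℕ) : Matrix (Fin d) (Fin d) ℤ :=
  Matrix.of fun i j =>
    decodeInt ((Finset.range (X.sup Nat.succ)).filter fun x => natPair i (natPair j x) ∈ X)

open Classical in
/-- The Pfaffian as a function on strings: the code of `pfaffian A` if `X` codes a skew
symmetric `2n × 2n` matrix `A`, and the code `∅` of zero otherwise. -/
noncomputable def pfaffianString (n : ℕ) (X : Finset ℕ) : Finset ℕ :=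
  let A := decodeMatrix (2 * n) X
  if A.transpose = -A then encodeInt (pfaffian A) else ∅

end TwoSorted

/-! ### Renaming of variables -/

/-! The Pfaffian is an entry of a power of an integer matrix whose entries are 0, 1 or copied from
`A`. Let `J` be the block diagonal symplectic matrix and `x` a variable. Every term of Pf(J + xA) is
a product of n entries, so its coefficient of x^n is Pf(A).

Now clear the pairs of vertices (2h, 2h+1) one after another. If `J` is already standing alone on
the pairs before h, a congruence of determinant 1 splits off the pair h, and the Pfaffian acquires
the factor 1 + z_h(2h). Here the power series z_h solve z_h(v) = x (a(v,2h+1) + sum over c > h of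
a(v,2c) z_h(2c+1) - a(v,2c+1) z_h(2c)). Hence Pf(A) is the coefficient of x^n in the product of all
1 + z_h(2h) (`exists_series`). Expanding the recursion, z_h(2h) enumerates closed walks with head h,
and the product enumerates sequences of such walks with increasing heads, with one x per step. A
graph on states (h, v) generates these sequences, so the coefficient is an entry of the power n + 1
of its transfer matrix, the extra step choosing the first head (`pfaffian_eq_intPow`).

The algebra uses `fullPf`, the sum over all permutations. It satisfies fullPf(B N Bᵀ) = det B ·
fullPf N (`fullPf_congruence`), and for skew symmetric matrices it is 2^n n! times the Pfaffian
(`fullPf_eq`); the factor is cancelled at the end.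

The formula says that there are a transfer matrix `P` and a recorded computation `Q`, `S`, `U` of
its powers, and that `Y` holds the digits of the right entry. The theory need not know anything
about Pfaffians: the strings exist by comprehension and matrix powering (`exists_pfaffianBody`), and
the result is unique by induction along the recorded computation (`sIsPowSeq.unique`,
`PfaffianBody.unique`). The algebraic identity is used in the standard model only, where uniqueness
reduces the claim to exhibiting one computation whose result is the Pfaffian.

To keep syntax out of these inductions, definability is treated semantically: `IsSig` for predicates
on a model, and `DenF` for the meaning of a formula with a supply of fresh variables. -/

namespace TwoSorted

/-- Renaming of the number variables by `f` and of the string variables by `g`. -/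
def NTerm.rename (f g : ℕ → ℕ) : NTerm → NTerm
  | .var x => .var (f x)
  | .zero => .zero
  | .one => .one
  | .add t u => .add (t.rename f g) (u.rename f g)
  | .mul t u => .mul (t.rename f g) (u.rename f g)
  | .len X => .len (g X)

/-- Renaming of all number variables by `f` and of all string variables by `g`. -/
def Formula.rename (f g : ℕ → ℕ) : Formula → Formula
  | .eqN t u => .eqN (t.rename f g) (u.rename f g)
  | .eqS X Y => .eqS (g X) (g Y)
  | .le t u => .le (t.rename f g) (u.rename f g)
  | .mem t X => .mem (t.rename f g) (g X)
  | .neg φ => .neg (φ.rename f g)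
  | .and φ ψ => .and (φ.rename f g) (ψ.rename f g)
  | .or φ ψ => .or (φ.rename f g) (ψ.rename f g)
  | .allN x φ => .allN (f x) (φ.rename f g)
  | .exN x φ => .exN (f x) (φ.rename f g)
  | .allS X φ => .allS (g X) (φ.rename f g)
  | .exS X φ => .exS (g X) (φ.rename f g)

theorem NTerm.eval_rename (M : Struct) (f g : ℕ → ℕ) (v : ℕ → M.Num) (s : ℕ → M.Str)
    (t : NTerm) : (t.rename f g).eval M v s = t.eval M (v ∘ f) (s ∘ g) := by
  induction t <;> simp_all [NTerm.rename, NTerm.eval]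

theorem NTerm.numVars_rename (f g : ℕ → ℕ) (t : NTerm) :
    (t.rename f g).numVars = f '' t.numVars := by
  induction t <;> simp_all [NTerm.rename, NTerm.numVars, Set.image_union]

theorem NTerm.strVars_rename (f g : ℕ → ℕ) (t : NTerm) :
    (t.rename f g).strVars = g '' t.strVars := by
  induction t <;> simp_all [NTerm.rename, NTerm.strVars, Set.image_union]

/-- Injectivity prevents capture: updating an assignment at `f x` and composing with `f` is the same
as composing first and updating at `x`. -/
theorem Formula.sat_rename (M : Struct) {f g : ℕ → ℕ} (hf : f.Injective) (hg : g.Injective)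
    (φ : Formula) (v : ℕ → M.Num) (s : ℕ → M.Str) :
    (φ.rename f g).Sat M v s ↔ φ.Sat M (v ∘ f) (s ∘ g) := by
  induction φ generalizing v s <;>
    simp_all [Formula.rename, Formula.Sat, NTerm.eval_rename, Function.update_comp_eq_of_injective]

theorem Formula.freeStr_rename {f g : ℕ → ℕ} (hg : g.Injective) (φ : Formula) :
    (φ.rename f g).freeStr = g '' φ.freeStr := by
  induction φ <;>
    simp_all [Formula.rename, Formula.freeStr, NTerm.strVars_rename, Set.image_union,
      Set.image_sdiff, Set.image_insert_eq]

theorem Formula.IsSigmaB0.rename {f g : ℕ → ℕ} (hf : f.Injective) {φ : Formula}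
    (h : φ.IsSigmaB0) : (φ.rename f g).IsSigmaB0 := by
  induction h with
  | eqN t u => exact .eqN _ _
  | eqS X Y => exact .eqS _ _
  | le t u => exact .le _ _
  | mem t X => exact .mem _ _
  | neg _ ih => exact .neg ih
  | and _ _ ih₁ ih₂ => exact .and ih₁ ih₂
  | or _ _ ih₁ ih₂ => exact .or ih₁ ih₂
  | ballN hx _ ih =>
    refine .ballN ?_ ih
    rwa [NTerm.numVars_rename, hf.mem_set_image]
  | bexN hx _ ih =>
    refine .bexN ?_ ih
    rwa [NTerm.numVars_rename, hf.mem_set_image]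

/-! ### Predicates given by `Σ^B_0` formulas with parameters -/

variable {M : Struct}

instance (M : Struct) : Zero M.Num := ⟨M.zero⟩
instance (M : Struct) : One M.Num := ⟨M.one⟩
instance (M : Struct) : Add M.Num := ⟨M.add⟩
instance (M : Struct) : Mul M.Num := ⟨M.mul⟩
instance (M : Struct) : LE M.Num := ⟨M.le⟩

/-- The sequence with even members `a` and odd members `c`. -/
def interleave {α : Type*} (a c : ℕ → α) (k : ℕ) : α := if k % 2 = 0 then a (k / 2) else c (k / 2)

/-- The sequence with first member `x` and tail `a`. -/
def consSeq {α : Type*} (x : α) (a : ℕ → α) : ℕ → α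
  | 0 => x
  | k + 1 => a k

@[simp] theorem consSeq_zero {α : Type*} (x : α) (a : ℕ → α) : consSeq x a 0 = x := rfl
@[simp] theorem consSeq_succ {α : Type*} (x : α) (a : ℕ → α) (k : ℕ) :
    consSeq x a (k + 1) = a k := rfl

/-- The number-valued functions of a sequence of numbers that are given by a term. -/
def IsTerm (M : Struct) (f : (ℕ → M.Num) → M.Num) : Prop :=
  ∃ (c : ℕ → M.Num) (s : ℕ → M.Str) (t : NTerm), ∀ a, f a = t.eval M (interleave a c) s

/-- The predicates on sequences of numbers that are given by a `Σ^B_0` formula. -/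
def IsSig (M : Struct) (P : (ℕ → M.Num) → Prop) : Prop :=
  ∃ (c : ℕ → M.Num) (s : ℕ → M.Str) (φ : Formula), φ.IsSigmaB0 ∧
    ∀ a, P a ↔ φ.Sat M (interleave a c) s

/-- Even names are arguments and stay fixed. Odd names are parameters; they are sent to the classes
1 and 3 modulo 4, so that two formulas with separate parameters become formulas over one interleaved
parameter sequence. -/
def leftName (k : ℕ) : ℕ := if k % 2 = 0 then k else 4 * (k / 2) + 1
def rightName (k : ℕ) : ℕ := if k % 2 = 0 then k else 4 * (k / 2) + 3

theorem leftName_injective : leftName.Injective := by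
  intro a b h; unfold leftName at h; split_ifs at h <;> omega

theorem rightName_injective : rightName.Injective := by
  intro a b h; unfold rightName at h; split_ifs at h <;> omega

theorem two_mul_injective : (fun k : ℕ => 2 * k).Injective := fun a b h => by simpa using h

theorem two_mul_add_one_injective : (fun k : ℕ => 2 * k + 1).Injective :=
  fun a b h => by simpa using h

theorem interleave_leftName {α : Type*} (a c d : ℕ → α) :
    interleave a (interleave c d) ∘ leftName = interleave a c := by
  funext k
  by_cases h : k % 2 = 0
  · simp [interleave, leftName, h]
  · have h1 : (4 * (k / 2) + 1) % 2 ≠ 0 := by omega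
    have h2 : (4 * (k / 2) + 1) / 2 = 2 * (k / 2) := by omega
    simp [interleave, leftName, h, h1, h2]

theorem interleave_rightName {α : Type*} (a c d : ℕ → α) :
    interleave a (interleave c d) ∘ rightName = interleave a d := by
  funext k
  by_cases h : k % 2 = 0
  · simp [interleave, rightName, h]
  · have h1 : (4 * (k / 2) + 3) % 2 ≠ 0 := by omega
    have h2 : (4 * (k / 2) + 3) / 2 = 2 * (k / 2) + 1 := by omega
    have h3 : (2 * (k / 2) + 1) / 2 = k / 2 := by omega
    simp [interleave, rightName, h, h1, h2, h3]

theorem interleave_even {α : Type*} (a c : ℕ → α) : interleave a c ∘ (fun k => 2 * k) = a := by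
  funext k; simp [interleave]

theorem interleave_odd {α : Type*} (a c : ℕ → α) : interleave a c ∘ (fun k => 2 * k + 1) = c := by
  funext k
  have h1 : (2 * k + 1) % 2 ≠ 0 := by omega
  have h2 : (2 * k + 1) / 2 = k := by omega
  simp [interleave, h2]

theorem IsTerm.join {f g : (ℕ → M.Num) → M.Num} (hf : IsTerm M f) (hg : IsTerm M g) :
    ∃ (c : ℕ → M.Num) (s : ℕ → M.Str) (t u : NTerm),
      (∀ a, f a = t.eval M (interleave a c) s) ∧ ∀ a, g a = u.eval M (interleave a c) s := by
  obtain ⟨c₁, s₁, t₁, h₁⟩ := hf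
  obtain ⟨c₂, s₂, t₂, h₂⟩ := hg
  refine ⟨interleave c₁ c₂, interleave s₁ s₂, t₁.rename leftName (fun k => 2 * k),
    t₂.rename rightName (fun k => 2 * k + 1), fun a => ?_, fun a => ?_⟩
  · rw [NTerm.eval_rename, interleave_leftName, interleave_even, h₁]
  · rw [NTerm.eval_rename, interleave_rightName, interleave_odd, h₂]

theorem IsTerm.var (k : ℕ) : IsTerm M (fun a => a k) :=
  ⟨fun _ => M.zero, fun _ => M.str_nonempty.some, .var (2 * k), fun a => by
    simp [NTerm.eval, interleave]⟩

theorem IsTerm.const (x : M.Num) : IsTerm M (fun _ => x) :=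
  ⟨fun _ => x, fun _ => M.str_nonempty.some, .var 1, fun a => by
    simp [NTerm.eval, interleave]⟩

theorem IsTerm.add {f g : (ℕ → M.Num) → M.Num} (hf : IsTerm M f) (hg : IsTerm M g) :
    IsTerm M (fun a => f a + g a) := by
  obtain ⟨c, s, t, u, h₁, h₂⟩ := hf.join hg
  exact ⟨c, s, .add t u, fun a => by simp only [h₁, h₂]; rfl⟩

theorem IsTerm.mul {f g : (ℕ → M.Num) → M.Num} (hf : IsTerm M f) (hg : IsTerm M g) :
    IsTerm M (fun a => f a * g a) := by
  obtain ⟨c, s, t, u, h₁, h₂⟩ := hf.join hg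
  exact ⟨c, s, .mul t u, fun a => by simp only [h₁, h₂]; rfl⟩

theorem IsSig.le {f g : (ℕ → M.Num) → M.Num} (hf : IsTerm M f) (hg : IsTerm M g) :
    IsSig M (fun a => f a ≤ g a) := by
  obtain ⟨c, s, t, u, h₁, h₂⟩ := hf.join hg
  exact ⟨c, s, .le t u, .le _ _, fun a => by simp only [h₁, h₂]; rfl⟩

theorem IsSig.eq {f g : (ℕ → M.Num) → M.Num} (hf : IsTerm M f) (hg : IsTerm M g) :
    IsSig M (fun a => f a = g a) := by
  obtain ⟨c, s, t, u, h₁, h₂⟩ := hf.join hg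
  exact ⟨c, s, .eqN t u, .eqN _ _, fun a => by simp only [h₁, h₂]; rfl⟩

theorem IsSig.mem {f : (ℕ → M.Num) → M.Num} (hf : IsTerm M f) (X : M.Str) :
    IsSig M (fun a => M.mem (f a) X) := by
  obtain ⟨c, s, t, h⟩ := hf
  refine ⟨c, consSeq X s, .mem (t.rename id Nat.succ) 0, .mem _ _, fun a => ?_⟩
  simp only [h, Formula.Sat, NTerm.eval_rename]
  rfl

theorem IsSig.not {P : (ℕ → M.Num) → Prop} (hP : IsSig M P) : IsSig M (fun a => ¬ P a) := by
  obtain ⟨c, s, φ, hφ, h⟩ := hP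
  exact ⟨c, s, .neg φ, .neg hφ, fun a => by simp only [h]; rfl⟩

theorem IsSig.and {P Q : (ℕ → M.Num) → Prop} (hP : IsSig M P) (hQ : IsSig M Q) :
    IsSig M (fun a => P a ∧ Q a) := by
  obtain ⟨c₁, s₁, φ₁, hφ₁, h₁⟩ := hP
  obtain ⟨c₂, s₂, φ₂, hφ₂, h₂⟩ := hQ
  refine ⟨interleave c₁ c₂, interleave s₁ s₂, (φ₁.rename leftName (fun k => 2 * k)).and
    (φ₂.rename rightName (fun k => 2 * k + 1)),
    (hφ₁.rename leftName_injective).and (hφ₂.rename rightName_injective), fun a => ?_⟩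
  rw [Formula.Sat, Formula.sat_rename _ leftName_injective two_mul_injective,
    Formula.sat_rename _ rightName_injective two_mul_add_one_injective, interleave_leftName,
    interleave_rightName, interleave_even, interleave_odd, ← h₁, ← h₂]

theorem IsSig.congr {P Q : (ℕ → M.Num) → Prop} (hP : IsSig M P) (h : ∀ a, Q a ↔ P a) :
    IsSig M Q := by
  rwa [show Q = P from funext fun a => propext (h a)]

theorem IsSig.or {P Q : (ℕ → M.Num) → Prop} (hP : IsSig M P) (hQ : IsSig M Q) :
    IsSig M (fun a => P a ∨ Q a) :=
  (hP.not.and hQ.not).not.congr fun a => by tauto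

theorem IsSig.imp {P Q : (ℕ → M.Num) → Prop} (hP : IsSig M P) (hQ : IsSig M Q) :
    IsSig M (fun a => P a → Q a) :=
  (hP.and hQ.not).not.congr fun a => by tauto

theorem IsSig.iff {P Q : (ℕ → M.Num) → Prop} (hP : IsSig M P) (hQ : IsSig M Q) :
    IsSig M (fun a => P a ↔ Q a) :=
  ((hP.imp hQ).and (hQ.imp hP)).congr fun a => by tauto

/-- The renaming that turns the variable with name `0` into a new one with name `1`. -/
def boundName (k : ℕ) : ℕ := if k % 2 = 0 then (if k = 0 then 1 else k - 2) else k + 2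

theorem boundName_injective : boundName.Injective := by
  intro a b h; unfold boundName at h; split_ifs at h <;> omega

/-- A de Bruijn convention: in the hypothesis on `P` the bound variable is argument 0 and the other
arguments are moved up by one. -/
theorem IsSig.ball {P : (ℕ → M.Num) → M.Num → Prop} {f : (ℕ → M.Num) → M.Num}
    (hf : IsTerm M f) (hP : IsSig M (fun b => P (fun k => b (k + 1)) (b 0))) :
    IsSig M (fun a => ∀ x ≤ f a, P a x) := by
  obtain ⟨c₁, s₁, t, ht⟩ := hf
  obtain ⟨c₂, s₂, φ, hφ, h⟩ := hP
  have hinj : (boundName ∘ rightName).Injective :=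
    boundName_injective.comp rightName_injective
  have hk : (boundName ∘ leftName).Injective := boundName_injective.comp leftName_injective
  -- The parameters of the bound avoid the name 1, which is reserved for the quantified variable;
  -- its slot in the parameter sequence holds the dummy value `M.zero`.
  let g : ℕ → ℕ := fun k => if k % 2 = 0 then k else 4 * (k / 2) + 3
  have hg : ∀ a, interleave a (consSeq M.zero (interleave c₁ c₂)) ∘ g = interleave a c₁ := by
    intro a
    funext k
    by_cases h : k % 2 = 0
    · simp [interleave, g, h]
    · have h1 : (4 * (k / 2) + 3) % 2 ≠ 0 := by omega
      have h2 : (4 * (k / 2) + 3) / 2 = 2 * (k / 2) + 1 := by omega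
      simp [interleave, g, h, h1, h2]
  have h1 : (1 : ℕ) ∉ (t.rename g (fun k => 2 * k)).numVars := by
    rw [NTerm.numVars_rename]
    rintro ⟨k, -, hk⟩
    simp only [g] at hk
    split_ifs at hk <;> omega
  refine ⟨consSeq M.zero (interleave c₁ c₂), interleave s₁ s₂,
    .ballN 1 (t.rename g (fun k => 2 * k))
      (φ.rename (boundName ∘ rightName) (fun k => 2 * k + 1)),
    .ballN h1 (hφ.rename hinj), fun a => ?_⟩
  have key : ∀ x : M.Num, Function.update (interleave a (consSeq M.zero (interleave c₁ c₂))) 1 x ∘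
      (boundName ∘ rightName) = interleave (consSeq x a) c₂ := by
    intro x
    funext k
    by_cases h : k % 2 = 0
    · by_cases h0 : k = 0
      · subst h0; simp [boundName, rightName, interleave]
      · obtain ⟨m, rfl⟩ : ∃ m, k = 2 * m + 2 := ⟨k / 2 - 1, by omega⟩
        have h3 : (2 * m + 2) / 2 = m + 1 := by omega
        have h4 : (2 * m) ≠ 1 := by omega
        simp [boundName, rightName, interleave, h3, h4]
    · have h1 : (4 * (k / 2) + 3) % 2 ≠ 0 := by omega
      have h2 : (4 * (k / 2) + 5) / 2 = 2 * (k / 2) + 1 + 1 := by omega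
      have h3 : (4 * (k / 2) + 5) % 2 ≠ 0 := by omega
      have h4 : (2 * (k / 2) + 1) / 2 = k / 2 := by omega
      simp [boundName, rightName, interleave, h, h1, h2, h4]
  have heval : ∀ x : M.Num, (t.rename g (fun k => 2 * k)).eval M
      (Function.update (interleave a (consSeq M.zero (interleave c₁ c₂))) 1 x)
      (interleave s₁ s₂) = f a := by
    intro x
    rw [NTerm.eval_rename, interleave_even, ht, ← hg a]
    congr 1
    funext k
    rw [Function.comp_apply, Function.comp_apply, Function.update_of_ne]
    simp only [g]
    split_ifs <;> omega
  simp only [Formula.ballN, Formula.imp, Formula.Sat, NTerm.eval, heval,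
    Formula.sat_rename _ hinj two_mul_add_one_injective, key, interleave_odd, ← h,
    Function.update_self, consSeq_succ, consSeq_zero]
  refine forall_congr' fun x => ?_
  exact imp_iff_not_or

theorem IsSig.bex {P : (ℕ → M.Num) → M.Num → Prop} {f : (ℕ → M.Num) → M.Num}
    (hf : IsTerm M f) (hP : IsSig M (fun b => P (fun k => b (k + 1)) (b 0))) :
    IsSig M (fun a => ∃ x ≤ f a, P a x) :=
  (IsSig.ball (P := fun a x => ¬ P a x) hf hP.not).not.congr fun a => by push Not; rfl

end TwoSorted

namespace TwoSorted

variable {M : Struct}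

/-! ### Models of `2-BASIC` and `Σ^B_0`-comprehension -/

/-- Models of `2-BASIC` and `Σ^B_0`-comprehension. -/
class IsV0 (M : Struct) : Prop where
  basic : ∀ φ, Basic2 φ → M.Models φ
  comp : ∀ φ, SigmaB0Comp φ → M.Models φ

namespace IsV0

/-- Renaming frees the string name 0 for the new set and the number name 1 for its bound, so the
axiom applies to a formula with arbitrary parameters. -/
theorem comprehension [IsV0 M] {P : M.Num → Prop} (hP : IsSig M (fun a => P (a 0))) (y : M.Num) :
    ∃ X : M.Str, M.len X ≤ y ∧ ∀ z ≤ y, z ≠ y → (M.mem z X ↔ P z) := by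
  obtain ⟨c, s, φ, hφ, h⟩ := hP
  let f : ℕ → ℕ := fun k => if k = 0 then 0 else k + 1
  have hf : f.Injective := by
    intro a b h; simp only [f] at h; split_ifs at h <;> omega
  have hg : Nat.succ.Injective := Nat.succ_injective
  have hX : 0 ∉ (φ.rename f Nat.succ).freeStr := by
    rw [Formula.freeStr_rename hg]
    rintro ⟨k, -, hk⟩
    exact Nat.succ_ne_zero k hk
  let v : ℕ → M.Num := fun k => if k = 1 then y else interleave (fun _ => M.zero) c (k - 1)
  have := comp _ (.comp _ 0 1 0 (hφ.rename hf) hX one_ne_zero) v (consSeq M.str_nonempty.some s)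
  simp only [Formula.bexS, Formula.ballN, Formula.iff, Formula.imp, Formula.lt, Formula.Sat,
    NTerm.eval, Formula.sat_rename _ hf hg] at this
  obtain ⟨X, hX, h'⟩ := this
  refine ⟨X, ?_, fun z hz hzy => ?_⟩
  · simp only [v, Function.update_self, if_true] at hX
    exact hX
  have h1 := h' z
  simp only [Function.update_self, ne_eq, one_ne_zero, not_false_eq_true, Function.update_of_ne]
    at h1
  have hv : v 1 = y := by simp [v]
  have e : Function.update v 0 z ∘ f = interleave (consSeq z fun _ => M.zero) c := by
    funext k
    rcases k with _ | k
    · simp [f, interleave]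
    · by_cases hk : (k + 1) % 2 = 0
      · obtain ⟨m, hm⟩ : ∃ m, (k + 1) / 2 = m + 1 := ⟨(k + 1) / 2 - 1, by omega⟩
        simp [f, v, interleave, hk, hm]
      · simp [f, v, interleave, hk]
  have e' : Function.update (consSeq M.str_nonempty.some s) 0 X ∘ Nat.succ = s := by
    funext k
    simp [consSeq]
  rw [e, e', ← h, hv] at h1
  simp only [consSeq_zero] at h1
  have hz' : M.le z y := hz
  tauto

/-- The axiom `φ` under the assignment of `x`, `y` to the number variables `0`, `1`, and of `X`,
`Y` to the string variables `0`, `1`. -/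
theorem basic_sat [IsV0 M] {φ : Formula} (h : Basic2 φ) (x y : M.Num) (X Y : M.Str) :
    φ.Sat M (consSeq x fun _ => y) (consSeq X fun _ => Y) := basic φ h _ _

section

variable [IsV0 M]

open Formula

theorem raw_succ_ne_zero (x : M.Num) : x + 1 ≠ 0 :=
  basic_sat .B1 x x M.str_nonempty.some M.str_nonempty.some

theorem raw_succ_inj {x y : M.Num} (h : x + 1 = y + 1) : x = y :=
  (basic_sat .B2 x y M.str_nonempty.some M.str_nonempty.some).resolve_left (not_not.2 h)

theorem raw_add_zero (x : M.Num) : x + 0 = x :=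
  basic_sat .B3 x x M.str_nonempty.some M.str_nonempty.some

theorem raw_add_succ (x y : M.Num) : x + (y + 1) = x + y + 1 :=
  basic_sat .B4 x y M.str_nonempty.some M.str_nonempty.some

theorem raw_mul_zero (x : M.Num) : x * 0 = 0 :=
  basic_sat .B5 x x M.str_nonempty.some M.str_nonempty.some

theorem raw_mul_succ (x y : M.Num) : x * (y + 1) = x * y + x :=
  basic_sat .B6 x y M.str_nonempty.some M.str_nonempty.some

theorem raw_le_antisymm {x y : M.Num} (h : x ≤ y) (h' : y ≤ x) : x = y :=
  (basic_sat .B7 x y M.str_nonempty.some M.str_nonempty.some).resolve_left (not_not.2 ⟨h, h'⟩)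

theorem raw_le_add (x y : M.Num) : x ≤ x + y :=
  basic_sat .B8 x y M.str_nonempty.some M.str_nonempty.some

theorem raw_zero_le (x : M.Num) : 0 ≤ x :=
  basic_sat .B9 x x M.str_nonempty.some M.str_nonempty.some

theorem raw_le_total (x y : M.Num) : x ≤ y ∨ y ≤ x :=
  basic_sat .B10 x y M.str_nonempty.some M.str_nonempty.some

theorem raw_le_succ {x y : M.Num} (h : x ≤ y) : x ≤ y + 1 ∧ x ≠ y + 1 :=
  (basic_sat .B11 x y M.str_nonempty.some M.str_nonempty.some).1.resolve_left (not_not.2 h)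

theorem raw_le_of_lt_succ {x y : M.Num} (h : x ≤ y + 1) (h' : x ≠ y + 1) : x ≤ y :=
  (basic_sat .B11 x y M.str_nonempty.some M.str_nonempty.some).2.resolve_left
    (not_not.2 ⟨h, h'⟩)

theorem raw_exists_pred {x : M.Num} (h : x ≠ 0) : ∃ w, w + 1 = x := by
  obtain ⟨w, -, hw⟩ := (basic_sat .B12 x x M.str_nonempty.some M.str_nonempty.some).resolve_left
    (not_not.2 h)
  exact ⟨w, hw⟩

theorem raw_mem_lt {x : M.Num} {X : M.Str} (h : M.mem x X) : x ≤ M.len X ∧ x ≠ M.len X :=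
  (basic_sat .L1 x x X X).resolve_left (not_not.2 h)

theorem raw_mem_of_succ_eq {x : M.Num} {X : M.Str} (h : x + 1 = M.len X) : M.mem x X :=
  (basic_sat .L2 x x X X).resolve_left (not_not.2 h)

theorem raw_ext {X Y : M.Str} (h : M.len X = M.len Y)
    (h' : ∀ x ≤ M.len X, x ≠ M.len X → (M.mem x X ↔ M.mem x Y)) : X = Y := by
  refine (basic_sat .SE M.zero M.zero X Y).resolve_left (not_not.2 ⟨h, fun x => ?_⟩)
  have := h' x
  change (¬ x ≤ M.len X) ∨ (¬ (x ≤ M.len X ∧ x ≠ M.len X) ∨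
    ((¬ M.mem x X ∨ M.mem x Y) ∧ (¬ M.mem x Y ∨ M.mem x X)))
  tauto

theorem raw_le_refl (x : M.Num) : x ≤ x := (raw_le_total x x).elim id id

theorem raw_le_of_succ_le_succ {x y : M.Num} (h : x + 1 ≤ y + 1) : x ≤ y := by
  rcases raw_le_total x y with h1 | h1
  · exact h1
  by_cases h2 : x + 1 = y + 1
  · rw [raw_succ_inj h2]; exact raw_le_refl y
  obtain ⟨h3, h4⟩ := raw_le_succ h1
  exact absurd (raw_le_antisymm h3 (raw_le_of_lt_succ h h2)) h4

theorem raw_succ_le {x y : M.Num} (h : x ≤ y) (hne : x ≠ y) : x + 1 ≤ y := by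
  rcases raw_le_total (x + 1) y with h1 | h1
  · exact h1
  by_cases h2 : y = x + 1
  · rw [h2]; exact raw_le_refl _
  · exact absurd (raw_le_antisymm h (raw_le_of_lt_succ h1 h2)) hne

/-- Comprehension gives the set of all z ≤ x such that P holds up to z. By L2 the predecessor w of
its length is an element. If w ≠ x, then w + 1 is an element as well, although it equals the length.
-/
theorem induction {P : M.Num → Prop} (hP : IsSig M (fun a => P (a 0))) (zero : P 0)
    (succ : ∀ x, P x → P (x + 1)) (x : M.Num) : P x := by
  obtain ⟨X, hX, h⟩ := comprehension (P := fun z => ∀ u ≤ z, P u)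
    (.ball (P := fun _ x => P x) (.var 0) hP) (x + 1)
  have h0 : M.mem 0 X := by
    refine (h 0 (raw_zero_le _) (raw_succ_ne_zero x).symm).2 fun u hu => ?_
    rwa [raw_le_antisymm hu (raw_zero_le u)]
  obtain ⟨w, hw⟩ : ∃ w, w + 1 = M.len X := raw_exists_pred fun h1 => by
    obtain ⟨h2, h3⟩ := raw_mem_lt h0
    exact h3 h1.symm
  have hwX : M.mem w X := raw_mem_of_succ_eq hw
  rw [← hw] at hX
  have hwx := raw_le_of_succ_le_succ hX
  have hw' := (h w (raw_le_succ hwx).1 (raw_le_succ hwx).2).1 hwX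
  by_cases hne : w = x
  · exact hne ▸ hw' w (raw_le_refl w)
  have h1 := raw_le_succ (raw_succ_le hwx hne)
  have h2 : M.mem (w + 1) X := by
    refine (h _ h1.1 h1.2).2 fun u hu => ?_
    by_cases hu' : u = w + 1
    · exact hu' ▸ succ w (hw' w (raw_le_refl w))
    · exact hw' u (raw_le_of_lt_succ hu hu')
  exact absurd hw (raw_mem_lt h2).2

/-! ### The laws of an ordered commutative semiring -/

theorem raw_zero_add (x : M.Num) : 0 + x = x :=
  induction (P := fun x => 0 + x = x) (.eq (.add (.const 0) (.var 0)) (.var 0))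
    (raw_add_zero 0) (fun x h => by rw [raw_add_succ, h]) x

theorem raw_add_assoc (x y z : M.Num) : x + y + z = x + (y + z) :=
  induction (P := fun z => x + y + z = x + (y + z))
    (.eq (.add (.add (.const x) (.const y)) (.var 0))
      (.add (.const x) (.add (.const y) (.var 0))))
    (by rw [raw_add_zero, raw_add_zero])
    (fun z h => by rw [raw_add_succ, h, raw_add_succ, raw_add_succ]) z

theorem raw_one_add (x : M.Num) : 1 + x = x + 1 :=
  induction (P := fun x => 1 + x = x + 1)
    (.eq (.add (.const 1) (.var 0)) (.add (.var 0) (.const 1)))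
    (by rw [raw_add_zero, raw_zero_add]) (fun x h => by rw [raw_add_succ, h]) x

theorem raw_add_comm (x y : M.Num) : x + y = y + x :=
  induction (P := fun y => x + y = y + x)
    (.eq (.add (.const x) (.var 0)) (.add (.var 0) (.const x)))
    (by rw [raw_add_zero, raw_zero_add])
    (fun y h => by rw [raw_add_succ, h, raw_add_assoc y 1 x, raw_one_add, raw_add_assoc]) y

theorem raw_add_right_cancel {x y z : M.Num} (h : x + z = y + z) : x = y :=
  induction (P := fun z => x + z = y + z → x = y)
    (.imp (.eq (.add (.const x) (.var 0)) (.add (.const y) (.var 0)))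
      (.eq (.const x) (.const y)))
    (by rw [raw_add_zero, raw_add_zero]; exact id)
    (fun z ih h => ih (by rw [raw_add_succ, raw_add_succ] at h; exact raw_succ_inj h)) z h

theorem raw_mul_add (x y z : M.Num) : x * (y + z) = x * y + x * z :=
  induction (P := fun z => x * (y + z) = x * y + x * z)
    (.eq (.mul (.const x) (.add (.const y) (.var 0)))
      (.add (.mul (.const x) (.const y)) (.mul (.const x) (.var 0))))
    (by rw [raw_add_zero, raw_mul_zero, raw_add_zero])
    (fun z h => by rw [raw_add_succ, raw_mul_succ, h, raw_mul_succ, raw_add_assoc]) z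

theorem raw_mul_assoc (x y z : M.Num) : x * y * z = x * (y * z) :=
  induction (P := fun z => x * y * z = x * (y * z))
    (.eq (.mul (.mul (.const x) (.const y)) (.var 0))
      (.mul (.const x) (.mul (.const y) (.var 0))))
    (by rw [raw_mul_zero, raw_mul_zero, raw_mul_zero])
    (fun z h => by rw [raw_mul_succ, h, raw_mul_succ, raw_mul_add]) z

theorem raw_zero_mul (x : M.Num) : 0 * x = 0 :=
  induction (P := fun x => 0 * x = 0) (.eq (.mul (.const 0) (.var 0)) (.const 0))
    (raw_mul_zero 0) (fun x h => by rw [raw_mul_succ, h, raw_add_zero]) x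

theorem raw_mul_one (x : M.Num) : x * 1 = x := by
  rw [← raw_zero_add 1, raw_mul_succ, raw_mul_zero, raw_zero_add]

theorem raw_succ_mul (x y : M.Num) : (x + 1) * y = x * y + y :=
  induction (P := fun y => (x + 1) * y = x * y + y)
    (.eq (.mul (.add (.const x) (.const 1)) (.var 0))
      (.add (.mul (.const x) (.var 0)) (.var 0)))
    (by rw [raw_mul_zero, raw_mul_zero, raw_add_zero])
    (fun y h => by
      rw [raw_mul_succ, h, raw_mul_succ, raw_add_assoc, raw_add_assoc, ← raw_add_assoc y x 1,
        ← raw_add_assoc x y 1, raw_add_comm x y]) y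

theorem raw_mul_comm (x y : M.Num) : x * y = y * x :=
  induction (P := fun y => x * y = y * x)
    (.eq (.mul (.const x) (.var 0)) (.mul (.var 0) (.const x)))
    (by rw [raw_mul_zero, raw_zero_mul])
    (fun y h => by rw [raw_mul_succ, h, raw_succ_mul]) y

noncomputable instance : CommSemiring M.Num where
  add_assoc := raw_add_assoc
  zero_add := raw_zero_add
  add_zero := raw_add_zero
  add_comm := raw_add_comm
  left_distrib := raw_mul_add
  right_distrib x y z := by rw [raw_mul_comm, raw_mul_add, raw_mul_comm z x, raw_mul_comm z y]
  zero_mul := raw_zero_mul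
  mul_zero := raw_mul_zero
  mul_assoc := raw_mul_assoc
  one_mul x := by rw [raw_mul_comm]; exact raw_mul_one x
  mul_one := raw_mul_one
  mul_comm := raw_mul_comm
  nsmul := nsmulRec

/-- Subtraction, by induction on y. The witness is bounded by y to keep the induction formula
`Σ^B_0`. -/
theorem raw_exists_add {x y : M.Num} (h : x ≤ y) : ∃ z, x + z = y := by
  obtain ⟨z, -, hz⟩ := induction (P := fun y => ∀ x ≤ y, ∃ z ≤ y, x + z = y)
    (.ball (P := fun a x => ∃ z ≤ a 0, x + z = a 0) (.var 0)
      (.bex (P := fun a z => a 0 + z = a 1) (.var 1) (.eq (.add (.var 1) (.var 0)) (.var 2))))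
    (fun x hx => ⟨0, raw_le_refl 0, by
      rw [raw_le_antisymm hx (raw_zero_le x)]; exact raw_add_zero 0⟩)
    (fun y ih x hx => by
      by_cases hxy : x = y + 1
      · exact ⟨0, raw_zero_le _, by rw [hxy]; exact raw_add_zero _⟩
      · obtain ⟨z, hz, rfl⟩ := ih x (raw_le_of_lt_succ hx hxy)
        refine ⟨z + 1, ?_, (raw_add_assoc _ _ _).symm⟩
        rw [raw_add_comm x z, raw_add_assoc, raw_add_comm x 1, ← raw_add_assoc]
        exact raw_le_add _ _) y x h
  exact ⟨z, hz⟩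

noncomputable instance : LinearOrder M.Num where
  le_refl := raw_le_refl
  le_trans x y z hxy hyz := by
    obtain ⟨u, rfl⟩ := raw_exists_add hxy
    obtain ⟨w, rfl⟩ := raw_exists_add hyz
    rw [raw_add_assoc]
    exact raw_le_add _ _
  le_antisymm _ _ := raw_le_antisymm
  le_total := raw_le_total
  toDecidableLE := Classical.decRel _

instance : IsOrderedCancelAddMonoid M.Num where
  add_le_add_left x y h z := by
    obtain ⟨u, rfl⟩ := raw_exists_add h
    rw [add_right_comm]
    exact raw_le_add _ _
  le_of_add_le_add_left x y z h := by
    obtain ⟨u, hu⟩ := raw_exists_add h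
    rw [add_assoc, add_comm x, add_comm x] at hu
    rw [← raw_add_right_cancel hu]
    exact raw_le_add _ _

instance : CanonicallyOrderedAdd M.Num where
  le_self_add := raw_le_add
  le_add_self x y := by rw [add_comm]; exact raw_le_add _ _
  exists_add_of_le h := by obtain ⟨z, hz⟩ := raw_exists_add h; exact ⟨z, hz.symm⟩

theorem lt_add_one_iff {x y : M.Num} : x < y + 1 ↔ x ≤ y :=
  ⟨fun h => raw_le_of_lt_succ h.le h.ne, fun h => lt_of_le_of_ne (raw_le_succ h).1
    (raw_le_succ h).2⟩

theorem add_one_le_iff {x y : M.Num} : x + 1 ≤ y ↔ x < y :=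
  ⟨fun h => lt_of_lt_of_le (lt_add_one_iff.2 le_rfl) h, fun h => raw_succ_le h.le h.ne⟩

instance : IsOrderedRing M.Num where
  zero_le_one := raw_zero_le 1
  mul_le_mul_of_nonneg_left x _ y z h := by
    obtain ⟨u, rfl⟩ := raw_exists_add h
    change x * y ≤ x * (y + u)
    rw [mul_add]
    exact raw_le_add _ _
  mul_le_mul_of_nonneg_right x _ y z h := by
    obtain ⟨u, rfl⟩ := raw_exists_add h
    change y * x ≤ (y + u) * x
    rw [add_mul]
    exact raw_le_add _ _

theorem mem_lt {x : M.Num} {X : M.Str} (h : M.mem x X) : x < M.len X :=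
  lt_of_le_of_ne (raw_mem_lt h).1 (raw_mem_lt h).2

/-- The extensionality axiom also asks for equal lengths. These follow from equal elements, because
the predecessor of a nonzero length is an element. -/
theorem str_ext {X Y : M.Str} (h : ∀ x, M.mem x X ↔ M.mem x Y) : X = Y := by
  have key : ∀ {X Y : M.Str}, (∀ x, M.mem x X ↔ M.mem x Y) → M.len X ≤ M.len Y := by
    intro X Y h
    by_cases h0 : M.len X = 0
    · rw [h0]; exact zero_le
    · obtain ⟨w, hw⟩ := raw_exists_pred h0
      rw [← hw]
      exact add_one_le_iff.2 (mem_lt ((h w).1 (raw_mem_of_succ_eq hw)))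
  exact raw_ext (le_antisymm (key h) (key fun x => (h x).symm)) fun x _ _ => h x

theorem strong_induction {P : M.Num → Prop} (hP : IsSig M (fun a => P (a 0)))
    (step : ∀ x, (∀ y < x, P y) → P x) (x : M.Num) : P x :=
  induction (P := fun x => ∀ u ≤ x, P u) (.ball (P := fun _ x => P x) (.var 0) hP)
    (fun u hu => step u fun y hy => absurd (hy.trans_le hu) (not_lt.2 zero_le))
    (fun x ih u hu => by
      rcases hu.lt_or_eq with h | rfl
      · exact ih u (lt_add_one_iff.1 h)
      · exact step _ fun y hy => ih y (lt_add_one_iff.1 hy)) x x le_rfl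

theorem comprehension' {P : M.Num → Prop} (hP : IsSig M (fun a => P (a 0))) (y : M.Num) :
    ∃ X : M.Str, M.len X ≤ y ∧ ∀ z, M.mem z X ↔ z < y ∧ P z := by
  obtain ⟨X, hX, h⟩ := comprehension hP y
  refine ⟨X, hX, fun z => ⟨fun hz => ?_, fun ⟨hz, hP⟩ => (h z hz.le hz.ne).2 hP⟩⟩
  have hzy := (mem_lt hz).trans_le hX
  exact ⟨hzy, (h z hzy.le hzy.ne).1 hz⟩

end

end IsV0

end TwoSorted

namespace TwoSorted

/-! ### The arithmetic of `isPowSeq`, as relations between predicates -/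

section Semantics

variable {R : Type} [Zero R] [One R] [Add R] [Mul R] [LE R]

/-- These relations need only the operations of the vocabulary, so they make sense in a structure
not known to be ordered and also over ℕ. Strict order is therefore spelled out as in the formulas.
-/
def slt (x y : R) : Prop := x ≤ y ∧ x ≠ y

def spair (x y : R) : R := (x + y) * (x + y + 1) + (1 + 1) * y

def srow (A : R → Prop) (i : R) : R → Prop := fun x => A (spair i x)

def sIsZero (b : R) (A : R → Prop) : Prop := ∀ x ≤ b, ¬ A x

def sSameBits (b : R) (A C : R → Prop) : Prop := ∀ x ≤ b, (A x ↔ C x)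

def sCarry (A C : R → Prop) (x : R) : Prop :=
  ∃ k ≤ x, slt k x ∧ (A k ∧ C k) ∧ ∀ j ≤ x, slt j x → slt k j → A j ∨ C j

def sIsSum (b : R) (A C E : R → Prop) : Prop :=
  ∀ x ≤ b, (E x ↔ ¬ (¬ (A x ↔ C x) ↔ sCarry A C x))

def sShift (A : R → Prop) (i : R) : R → Prop := fun x => ∃ y ≤ x, y + i = x ∧ A y

def sIsMulRun (b m : R) (A C : R → Prop) (W : R → R → Prop) : Prop :=
  sIsZero b (W 0) ∧ ∀ i ≤ m, slt i m →
    (C i → sIsSum b (W i) (sShift A i) (W (i + 1))) ∧ (¬ C i → sSameBits b (W i) (W (i + 1)))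

/-- The sign and the digits of the absolute value of an integer. -/
structure SInt (R : Type) where
  neg : Prop
  abs : R → Prop

def sInt (A : R → Prop) : SInt R := ⟨A 0, fun x => A (x + 1)⟩

def sIsIntSum (b : R) (A C E : SInt R) : Prop :=
  ((A.neg ↔ C.neg) ∧ sIsSum b A.abs C.abs E.abs ∧ (E.neg ↔ A.neg ∧ ¬ sIsZero b E.abs)) ∨
    (¬ (A.neg ↔ C.neg) ∧
      ((sIsSum b E.abs C.abs A.abs ∧ (E.neg ↔ A.neg ∧ ¬ sIsZero b E.abs)) ∨
        (sIsSum b E.abs A.abs C.abs ∧ (E.neg ↔ C.neg ∧ ¬ sIsZero b E.abs))))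

def sIsPowSeq (b lx n k : R) (X Y S U : R → Prop) : Prop :=
  let x (i j : R) : R → Prop := srow (srow X i) j
  let y (i a c : R) : R → Prop := srow (srow (srow Y i) a) c
  let s (i a c l : R) : R → Prop := srow (srow (srow (srow S i) a) c) l
  let u (i a c l m : R) : R → Prop := srow (srow (srow (srow (srow U i) a) c) l) m
  (∀ a ≤ n, slt a n → ∀ c ≤ n, slt c n → ∀ z ≤ b, (y 0 a c z ↔ a = c ∧ z = 1)) ∧
    ∀ i ≤ k, slt i k → ∀ a ≤ n, slt a n → ∀ c ≤ n, slt c n →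
      sIsZero b (s i a c 0) ∧
        (∀ l ≤ n, slt l n →
          sIsMulRun b lx (sInt (y i a l)).abs (sInt (x l c)).abs (u i a c l) ∧
            sIsIntSum b (sInt (s i a c l))
              ⟨¬ ((sInt (y i a l)).neg ↔ (sInt (x l c)).neg), u i a c l lx⟩
              (sInt (s i a c (l + 1)))) ∧
        sSameBits b (y (i + 1) a c) (s i a c n)

end Semantics

/-! ### The meaning of formulas with a supply of fresh variables -/

section Denotation

variable {M : Struct}

/-- A bound for the names of the number variables in use, with their values. -/
structure World (M : Struct) where
  next : ℕ
  val : ℕ → M.Num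

/-- Worlds are ordered as in Kripke semantics: a later world has more names in use and keeps the old
values. Meanings are required at all later worlds, so a formula can be placed under further
quantifiers without capture. -/
instance : LE (World M) := ⟨fun w w' => w.next ≤ w'.next ∧ ∀ k < w.next, w'.val k = w.val k⟩

theorem World.le_refl (w : World M) : w ≤ w := ⟨le_rfl, fun _ _ => rfl⟩

theorem World.le_trans {w₁ w₂ w₃ : World M} (h : w₁ ≤ w₂) (h' : w₂ ≤ w₃) : w₁ ≤ w₃ :=
  ⟨h.1.trans h'.1, fun k hk => (h'.2 k (hk.trans_le h.1)).trans (h.2 k hk)⟩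

variable (J : Set ℕ) (s : ℕ → M.Str)

/-- The term `t` uses variables of the world `w` and strings from `J`, and has the value `x`. -/
def DenT (w : World M) (t : NTerm) (x : M.Num) : Prop :=
  t.numVars ⊆ Set.Iio w.next ∧ t.strVars ⊆ J ∧ t.eval M w.val s = x

/-- In the world `w`, the formula `φ` is a `Σ^B_0` formula that says `P`. -/
def DenF (w : World M) (φ : FB) (P : Prop) : Prop :=
  ∀ w' ≥ w, ∀ j, (φ w'.next j).IsSigmaB0 ∧ (φ w'.next j).freeNum ⊆ Set.Iio w'.next ∧
    (φ w'.next j).freeStr ⊆ J ∧ ((φ w'.next j).Sat M w'.val s ↔ P)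

/-- In the world `w`, the formula `a t` says `A x`, where `x` is the value of `t`. -/
def DenB (w : World M) (a : Bits) (A : M.Num → Prop) : Prop :=
  ∀ w' ≥ w, ∀ t x, DenT J s w' t x → DenF J s w' (a t) (A x)

variable {J s} {w w' : World M}

theorem NTerm.eval_congr (s : ℕ → M.Str) {v v' : ℕ → M.Num} {t : NTerm}
    (h : ∀ k ∈ t.numVars, v' k = v k) : t.eval M v' s = t.eval M v s := by
  induction t with
  | var x => exact h x rfl
  | zero => rfl
  | one => rfl
  | add t u iht ihu =>
    exact congrArg₂ M.add (iht fun k hk => h k (.inl hk)) (ihu fun k hk => h k (.inr hk))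
  | mul t u iht ihu =>
    exact congrArg₂ M.mul (iht fun k hk => h k (.inl hk)) (ihu fun k hk => h k (.inr hk))
  | len X => rfl

theorem DenT.mono {t : NTerm} {x : M.Num} (h : DenT J s w t x) (hw : w ≤ w') :
    DenT J s w' t x := by
  refine ⟨h.1.trans (Set.Iio_subset_Iio hw.1), h.2.1, ?_⟩
  rw [← h.2.2]
  exact NTerm.eval_congr s fun k hk => hw.2 k (h.1 hk)

theorem DenB.mono {a : Bits} {A : M.Num → Prop} (h : DenB J s w a A) (hw : w ≤ w') :
    DenB J s w' a A :=
  fun w'' hw'' => h w'' (World.le_trans hw hw'')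

theorem DenB.apply {a : Bits} {A : M.Num → Prop} (h : DenB J s w a A) {t : NTerm} {x : M.Num}
    (ht : DenT J s w t x) : DenF J s w (a t) (A x) :=
  h w w.le_refl t x ht

theorem DenT.zero : DenT J s w 0 (0 : M.Num) :=
  ⟨Set.empty_subset _, Set.empty_subset _, rfl⟩

theorem DenT.one : DenT J s w 1 (1 : M.Num) :=
  ⟨Set.empty_subset _, Set.empty_subset _, rfl⟩

theorem DenT.add {t u : NTerm} {x y : M.Num} (ht : DenT J s w t x) (hu : DenT J s w u y) :
    DenT J s w (t + u) (x + y) :=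
  ⟨Set.union_subset ht.1 hu.1, Set.union_subset ht.2.1 hu.2.1,
    congrArg₂ M.add ht.2.2 hu.2.2⟩

theorem DenT.mul {t u : NTerm} {x y : M.Num} (ht : DenT J s w t x) (hu : DenT J s w u y) :
    DenT J s w (t * u) (x * y) :=
  ⟨Set.union_subset ht.1 hu.1, Set.union_subset ht.2.1 hu.2.1,
    congrArg₂ M.mul ht.2.2 hu.2.2⟩

theorem DenT.len {X : ℕ} (hX : X ∈ J) : DenT J s w (.len X) (M.len (s X)) :=
  ⟨Set.empty_subset _, Set.singleton_subset_iff.2 hX, rfl⟩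

theorem DenT.pair {t u : NTerm} {x y : M.Num} (ht : DenT J s w t x) (hu : DenT J s w u y) :
    DenT J s w (t.pair u) (spair x y) :=
  ((ht.add hu).mul ((ht.add hu).add .one)).add ((DenT.one.add .one).mul hu)

theorem DenF.eq {t u : NTerm} {x y : M.Num} (ht : DenT J s w t x) (hu : DenT J s w u y) :
    DenF J s w (FB.eq t u) (x = y) := by
  intro w' hw j
  have ht' := ht.mono hw
  have hu' := hu.mono hw
  refine ⟨.eqN _ _, Set.union_subset ht'.1 hu'.1, Set.union_subset ht'.2.1 hu'.2.1, ?_⟩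
  rw [FB.eq, Formula.Sat, ht'.2.2, hu'.2.2]

theorem DenF.le {t u : NTerm} {x y : M.Num} (ht : DenT J s w t x) (hu : DenT J s w u y) :
    DenF J s w (FB.le t u) (x ≤ y) := by
  intro w' hw j
  have ht' := ht.mono hw
  have hu' := hu.mono hw
  refine ⟨.le _ _, Set.union_subset ht'.1 hu'.1, Set.union_subset ht'.2.1 hu'.2.1, ?_⟩
  rw [FB.le, Formula.Sat, ht'.2.2, hu'.2.2]
  rfl

theorem DenF.mem {t : NTerm} {x : M.Num} {X : ℕ} (ht : DenT J s w t x) (hX : X ∈ J) :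
    DenF J s w (FB.mem t X) (M.mem x (s X)) := by
  intro w' hw j
  have ht' := ht.mono hw
  refine ⟨.mem _ _, ht'.1, Set.union_subset ht'.2.1 (Set.singleton_subset_iff.2 hX), ?_⟩
  rw [FB.mem, Formula.Sat, ht'.2.2]

theorem DenF.not {φ : FB} {P : Prop} (h : DenF J s w φ P) : DenF J s w φ.not (¬ P) := by
  intro w' hw j
  obtain ⟨h1, h2, h3, h4⟩ := h w' hw j
  exact ⟨.neg h1, h2, h3, not_congr h4⟩

theorem DenF.and {φ ψ : FB} {P Q : Prop} (h : DenF J s w φ P) (h' : DenF J s w ψ Q) :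
    DenF J s w (φ.and ψ) (P ∧ Q) := by
  intro w' hw j
  obtain ⟨h1, h2, h3, h4⟩ := h w' hw j
  obtain ⟨h1', h2', h3', h4'⟩ := h' w' hw j
  exact ⟨.and h1 h1', Set.union_subset h2 h2', Set.union_subset h3 h3', and_congr h4 h4'⟩

theorem DenF.or {φ ψ : FB} {P Q : Prop} (h : DenF J s w φ P) (h' : DenF J s w ψ Q) :
    DenF J s w (φ.or ψ) (P ∨ Q) := by
  intro w' hw j
  obtain ⟨h1, h2, h3, h4⟩ := h w' hw j
  obtain ⟨h1', h2', h3', h4'⟩ := h' w' hw j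
  exact ⟨.or h1 h1', Set.union_subset h2 h2', Set.union_subset h3 h3', or_congr h4 h4'⟩

theorem DenF.congr {φ : FB} {P Q : Prop} (h : DenF J s w φ P) (hPQ : P ↔ Q) :
    DenF J s w φ Q := propext hPQ ▸ h

theorem DenF.imp {φ ψ : FB} {P Q : Prop} (h : DenF J s w φ P) (h' : DenF J s w ψ Q) :
    DenF J s w (φ.imp ψ) (P → Q) :=
  DenF.congr (h.not.or h') imp_iff_not_or.symm

theorem DenF.iff {φ ψ : FB} {P Q : Prop} (h : DenF J s w φ P) (h' : DenF J s w ψ Q) :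
    DenF J s w (φ.iff ψ) (P ↔ Q) :=
  DenF.congr ((h.imp h').and (h'.imp h)) iff_iff_implies_and_implies.symm

theorem DenF.xor {φ ψ : FB} {P Q : Prop} (h : DenF J s w φ P) (h' : DenF J s w ψ Q) :
    DenF J s w (φ.xor ψ) (¬ (P ↔ Q)) :=
  (h.iff h').not

theorem DenF.lt {t u : NTerm} {x y : M.Num} (ht : DenT J s w t x) (hu : DenT J s w u y) :
    DenF J s w (FB.lt t u) (slt x y) :=
  (DenF.le ht hu).and (DenF.eq ht hu).not

theorem DenF.allLe {t : NTerm} {x : M.Num} {f : NTerm → FB} {P : M.Num → Prop}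
    (ht : DenT J s w t x) (hf : DenB J s w f P) :
    DenF J s w (FB.allLe t f) (∀ y ≤ x, P y) := by
  intro w' hw j
  have ht' := ht.mono hw
  have key : ∀ a : M.Num, w' ≤ ⟨w'.next + 1, Function.update w'.val w'.next a⟩ := fun a =>
    ⟨Nat.le_succ _, fun k hk => Function.update_of_ne (ne_of_lt hk) _ _⟩
  have h1 : ∀ a : M.Num, DenT J s ⟨w'.next + 1, Function.update w'.val w'.next a⟩
      (.var w'.next) a := fun a =>
    ⟨Set.singleton_subset_iff.2 (Nat.lt_succ_self _), Set.empty_subset _,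
      Function.update_self _ _ _⟩
  have h2 := fun a => hf _ (World.le_trans hw (key a)) _ _ (h1 a) _ (World.le_refl _) j
  have hn : w'.next ∉ t.numVars := fun h => (Set.mem_Iio.1 (ht'.1 h)).false
  -- The syntactic facts do not depend on the value of the bound variable; the instance at `x`
  -- serves.
  obtain ⟨h3, h4, h5, -⟩ := h2 x
  refine ⟨.ballN hn h3, ?_, ?_, ?_⟩
  · rintro k ⟨(hk | hk) | hk, hk'⟩
    · exact absurd hk hk'
    · exact ht'.1 hk
    · exact lt_of_le_of_ne (Nat.lt_succ_iff.1 (h4 hk)) hk'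
  · exact Set.union_subset (Set.union_subset (Set.empty_subset _) ht'.2.1) h5
  · refine forall_congr' fun a => ?_
    have h6 : t.eval M (Function.update w'.val w'.next a) s = x := (ht'.mono (key a)).2.2
    have h7 : NTerm.eval M (Function.update w'.val w'.next a) s (.var w'.next) = a := (h1 a).2.2
    rw [Formula.imp, Formula.Sat, Formula.Sat, Formula.Sat, h6, h7, (h2 a).2.2.2]
    exact imp_iff_not_or.symm

theorem DenF.exLe {t : NTerm} {x : M.Num} {f : NTerm → FB} {P : M.Num → Prop}
    (ht : DenT J s w t x) (hf : DenB J s w f P) :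
    DenF J s w (FB.exLe t f) (∃ y ≤ x, P y) := by
  intro w' hw j
  have ht' := ht.mono hw
  have key : ∀ a : M.Num, w' ≤ ⟨w'.next + 1, Function.update w'.val w'.next a⟩ := fun a =>
    ⟨Nat.le_succ _, fun k hk => Function.update_of_ne (ne_of_lt hk) _ _⟩
  have h1 : ∀ a : M.Num, DenT J s ⟨w'.next + 1, Function.update w'.val w'.next a⟩
      (.var w'.next) a := fun a =>
    ⟨Set.singleton_subset_iff.2 (Nat.lt_succ_self _), Set.empty_subset _,
      Function.update_self _ _ _⟩
  have h2 := fun a => hf _ (World.le_trans hw (key a)) _ _ (h1 a) _ (World.le_refl _) j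
  have hn : w'.next ∉ t.numVars := fun h => (Set.mem_Iio.1 (ht'.1 h)).false
  obtain ⟨h3, h4, h5, -⟩ := h2 x
  refine ⟨.bexN hn h3, ?_, ?_, ?_⟩
  · rintro k ⟨(hk | hk) | hk, hk'⟩
    · exact absurd hk hk'
    · exact ht'.1 hk
    · exact lt_of_le_of_ne (Nat.lt_succ_iff.1 (h4 hk)) hk'
  · exact Set.union_subset (Set.union_subset (Set.empty_subset _) ht'.2.1) h5
  · refine exists_congr fun a => ?_
    have h6 : t.eval M (Function.update w'.val w'.next a) s = x := (ht'.mono (key a)).2.2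
    have h7 : NTerm.eval M (Function.update w'.val w'.next a) s (.var w'.next) = a := (h1 a).2.2
    rw [Formula.Sat, Formula.Sat, h6, h7, (h2 a).2.2.2]
    rfl

theorem DenF.allLt {t : NTerm} {x : M.Num} {f : NTerm → FB} {P : M.Num → Prop}
    (ht : DenT J s w t x) (hf : DenB J s w f P) :
    DenF J s w (FB.allLt t f) (∀ y ≤ x, slt y x → P y) :=
  .allLe ht fun _ hw _ _ hu => (DenF.lt hu (ht.mono hw)).imp (hf _ hw _ _ hu)

theorem DenF.exLt {t : NTerm} {x : M.Num} {f : NTerm → FB} {P : M.Num → Prop}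
    (ht : DenT J s w t x) (hf : DenB J s w f P) :
    DenF J s w (FB.exLt t f) (∃ y ≤ x, slt y x ∧ P y) :=
  .exLe ht fun _ hw _ _ hu => (DenF.lt hu (ht.mono hw)).and (hf _ hw _ _ hu)

theorem DenB.bits {X : ℕ} (hX : X ∈ J) : DenB J s w (bits X) (fun x => M.mem x (s X)) :=
  fun _ _ _ _ ht => .mem ht hX

theorem DenB.row {a : Bits} {A : M.Num → Prop} {t : NTerm} {x : M.Num} (ha : DenB J s w a A)
    (ht : DenT J s w t x) : DenB J s w (a.row t) (srow A x) :=
  fun _ hw _ _ hu => ha _ hw _ _ ((ht.mono hw).pair hu)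

theorem DenF.isZero {b : NTerm} {x : M.Num} {a : Bits} {A : M.Num → Prop}
    (hb : DenT J s w b x) (ha : DenB J s w a A) : DenF J s w (isZero b a) (sIsZero x A) :=
  .allLe hb fun _ hw _ _ hu => (ha _ hw _ _ hu).not

theorem DenF.sameBits {b : NTerm} {x : M.Num} {a c : Bits} {A C : M.Num → Prop}
    (hb : DenT J s w b x) (ha : DenB J s w a A) (hc : DenB J s w c C) :
    DenF J s w (sameBits b a c) (sSameBits x A C) :=
  .allLe hb fun _ hw _ _ hu => (ha _ hw _ _ hu).iff (hc _ hw _ _ hu)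

theorem DenB.carry {a c : Bits} {A C : M.Num → Prop} (ha : DenB J s w a A)
    (hc : DenB J s w c C) : DenB J s w (carry a c) (sCarry A C) := by
  intro w₁ hw₁ t x ht
  refine .exLt ht fun w₂ hw₂ u k hk => ?_
  have ha := ha.mono (World.le_trans hw₁ hw₂)
  have hc := hc.mono (World.le_trans hw₁ hw₂)
  refine ((ha.apply hk).and (hc.apply hk)).and (.allLt (ht.mono hw₂) fun w₃ hw₃ u' j hj => ?_)
  exact (DenF.lt (hk.mono hw₃) hj).imp ((ha _ hw₃ _ _ hj).or (hc _ hw₃ _ _ hj))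

theorem DenF.isSum {b : NTerm} {x : M.Num} {a c e : Bits} {A C E : M.Num → Prop}
    (hb : DenT J s w b x) (ha : DenB J s w a A) (hc : DenB J s w c C) (he : DenB J s w e E) :
    DenF J s w (isSum b a c e) (sIsSum x A C E) :=
  .allLe hb fun _ hw _ _ hu => (he _ hw _ _ hu).iff
    (((ha _ hw _ _ hu).xor (hc _ hw _ _ hu)).xor ((DenB.carry ha hc) _ hw _ _ hu))

theorem DenB.shift {a : Bits} {A : M.Num → Prop} {t : NTerm} {i : M.Num} (ha : DenB J s w a A)
    (ht : DenT J s w t i) : DenB J s w (shift a t) (sShift A i) :=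
  fun _ hw _ _ hu => .exLe hu fun _ hw' _ _ hy =>
    (DenF.eq (hy.add (ht.mono (World.le_trans hw hw'))) (hu.mono hw')).and
      (ha _ (World.le_trans hw hw') _ _ hy)

theorem DenF.isMulRun {b m : NTerm} {x y : M.Num} {a c : Bits} {A C : M.Num → Prop}
    {f : NTerm → Bits} {F : M.Num → M.Num → Prop} (hb : DenT J s w b x) (hm : DenT J s w m y)
    (ha : DenB J s w a A) (hc : DenB J s w c C)
    (hf : ∀ w' ≥ w, ∀ t i, DenT J s w' t i → DenB J s w' (f t) (F i)) :
    DenF J s w (isMulRun b m a c f) (sIsMulRun x y A C F) := by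
  refine (DenF.isZero hb (hf _ w.le_refl _ _ .zero)).and (.allLt hm fun w₁ hw _ i hi => ?_)
  have hf₁ := hf _ hw _ _ hi
  have hf₂ := hf _ hw _ _ (hi.add .one)
  exact ((hc _ hw _ _ hi).imp (.isSum (hb.mono hw) hf₁ ((ha.mono hw).shift hi) hf₂)).and
    ((hc _ hw _ _ hi).not.imp (.sameBits (hb.mono hw) hf₁ hf₂))

variable (J s) in
/-- The meaning of an integer. -/
def DenI (w : World M) (a : IntBits) (A : SInt M.Num) : Prop :=
  DenF J s w a.neg A.neg ∧ DenB J s w a.abs A.abs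

theorem DenB.int {a : Bits} {A : M.Num → Prop} (ha : DenB J s w a A) :
    DenI J s w a.int (sInt A) :=
  ⟨ha.apply .zero, fun _ hw _ _ hu => ha _ hw _ _ (hu.add .one)⟩

theorem DenF.isIntSum {b : NTerm} {x : M.Num} {a c e : IntBits} {A C E : SInt M.Num}
    (hb : DenT J s w b x) (ha : DenI J s w a A) (hc : DenI J s w c C) (he : DenI J s w e E) :
    DenF J s w (isIntSum b a c e) (sIsIntSum x A C E) := by
  have sign {φ : FB} {P : Prop} (h : DenF J s w φ P) :
      DenF J s w (e.neg.iff (φ.and (.not (TwoSorted.isZero b e.abs)))) (E.neg ↔ P ∧ ¬ sIsZero x E.abs) :=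
    he.1.iff (h.and (DenF.isZero hb he.2).not)
  exact ((ha.1.iff hc.1).and ((DenF.isSum hb ha.2 hc.2 he.2).and (sign ha.1))).or
    ((ha.1.xor hc.1).and (((DenF.isSum hb he.2 hc.2 ha.2).and (sign ha.1)).or
      ((DenF.isSum hb he.2 ha.2 hc.2).and (sign hc.1))))

theorem DenF.isPowSeq {n k : NTerm} {n' k' : M.Num} {X Y S U : ℕ} (hn : DenT J s w n n')
    (hk : DenT J s w k k') (hX : X ∈ J) (hY : Y ∈ J) (hS : S ∈ J) (hU : U ∈ J) :
    DenF J s w (isPowSeq n k X Y S U)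
      (sIsPowSeq (M.len (s X) + M.len (s Y) + M.len (s S) + M.len (s U)) (M.len (s X)) n' k'
        (M.mem · (s X)) (M.mem · (s Y)) (M.mem · (s S)) (M.mem · (s U))) := by
  have hb {w : World M} := (((DenT.len hX (s := s) (w := w)).add (.len hY)).add (.len hS)).add
    (.len hU)
  refine .and (.allLt hn fun w₁ h₁ a a' ha => .allLt (hn.mono h₁) fun w₂ h₂ c c' hc =>
    .allLe hb fun w₃ h₃ z z' hz => ?_) (.allLt hk fun w₁ h₁ i i' hi =>
    .allLt (hn.mono h₁) fun w₂ h₂ a a' ha =>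
    .allLt (hn.mono (World.le_trans h₁ h₂)) fun w₃ h₃ c c' hc => ?_)
  · have ha := ha.mono (World.le_trans h₂ h₃)
    have hc := hc.mono h₃
    exact ((((DenB.bits hY).row .zero).row ha).row hc |>.apply hz).iff
      ((DenF.eq ha hc).and (.eq hz .one))
  · have h₁₃ := World.le_trans h₁ (World.le_trans h₂ h₃)
    have hi := hi.mono (World.le_trans h₂ h₃)
    have ha := ha.mono h₃
    have hs {w : World M} (hw : w₃ ≤ w) :=
      ((((DenB.bits hS (s := s) (w := w)).row (hi.mono hw)).row (ha.mono hw)).row (hc.mono hw))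
    refine .and (.isZero hb ((hs (World.le_refl _)).row .zero)) (.and
      (.allLt (hn.mono h₁₃) fun w₄ h₄ l l' hl => ?_)
      (.sameBits hb ((((DenB.bits hY).row (hi.add .one)).row ha).row hc)
        ((hs (World.le_refl _)).row (hn.mono h₁₃))))
    have hi := hi.mono h₄
    have ha := ha.mono h₄
    have hc := hc.mono h₄
    have hy := ((((DenB.bits hY).row hi).row ha).row hl).int
    have hx := (((DenB.bits hX).row hl).row hc).int
    have hu {w : World M} (hw : w₄ ≤ w) := ((((DenB.bits hU (s := s) (w := w)).row
      (hi.mono hw)).row (ha.mono hw)).row (hc.mono hw)).row (hl.mono hw)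
    exact .and (.isMulRun hb (.len hX) hy.2 hx.2 fun w₅ h₅ m m' hm => (hu h₅).row hm)
      (.isIntSum hb ((hs h₄).row hl).int
        ⟨hy.1.xor hx.1, (hu (World.le_refl _)).row (.len hX)⟩ ((hs h₄).row (hl.add .one)).int)

end Denotation

end TwoSorted

namespace TwoSorted

/-! ### Uniqueness of sums, products and powers -/

section Order

variable {R : Type} [LinearOrder R]

theorem slt_iff {x y : R} : slt x y ↔ x < y := lt_iff_le_and_ne.symm

theorem sIsZero_iff {A : R → Prop} {b : R} (hA : ∀ y, A y → y < b) :
    sIsZero b A ↔ ∀ x, ¬ A x :=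
  ⟨fun h x hx => h x (hA x hx).le hx, fun h x _ => h x⟩

theorem sSameBits_iff {A C : R → Prop} {b : R} (hA : ∀ y, A y → y < b)
    (hC : ∀ y, C y → y < b) : sSameBits b A C ↔ ∀ x, (A x ↔ C x) :=
  ⟨fun h x => ⟨fun hx => (h x (hA x hx).le).1 hx, fun hx => (h x (hC x hx).le).2 hx⟩,
    fun h x _ => h x⟩

theorem sCarry_iff {A C : R → Prop} {x : R} :
    sCarry A C x ↔ ∃ k < x, (A k ∧ C k) ∧ ∀ j < x, k < j → A j ∨ C j := by
  simp only [sCarry, slt_iff]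
  exact ⟨fun ⟨k, _, hk, h, h'⟩ => ⟨k, hk, h, fun j hj => h' j hj.le hj⟩,
    fun ⟨k, hk, h, h'⟩ => ⟨k, hk.le, hk, h, fun j _ hj => h' j hj⟩⟩

theorem sCarry_congr {A C A' C' : R → Prop} {x : R} (hA : ∀ y < x, (A y ↔ A' y))
    (hC : ∀ y < x, (C y ↔ C' y)) : sCarry A C x ↔ sCarry A' C' x := by
  rw [sCarry_iff, sCarry_iff]
  refine exists_congr fun k => and_congr_right fun hk => ?_
  refine and_congr (and_congr (hA k hk) (hC k hk)) (forall₂_congr fun j hj => ?_)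
  rw [hA j hj, hC j hj]

/-- No digit sits at position `b`, so no carry passes it. A carry into `b` itself is possible, hence
the strict inequality. -/
theorem not_sCarry_of_lt {A C : R → Prop} {b x : R} (hA : ∀ y, A y → y < b)
    (hC : ∀ y, C y → y < b) (hx : b < x) : ¬ sCarry A C x := by
  rw [sCarry_iff]
  rintro ⟨k, -, h, h'⟩
  rcases h' b hx (hA k h.1) with h | h
  · exact lt_irrefl _ (hA b h)
  · exact lt_irrefl _ (hC b h)

theorem sIsSum_iff {A C E : R → Prop} {b : R} (hA : ∀ y, A y → y < b)
    (hC : ∀ y, C y → y < b) (hE : ∀ y, E y → y < b) :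
    sIsSum b A C E ↔ ∀ x, (E x ↔ ¬ (¬ (A x ↔ C x) ↔ sCarry A C x)) := by
  refine ⟨fun h x => ?_, fun h x _ => h x⟩
  rcases le_or_gt x b with hx | hx
  · exact h x hx
  · have h1 := not_sCarry_of_lt hA hC hx
    have h2 : ¬ A x := fun h => lt_asymm hx (hA x h)
    have h3 : ¬ C x := fun h => lt_asymm hx (hC x h)
    have h4 : ¬ E x := fun h => lt_asymm hx (hE x h)
    tauto

/-- The digit bound of a computation depends on the lengths of its record strings. The `mono` lemmas
move two computations to a common bound. -/
theorem sIsIntSum.mono {A C E : SInt R} {b b' : R} (hA : ∀ y, A.abs y → y < b)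
    (hC : ∀ y, C.abs y → y < b) (hE : ∀ y, E.abs y → y < b) (hb : b ≤ b')
    (h : sIsIntSum b A C E) : sIsIntSum b' A C E := by
  have hA' := fun y hy => (hA y hy).trans_le hb
  have hC' := fun y hy => (hC y hy).trans_le hb
  have hE' := fun y hy => (hE y hy).trans_le hb
  unfold sIsIntSum at h ⊢
  rw [sIsZero_iff hE, sIsSum_iff hA hC hE, sIsSum_iff hE hC hA, sIsSum_iff hE hA hC] at h
  rwa [sIsZero_iff hE', sIsSum_iff hA' hC' hE', sIsSum_iff hE' hC' hA',
    sIsSum_iff hE' hA' hC']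

variable [CommSemiring R]

theorem sCarry_succ (hlt : ∀ x y : R, x < y + 1 ↔ x ≤ y) {A C : R → Prop} {x : R} :
    sCarry A C (x + 1) ↔ (A x ∧ C x) ∨ ((A x ∨ C x) ∧ sCarry A C x) := by
  simp only [sCarry_iff, hlt]
  constructor
  · rintro ⟨k, hk, h, h'⟩
    rcases hk.lt_or_eq with hk | rfl
    · exact .inr ⟨h' x le_rfl hk, k, hk, h, fun j hj => h' j hj.le⟩
    · exact .inl h
  · rintro (h | ⟨h, k, hk, h', h''⟩)
    · exact ⟨x, le_rfl, h, fun j hj hj' => absurd hj hj'.not_ge⟩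
    · refine ⟨k, hk.le, h', fun j hj => ?_⟩
      rcases hj.lt_or_eq with hj | rfl
      · exact h'' j hj
      · exact fun _ => h

theorem sIsMulRun.mono {A C : R → Prop} {W : R → R → Prop} {b b' m : R}
    (hA : ∀ i < m, ∀ y, sShift A i y → y < b) (hW : ∀ i y, W i y → y < b) (hb : b ≤ b')
    (h : sIsMulRun b m A C W) : sIsMulRun b' m A C W := by
  have hA' := fun i hi y hy => (hA i hi y hy).trans_le hb
  have hW' := fun i y hy => (hW i y hy).trans_le hb
  refine ⟨(sIsZero_iff (hW' 0)).2 ((sIsZero_iff (hW 0)).1 h.1), fun i hi him => ?_⟩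
  have him' := slt_iff.1 him
  have := h.2 i hi him
  rw [sIsSum_iff (hW i) (hA i him') (hW _), sSameBits_iff (hW _) (hW _)] at this
  rwa [sIsSum_iff (hW' i) (hA' i him') (hW' _), sSameBits_iff (hW' _) (hW' _)]

end Order

/-! ### Definability of rows, digits and carries -/

section Sig

variable {M : Struct}

/-- Predicates that are `Σ^B_0` after substitution of any term. -/
def IsSigPred (M : Struct) (A : M.Num → Prop) : Prop :=
  ∀ f, IsTerm M f → IsSig M (fun a => A (f a))

theorem IsTerm.spair {f g : (ℕ → M.Num) → M.Num} (hf : IsTerm M f) (hg : IsTerm M g) :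
    IsTerm M (fun a => spair (f a) (g a)) :=
  ((hf.add hg).mul ((hf.add hg).add (.const 1))).add
    (((IsTerm.const 1).add (.const 1)).mul hg)

theorem IsSig.slt {f g : (ℕ → M.Num) → M.Num} (hf : IsTerm M f) (hg : IsTerm M g) :
    IsSig M (fun a => slt (f a) (g a)) :=
  (IsSig.le hf hg).and (IsSig.eq hf hg).not

theorem IsSigPred.mem (X : M.Str) : IsSigPred M (M.mem · X) := fun _ hf => .mem hf X

theorem IsSigPred.row {A : M.Num → Prop} (hA : IsSigPred M A) (i : M.Num) :
    IsSigPred M (srow A i) := fun _ hf => hA _ ((IsTerm.const i).spair hf)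

theorem IsSigPred.int_abs {A : M.Num → Prop} (hA : IsSigPred M A) :
    IsSigPred M (sInt A).abs := fun _ hf => hA _ (hf.add (.const 1))

/-- Weakening under one quantifier: arguments move up by one, hence their even names by two, and the
parameters stay. -/
theorem IsTerm.tail {f : (ℕ → M.Num) → M.Num} (hf : IsTerm M f) :
    IsTerm M (fun a => f fun k => a (k + 1)) := by
  obtain ⟨c, s, t, h⟩ := hf
  let g : ℕ → ℕ := fun k => if k % 2 = 0 then k + 2 else k
  refine ⟨c, s, t.rename g id, fun a => ?_⟩
  refine (h _).trans ?_
  rw [NTerm.eval_rename]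
  congr 1
  funext k
  by_cases hk : k % 2 = 0 <;> simp [interleave, g, hk]

theorem IsSigPred.carry {A C : M.Num → Prop} (hA : IsSigPred M A) (hC : IsSigPred M C) :
    IsSigPred M (sCarry A C) := fun f hf =>
  .bex (P := fun a k => TwoSorted.slt k (f a) ∧ (A k ∧ C k) ∧
      ∀ j ≤ f a, TwoSorted.slt j (f a) → TwoSorted.slt k j → A j ∨ C j) hf
    ((IsSig.slt (.var 0) hf.tail).and (((hA _ (.var 0)).and (hC _ (.var 0))).and
      (.ball (P := fun a j => TwoSorted.slt j (f fun k => a (k + 1)) →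
          TwoSorted.slt (a 0) j → A j ∨ C j) hf.tail
        ((IsSig.slt (.var 0) hf.tail.tail).imp
          ((IsSig.slt (.var 1) (.var 0)).imp ((hA _ (.var 0)).or (hC _ (.var 0))))))))

end Sig

/-! ### Uniqueness of recorded computations in every model -/

section Unique

variable {M : Struct} [IsV0 M]

open IsV0

theorem le_spair_right (x y : M.Num) : y ≤ spair x y := by
  unfold spair
  calc y ≤ x + y := le_add_self
    _ ≤ (x + y) * (x + y + 1) := le_mul_of_one_le_right zero_le le_add_self
    _ ≤ _ := le_self_add

theorem spair_mono {x y x' y' : M.Num} (hx : x ≤ x') (hy : y ≤ y') :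
    spair x y ≤ spair x' y' := by
  unfold spair
  gcongr

theorem srow_lt {A : M.Num → Prop} {b : M.Num} (hA : ∀ y, A y → y < b) (i y : M.Num)
    (h : srow A i y) : y < b :=
  (le_spair_right i y).trans_lt (hA _ h)

theorem sInt_abs_lt {A : M.Num → Prop} {b : M.Num} (hA : ∀ y, A y → y < b) (y : M.Num)
    (h : (sInt A).abs y) : y < b :=
  (le_self_add : y ≤ y + 1).trans_lt (hA _ h)

theorem sShift_lt {A : M.Num → Prop} {b m : M.Num} (hA : ∀ y, A y → y < b) (i : M.Num)
    (hi : i < m) (y : M.Num) (h : sShift A i y) : y < b + m := by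
  obtain ⟨z, -, rfl, hz⟩ := h
  exact add_lt_add (hA z hz) hi

/-- Digits beyond the bound are absent from all strings involved. Only the digit 1 of the identity
matrix is prescribed and not read off, so position 1 has to lie within the bound; `hX` ensures this.
-/
theorem sIsPowSeq.mono {n k b' : M.Num} {X Y S U : M.Str} (hX : 0 < M.len X)
    (hb : M.len X + M.len Y + M.len S + M.len U ≤ b')
    (h : sIsPowSeq (M.len X + M.len Y + M.len S + M.len U) (M.len X) n k (M.mem · X)
      (M.mem · Y) (M.mem · S) (M.mem · U)) :
    sIsPowSeq b' (M.len X) n k (M.mem · X) (M.mem · Y) (M.mem · S) (M.mem · U) := by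
  set b := M.len X + M.len Y + M.len S + M.len U with hbdef
  have hXY : M.len X + M.len Y ≤ b := by rw [hbdef, add_assoc _ (M.len S)]; exact le_self_add
  have hYb : M.len Y ≤ b := le_add_self.trans hXY
  have hSb : M.len S ≤ b := by rw [hbdef, add_right_comm]; exact le_add_self
  have hUb : M.len U ≤ b := le_add_self
  have hY : ∀ z, M.mem z Y → z < M.len Y := fun z hz => mem_lt hz
  have hS : ∀ z, M.mem z S → z < b := fun z hz => (mem_lt hz).trans_le hSb
  have hU : ∀ z, M.mem z U → z < b := fun z hz => (mem_lt hz).trans_le hUb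
  obtain ⟨h0, h1⟩ := h
  refine ⟨fun a ha ha' c hc hc' z _ => ?_, fun i hi hi' a ha ha' c hc hc' => ?_⟩
  · rcases le_or_gt z b with hz | hz
    · exact h0 a ha ha' c hc hc' z hz
    · refine iff_of_false (fun h => ?_) fun h => ?_
      · exact lt_asymm hz ((srow_lt (srow_lt (srow_lt hY _) _) _ _ h).trans_le hYb)
      · have : (1 : M.Num) ≤ M.len X := by
          have := add_one_le_iff.2 hX
          rwa [zero_add] at this
        rw [h.2] at hz
        exact absurd hz (not_lt.2 ((this.trans le_self_add).trans hXY))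
  · have hs := fun l => srow_lt (srow_lt (srow_lt (srow_lt hS i) a) c) l
    obtain ⟨h2, h3, h4⟩ := h1 i hi hi' a ha ha' c hc hc'
    have hy := fun i a c z h => (srow_lt (srow_lt (srow_lt hY i) a) c z h)
    have hy' := fun i a c z h => (hy i a c z h).trans_le hYb
    refine ⟨(sIsZero_iff fun y hy => (hs 0 y hy).trans_le hb).2
      ((sIsZero_iff (hs 0)).1 h2), fun l hl hl' => ?_,
      (sSameBits_iff (fun y h => (hy' _ a c y h).trans_le hb)
        fun y hy => (hs n y hy).trans_le hb).2
        ((sSameBits_iff (hy' _ a c) (hs n)).1 h4)⟩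
    have hu := fun m => srow_lt (srow_lt (srow_lt (srow_lt (srow_lt hU i) a) c) l) m
    obtain ⟨h5, h6⟩ := h3 l hl hl'
    refine ⟨h5.mono (fun m hm z hz => ?_) hu hb, h6.mono (sInt_abs_lt (hs _)) (hu _)
      (sInt_abs_lt (hs _)) hb⟩
    rw [add_comm] at hXY
    exact (sShift_lt (sInt_abs_lt (hy i a l)) m hm z hz).trans_le hXY

/-- The carry into x depends only on digits below x, where `E` and `E'` agree by induction. The
digits of `A` and `C` at x then fix the missing one. -/
theorem sIsSum.cancel {A C E E' : M.Num → Prop} {b : M.Num} (hE : IsSigPred M E)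
    (hE' : IsSigPred M E') (h : sIsSum b E C A) (h' : sIsSum b E' C A) (x : M.Num) :
    x ≤ b → (E x ↔ E' x) := by
  refine strong_induction (P := fun x => x ≤ b → (E x ↔ E' x))
    ((IsSig.le (.var 0) (.const b)).imp ((hE _ (.var 0)).iff (hE' _ (.var 0))))
    (fun x ih hx => ?_) x
  have h1 := h x hx
  have h2 := h' x hx
  have h3 := sCarry_congr (fun y hy => ih y hy (hy.le.trans hx)) (fun y _ => Iff.rfl (a := C y))
  tauto

/-- One position of the two additions e + c = a and e' + a = c. If neither sends a carry on, then
neither has received one, and both digits e and e' vanish. -/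
theorem carry_cases {e e' a c k k' K K' : Prop} (h1 : a ↔ ¬ (¬ (e ↔ c) ↔ k))
    (h2 : c ↔ ¬ (¬ (e' ↔ a) ↔ k')) (h3 : K ↔ (e ∧ c) ∨ ((e ∨ c) ∧ k))
    (h4 : K' ↔ (e' ∧ a) ∨ ((e' ∨ a) ∧ k')) : (K ∨ K') ∨ (¬ (k ∨ k') ∧ ¬ e ∧ ¬ e') := by
  by_cases e <;> by_cases c <;> by_cases k <;> by_cases e' <;> by_cases k' <;> simp_all

/-- Invariant, by induction on x: one of the two additions has a carry into x, or `E` and `E'` have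
no digits below x. By `carry_cases` a pending carry in one of the additions never dies out. At
position `b` all digits vanish, and the sum equations exclude a carry there. -/
theorem sIsSum.eq_zero {A C E E' : M.Num → Prop} {b : M.Num} (hEs : IsSigPred M E)
    (hE's : IsSigPred M E') (hAs : IsSigPred M A) (hCs : IsSigPred M C)
    (hE : ∀ y, E y → y < b) (hE' : ∀ y, E' y → y < b) (hA : ∀ y, A y → y < b)
    (hC : ∀ y, C y → y < b) (h : sIsSum b E C A) (h' : sIsSum b E' A C) :
    (∀ x, ¬ E x) ∧ ∀ x, ¬ E' x := by
  have key := induction (P := fun x => x ≤ b → (sCarry E C x ∨ sCarry E' A x) ∨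
      ∀ y ≤ x, slt y x → ¬ E y ∧ ¬ E' y)
    ((IsSig.le (.var 0) (.const b)).imp (((hEs.carry hCs _ (.var 0)).or
      (hE's.carry hAs _ (.var 0))).or (.ball (P := fun a y => slt y (a 0) → ¬ E y ∧ ¬ E' y)
        (.var 0) ((IsSig.slt (.var 0) (.var 1)).imp
          ((hEs _ (.var 0)).not.and (hE's _ (.var 0)).not)))))
    (fun _ => .inr fun y hy hy' => absurd (slt_iff.1 hy') (not_lt.2 zero_le))
    (fun x ih hx => by
      have hx' : x ≤ b := le_self_add.trans hx
      have h1 := h x hx'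
      have h2 := h' x hx'
      have h3 := sCarry_succ (fun x y : M.Num => lt_add_one_iff) (A := E) (C := C) (x := x)
      have h4 := sCarry_succ (fun x y : M.Num => lt_add_one_iff) (A := E') (C := A) (x := x)
      refine (carry_cases h1 h2 h3 h4).imp_right fun ⟨h5, h7⟩ y hy hy' => ?_
      rcases (lt_add_one_iff.1 (slt_iff.1 hy')).lt_or_eq with hy | rfl
      · exact (ih hx').resolve_left h5 y hy.le (slt_iff.2 hy)
      · exact h7)
    b le_rfl
  have h1 := h b le_rfl
  have h2 := h' b le_rfl
  have n1 : ¬ E b := fun h => lt_irrefl _ (hE b h)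
  have n2 : ¬ E' b := fun h => lt_irrefl _ (hE' b h)
  have n3 : ¬ A b := fun h => lt_irrefl _ (hA b h)
  have n4 : ¬ C b := fun h => lt_irrefl _ (hC b h)
  have h3 := key.resolve_left fun h3 => by
    simp only [n1, n2, n3, n4, false_iff, not_not, not_true_eq_false, iff_self] at h1 h2
    exact h3.elim h1 h2
  exact ⟨fun x hx => (h3 x (hE x hx).le (slt_iff.2 (hE x hx))).1 hx,
    fun x hx => (h3 x (hE' x hx).le (slt_iff.2 (hE' x hx))).2 hx⟩

/-- For opposite signs the relation offers two subtractions. If both candidates use the same one,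
cancellation applies. If they use different ones, both are zero by `sIsSum.eq_zero`, and the sign
rule forbids a negative zero. -/
theorem sIsIntSum.unique {A C E E' : SInt M.Num} {b : M.Num} (hEs : IsSigPred M E.abs)
    (hE's : IsSigPred M E'.abs) (hAs : IsSigPred M A.abs) (hCs : IsSigPred M C.abs)
    (hE : ∀ y, E.abs y → y < b) (hE' : ∀ y, E'.abs y → y < b) (hA : ∀ y, A.abs y → y < b)
    (hC : ∀ y, C.abs y → y < b) (h : sIsIntSum b A C E) (h' : sIsIntSum b A C E') :
    (E.neg ↔ E'.neg) ∧ ∀ x, (E.abs x ↔ E'.abs x) := by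
  have same (P : Prop) (h1 : sSameBits b E.abs E'.abs) (h2 : E.neg ↔ P ∧ ¬ sIsZero b E.abs)
      (h3 : E'.neg ↔ P ∧ ¬ sIsZero b E'.abs) :
      (E.neg ↔ E'.neg) ∧ ∀ x, (E.abs x ↔ E'.abs x) := by
    rw [sSameBits_iff hE hE'] at h1
    refine ⟨?_, h1⟩
    rw [h2, h3, sIsZero_iff hE, sIsZero_iff hE']
    simp only [h1]
  have zero (P Q : Prop) (h1 : (∀ x, ¬ E.abs x) ∧ ∀ x, ¬ E'.abs x)
      (h2 : E.neg ↔ P ∧ ¬ sIsZero b E.abs) (h3 : E'.neg ↔ Q ∧ ¬ sIsZero b E'.abs) :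
      (E.neg ↔ E'.neg) ∧ ∀ x, (E.abs x ↔ E'.abs x) := by
    rw [sIsZero_iff hE] at h2
    rw [sIsZero_iff hE'] at h3
    exact ⟨by tauto, fun x => iff_of_false (h1.1 x) (h1.2 x)⟩
  rcases h with ⟨h1, h2, h3⟩ | ⟨h1, ⟨h2, h3⟩ | ⟨h2, h3⟩⟩
  · rcases h' with ⟨-, h5, h6⟩ | ⟨h4, -⟩
    · exact same _ (fun x hx => (h2 x hx).trans (h5 x hx).symm) h3 h6
    · exact absurd h1 h4
  · rcases h' with ⟨h4, -⟩ | ⟨-, ⟨h5, h6⟩ | ⟨h5, h6⟩⟩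
    · exact absurd h4 h1
    · exact same _ (h2.cancel hEs hE's h5) h3 h6
    · exact zero _ _ (h2.eq_zero hEs hE's hAs hCs hE hE' hA hC h5) h3 h6
  · rcases h' with ⟨h4, -⟩ | ⟨-, ⟨h5, h6⟩ | ⟨h5, h6⟩⟩
    · exact absurd h4 h1
    · exact zero _ _ (h5.eq_zero hE's hEs hAs hCs hE' hE hA hC h2).symm h3 h6
    · exact same _ (h2.cancel hEs hE's h5) h3 h6

theorem sIsMulRun.unique {b m : M.Num} {A C : M.Num → Prop} {U U' : M.Num → Prop}
    (hU : IsSigPred M U) (hU' : IsSigPred M U') (hUb : ∀ y, U y → y < b)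
    (hUb' : ∀ y, U' y → y < b) (h : sIsMulRun b m A C (srow U))
    (h' : sIsMulRun b m A C (srow U')) (i : M.Num) : i ≤ m → srow U i = srow U' i := by
  have key := induction (P := fun i => i ≤ m → ∀ z ≤ b, (srow U i z ↔ srow U' i z))
    ((IsSig.le (.var 0) (.const m)).imp (.ball (P := fun a z => srow U (a 0) z ↔ srow U' (a 0) z)
      (.const b) ((hU _ ((IsTerm.var 1).spair (.var 0))).iff
        (hU' _ ((IsTerm.var 1).spair (.var 0))))))
    (fun _ z hz => iff_of_false (h.1 z hz) (h'.1 z hz))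
    (fun i ih hi => by
      have hi' : i < m := add_one_le_iff.1 hi
      have e : srow U i = srow U' i := funext fun z => propext
        ((sSameBits_iff (srow_lt hUb i) (srow_lt hUb' i)).1 (ih hi'.le) z)
      have h1 := h.2 i hi'.le (slt_iff.2 hi')
      have h2 := h'.2 i hi'.le (slt_iff.2 hi')
      rw [← e] at h2
      by_cases hC : C i
      · exact fun z hz => (h1.1 hC z hz).trans (h2.1 hC z hz).symm
      · exact fun z hz => (h1.2 hC z hz).symm.trans (h2.2 hC z hz)) i
  exact fun hi => funext fun z => propext
    ((sSameBits_iff (srow_lt hUb i) (srow_lt hUb' i)).1 (key hi) z)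

/-- An outer induction on the exponent and an inner one on the number of summands. The inner step
combines uniqueness of the school product with uniqueness of the integer sum. Both induction
formulas speak only of digits up to a common bound, so they are `Σ^B_0`. -/
theorem sIsPowSeq.unique {n k : M.Num} {X Y S U Y' S' U' : M.Str} (hX : 0 < M.len X)
    (h : sIsPowSeq (M.len X + M.len Y + M.len S + M.len U) (M.len X) n k (M.mem · X)
      (M.mem · Y) (M.mem · S) (M.mem · U))
    (h' : sIsPowSeq (M.len X + M.len Y' + M.len S' + M.len U') (M.len X) n k (M.mem · X)
      (M.mem · Y') (M.mem · S') (M.mem · U'))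
    {i a c : M.Num} (hi : i ≤ k) (ha : a < n) (hc : c < n) :
    srow (srow (srow (M.mem · Y) i) a) c = srow (srow (srow (M.mem · Y') i) a) c := by
  obtain ⟨b, hb⟩ : ∃ b, b = (M.len X + M.len Y + M.len S + M.len U) +
    (M.len X + M.len Y' + M.len S' + M.len U') := ⟨_, rfl⟩
  replace h := h.mono hX (le_self_add.trans hb.ge)
  replace h' := h'.mono hX (le_add_self.trans hb.ge)
  simp only [sIsPowSeq] at h h'
  have mem_lt' {Z : M.Str} (hZ : M.len Z ≤ b) (z : M.Num) (hz : M.mem z Z) : z < b :=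
    (mem_lt hz).trans_le hZ
  have hY : M.len Y ≤ b := by
    rw [hb]; exact (le_add_self.trans (le_self_add.trans le_self_add)).trans le_self_add
  have hS : M.len S ≤ b := by rw [hb]; exact (le_add_self.trans le_self_add).trans le_self_add
  have hU : M.len U ≤ b := by rw [hb]; exact le_add_self.trans le_self_add
  have hY' : M.len Y' ≤ b := by
    rw [hb]; exact (le_add_self.trans (le_self_add.trans le_self_add)).trans le_add_self
  have hS' : M.len S' ≤ b := by rw [hb]; exact (le_add_self.trans le_self_add).trans le_add_self
  have hU' : M.len U' ≤ b := by rw [hb]; exact le_add_self.trans le_add_self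
  have ext {A C : M.Num → Prop} (hA : ∀ z, A z → z < b) (hC : ∀ z, C z → z < b)
      (h : sSameBits b A C) : A = C :=
    funext fun z => propext ((sSameBits_iff hA hC).1 h z)
  have yb (i a c : M.Num) := srow_lt (srow_lt (srow_lt (mem_lt' hY) i) a) c
  have yb' (i a c : M.Num) := srow_lt (srow_lt (srow_lt (mem_lt' hY') i) a) c
  have sb (i a c l : M.Num) := srow_lt (srow_lt (srow_lt (srow_lt (mem_lt' hS) i) a) c) l
  have sb' (i a c l : M.Num) := srow_lt (srow_lt (srow_lt (srow_lt (mem_lt' hS') i) a) c) l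
  have ub (i a c l : M.Num) := srow_lt (srow_lt (srow_lt (srow_lt (mem_lt' hU) i) a) c) l
  have ub' (i a c l : M.Num) := srow_lt (srow_lt (srow_lt (srow_lt (mem_lt' hU') i) a) c) l
  have us (i a c l : M.Num) := ((((IsSigPred.mem U).row i).row a).row c).row l
  have us' (i a c l : M.Num) := ((((IsSigPred.mem U').row i).row a).row c).row l
  have key := induction (P := fun i => i ≤ k → ∀ a ≤ n, slt a n → ∀ c ≤ n, slt c n → ∀ z ≤ b,
      (srow (srow (srow (M.mem · Y) i) a) c z ↔ srow (srow (srow (M.mem · Y') i) a) c z))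
    (by
      have t : IsTerm M (fun e : ℕ → M.Num => spair (e 3) (spair (e 2) (spair (e 1) (e 0)))) :=
        (IsTerm.var 3).spair ((IsTerm.var 2).spair ((IsTerm.var 1).spair (.var 0)))
      refine (IsSig.le (.var 0) (.const k)).imp (.ball (P := fun e a => slt a n →
        ∀ c ≤ n, slt c n → ∀ z ≤ b, (srow (srow (srow (M.mem · Y) (e 0)) a) c z ↔
          srow (srow (srow (M.mem · Y') (e 0)) a) c z)) (.const n)
        ((IsSig.slt (.var 0) (.const n)).imp ?_))
      refine .ball (P := fun e c => slt c n → ∀ z ≤ b,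
        (srow (srow (srow (M.mem · Y) (e 1)) (e 0)) c z ↔
          srow (srow (srow (M.mem · Y') (e 1)) (e 0)) c z)) (.const n)
        ((IsSig.slt (.var 0) (.const n)).imp ?_)
      exact .ball (P := fun e z => srow (srow (srow (M.mem · Y) (e 2)) (e 1)) (e 0) z ↔
          srow (srow (srow (M.mem · Y') (e 2)) (e 1)) (e 0) z) (.const b)
        ((IsSig.mem t Y).iff (.mem t Y')))
    (fun _ a ha ha' c hc hc' z hz => (h.1 a ha ha' c hc hc' z hz).trans
      (h'.1 a ha ha' c hc hc' z hz).symm)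
    (fun i ih hi a ha ha' c hc hc' => by
      have hi' : i < k := add_one_le_iff.1 hi
      have e (l : M.Num) (hl : l < n) :=
        ext (yb i a l) (yb' i a l) (ih hi'.le a ha ha' l hl.le (slt_iff.2 hl))
      obtain ⟨h1, h2, h3⟩ := h.2 i hi'.le (slt_iff.2 hi') a ha ha' c hc hc'
      obtain ⟨h1', h2', h3'⟩ := h'.2 i hi'.le (slt_iff.2 hi') a ha ha' c hc hc'
      have hs := induction (P := fun l => l ≤ n → ∀ z ≤ b,
          (srow (srow (srow (srow (M.mem · S) i) a) c) l z ↔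
            srow (srow (srow (srow (M.mem · S') i) a) c) l z))
        ((IsSig.le (.var 0) (.const n)).imp (.ball (P := fun e z =>
          srow (srow (srow (srow (M.mem · S) i) a) c) (e 0) z ↔
            srow (srow (srow (srow (M.mem · S') i) a) c) (e 0) z) (.const b)
          (((((IsSigPred.mem S).row i).row a).row c _ ((IsTerm.var 1).spair (.var 0))).iff
            ((((IsSigPred.mem S').row i).row a).row c _ ((IsTerm.var 1).spair (.var 0))))))
        (fun _ z hz => iff_of_false (h1 z hz) (h1' z hz))
        (fun l ihl hl => by
          have hl' : l < n := add_one_le_iff.1 hl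
          have es := ext (sb i a c l) (sb' i a c l) (ihl hl'.le)
          obtain ⟨h4, h5⟩ := h2 l hl'.le (slt_iff.2 hl')
          obtain ⟨h4', h5'⟩ := h2' l hl'.le (slt_iff.2 hl')
          rw [← e l hl'] at h4' h5'
          rw [← es, ← h4.unique (us i a c l) (us' i a c l) (ub i a c l) (ub' i a c l) h4' _
            le_rfl] at h5'
          have ss (Z : M.Str) (l : M.Num) :=
            ((((IsSigPred.mem Z).row i).row a).row c).row l
          obtain ⟨h6, h7⟩ := h5.unique (ss S _).int_abs (ss S' _).int_abs (ss S _).int_abs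
            ((us i a c l).row _) (sInt_abs_lt (sb i a c _)) (sInt_abs_lt (sb' i a c _))
            (sInt_abs_lt (sb i a c _)) (srow_lt (ub i a c l) _) h5'
          intro z _
          -- Position 0 is the sign, and position w + 1 is digit w of the absolute value.
          by_cases hz : z = 0
          · rw [hz]; exact h6
          · obtain ⟨w, rfl⟩ := raw_exists_pred hz
            exact h7 w) n le_rfl
      exact fun z hz => ((h3 z hz).trans (hs z hz)).trans (h3' z hz).symm) i hi
  exact ext (yb i a c) (yb' i a c) (key a ha.le (slt_iff.2 ha) c hc.le (slt_iff.2 hc))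

end Unique

end TwoSorted

namespace TwoSorted

/-! ### The formula for the Pfaffian -/

section PfaffianFormula

open FB NTerm

/-- The entry `(p, q)` of the transfer matrix, as a set of digit positions `z`. A state is a pair
`(h, v)` with `h ≤ n` and `v < 2n + 2`, numbered `h (2n + 2) + v`; here `h` is the head of a closed
walk and `v` is the current vertex. -/
def transition (n : NTerm) (X : ℕ) (p q z : NTerm) : FB :=
  let a (v w : NTerm) : FB := ((bits X).row v).row w z
  let two : NTerm := 1 + 1
  let V := two * n + two
  exLe n fun h => exLt V fun v => exLe n fun h' => exLt V fun v' =>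
    and (and (eq p (h * V + v)) (eq q (h' * V + v')))
      -- From the start state (n, 2n + 1) a first head is chosen with weight 1, whose code is {1}.
      -- The head n means that no walk remains: (n, 2n) is the final state.
      (or (and (and (eq h n) (eq v (two * n + 1))) (and (eq v' (two * h')) (eq z 1)))
        (and (and (lt h n) (lt v (two * n)))
          -- Either the walk closes through 2h + 1, the partner of its head, and a later head is
          -- chosen, or it continues through a pair c > h. Entering 2c has weight -a(v, 2c+1), which
          -- is a(2c+1, v) by skew symmetry; thus codes are copied and no sign has to be changed.
          (or (and (and (lt h h') (eq v' (two * h'))) (a v (two * h + 1)))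
            (and (eq h' h) (exLt n fun c => and (lt h c)
              (or (and (eq v' (two * c)) (a (two * c + 1) v))
                (and (eq v' (two * c + 1)) (a v (two * c)))))))))

/-- The number of states. -/
def dimTerm (n : NTerm) : NTerm := (n + 1) * ((1 + 1) * n + (1 + 1))

/-- The code of the transfer matrix. -/
def transfer (n : NTerm) (X : ℕ) : Bits := fun w =>
  exLe (dimTerm n) fun p => exLe (dimTerm n) fun q => exLe (len X + 1) fun z =>
    and (eq w (pair p (pair q z))) (transition n X p q z)

/-- The string `X` codes a skew symmetric `d × d` matrix. -/
def isSkew (d : NTerm) (X : ℕ) : FB :=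
  let x (i j : NTerm) : IntBits := (((bits X).row i).row j).int
  allLt d fun i => allLt d fun j =>
    and (sameBits (len X) (x i j).abs (x j i).abs)
      (or (isZero (len X) (x i j).abs) (xor (x i j).neg (x j i).neg))

/-- The digits of the Pfaffian, found in the code `Q` of the powers of the transfer matrix. -/
def pfaffianBits (n : NTerm) (X Q : ℕ) : Bits := fun z =>
  and (isSkew ((1 + 1) * n) X)
    ((((bits Q).row (n + 1)).row (n * ((1 + 1) * n + (1 + 1)) + ((1 + 1) * n + 1))).row
      (n * ((1 + 1) * n + (1 + 1)) + (1 + 1) * n) z)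

/-- The bound on `|Y|` leaves no element of `Y` unconstrained, and it loses nothing: the digits come
from a row of `Q`, so they lie below `|Q|`. -/
def pfaffianBody (n : NTerm) (X Y P Q S U : ℕ) (t : NTerm) : FB :=
  and (allLt t fun w => iff (mem w P) (transfer n X w))
    (and (isPowSeq (dimTerm n) (n + 1) P Q S U)
      (and (le (len Y) (len Q)) (allLt (len Q) fun z => iff (mem z Y) (pfaffianBits n X Q z))))

/-- The bound for the code of the transfer matrix. -/
def transferBound (n : NTerm) (X : ℕ) : NTerm :=
  pair (dimTerm n) (pair (dimTerm n) (len X + 1)) + 1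

/-- The bound that occurs in the axiom for matrix powering. -/
def powBound (n k l : NTerm) : NTerm :=
  let B := (k + 1) * (n + l + 1)
  pair B (pair B (pair B (pair B (pair B B)))) + 1

/-- The formula that defines the Pfaffian. -/
def pfaffianFormula : Formula :=
  let n := var 0
  let t := transferBound n 0
  let t' := powBound (dimTerm n) (n + 1) t
  .bexS 2 t (.bexS 3 t' (.bexS 4 t' (.bexS 5 t' (pfaffianBody n 0 1 2 3 4 5 t 1 6))))

end PfaffianFormula

/-! ### The relations of the formula over an arbitrary structure -/

section PfaffianSemantics

variable {R : Type} [Zero R] [One R] [Add R] [Mul R] [LE R]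

def sTransition (n : R) (X : R → Prop) (p q z : R) : Prop :=
  ∃ h ≤ n, ∃ v ≤ (1 + 1) * n + (1 + 1), slt v ((1 + 1) * n + (1 + 1)) ∧
    ∃ h' ≤ n, ∃ v' ≤ (1 + 1) * n + (1 + 1), slt v' ((1 + 1) * n + (1 + 1)) ∧
      (p = h * ((1 + 1) * n + (1 + 1)) + v ∧ q = h' * ((1 + 1) * n + (1 + 1)) + v') ∧
      (((h = n ∧ v = (1 + 1) * n + 1) ∧ v' = (1 + 1) * h' ∧ z = 1) ∨
        ((slt h n ∧ slt v ((1 + 1) * n)) ∧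
          (((slt h h' ∧ v' = (1 + 1) * h') ∧ srow (srow X v) ((1 + 1) * h + 1) z) ∨
            (h' = h ∧ ∃ c ≤ n, slt c n ∧ slt h c ∧
              ((v' = (1 + 1) * c ∧ srow (srow X ((1 + 1) * c + 1)) v z) ∨
                (v' = (1 + 1) * c + 1 ∧ srow (srow X v) ((1 + 1) * c) z))))))

def sDim (n : R) : R := (n + 1) * ((1 + 1) * n + (1 + 1))

def sTransfer (n l : R) (X : R → Prop) (w : R) : Prop :=
  ∃ p ≤ sDim n, ∃ q ≤ sDim n, ∃ z ≤ l + 1, w = spair p (spair q z) ∧ sTransition n X p q z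

def sIsSkew (d l : R) (X : R → Prop) : Prop :=
  ∀ i ≤ d, slt i d → ∀ j ≤ d, slt j d →
    sSameBits l (sInt (srow (srow X i) j)).abs (sInt (srow (srow X j) i)).abs ∧
      (sIsZero l (sInt (srow (srow X i) j)).abs ∨
        ¬ ((sInt (srow (srow X i) j)).neg ↔ (sInt (srow (srow X j) i)).neg))

def sPfaffianBits (n l : R) (X Q : R → Prop) (z : R) : Prop :=
  sIsSkew ((1 + 1) * n) l X ∧
    srow (srow (srow Q (n + 1)) (n * ((1 + 1) * n + (1 + 1)) + ((1 + 1) * n + 1)))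
      (n * ((1 + 1) * n + (1 + 1)) + (1 + 1) * n) z

def sTransferBound (n l : R) : R := spair (sDim n) (spair (sDim n) (l + 1)) + 1

def sPowBound (n k l : R) : R :=
  spair ((k + 1) * (n + l + 1)) (spair ((k + 1) * (n + l + 1)) (spair ((k + 1) * (n + l + 1))
    (spair ((k + 1) * (n + l + 1)) (spair ((k + 1) * (n + l + 1))
      ((k + 1) * (n + l + 1)))))) + 1

end PfaffianSemantics

/-! ### The formula expresses these relations -/

section PfaffianDenotation

variable {M : Struct}

/-- The matrix of the formula for the Pfaffian, in a structure. -/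
def PfaffianBody (M : Struct) (n : M.Num) (X Y P Q S U : M.Str) : Prop :=
  (∀ w ≤ sTransferBound n (M.len X), slt w (sTransferBound n (M.len X)) →
      (M.mem w P ↔ sTransfer n (M.len X) (M.mem · X) w)) ∧
    sIsPowSeq (M.len P + M.len Q + M.len S + M.len U) (M.len P) (sDim n) (n + 1)
      (M.mem · P) (M.mem · Q) (M.mem · S) (M.mem · U) ∧
    M.len Y ≤ M.len Q ∧
    ∀ z ≤ M.len Q, slt z (M.len Q) →
      (M.mem z Y ↔ sPfaffianBits n (M.len X) (M.mem · X) (M.mem · Q) z)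

variable {J : Set ℕ} {s : ℕ → M.Str} {w : World M}

theorem DenT.dimTerm {t : NTerm} {n : M.Num} (h : DenT J s w t n) :
    DenT J s w (dimTerm t) (sDim n) :=
  (h.add .one).mul (((DenT.one.add .one).mul h).add (DenT.one.add .one))

theorem DenT.transferBound {t : NTerm} {n : M.Num} {X : ℕ} (h : DenT J s w t n) (hX : X ∈ J) :
    DenT J s w (transferBound t X) (sTransferBound n (M.len (s X))) :=
  (h.dimTerm.pair (h.dimTerm.pair ((DenT.len hX).add .one))).add .one

theorem DenT.powBound {n k l : NTerm} {n' k' l' : M.Num} (hn : DenT J s w n n')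
    (hk : DenT J s w k k') (hl : DenT J s w l l') :
    DenT J s w (powBound n k l) (sPowBound n' k' l') := by
  have hB := (hk.add .one).mul ((hn.add hl).add .one)
  exact (hB.pair (hB.pair (hB.pair (hB.pair (hB.pair hB))))).add .one

theorem DenF.transition {X : ℕ} {t p q z : NTerm} {n p' q' z' : M.Num} (hX : X ∈ J)
    (hn : DenT J s w t n) (hp : DenT J s w p p') (hq : DenT J s w q q') (hz : DenT J s w z z') :
    DenF J s w (transition t X p q z) (sTransition n (M.mem · (s X)) p' q' z') := by
  have two {w : World M} : DenT J s w (1 + 1) (1 + 1 : M.Num) := DenT.one.add .one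
  have hV {w' : World M} (hw : w ≤ w') := (two.mul (hn.mono hw)).add two
  unfold TwoSorted.transition sTransition
  dsimp only
  refine .exLe hn fun w₁ k₁ _ h hh => .exLt (hV k₁) fun w₂ k₂ _ v hv =>
    .exLe (hn.mono (World.le_trans k₁ k₂)) fun w₃ k₃ _ h' hh' =>
    .exLt (hV (World.le_trans (World.le_trans k₁ k₂) k₃)) fun w₄ k₄ _ v' hv' => ?_
  have k₁₄ := World.le_trans (World.le_trans (World.le_trans k₁ k₂) k₃) k₄
  replace hh := hh.mono (World.le_trans (World.le_trans k₂ k₃) k₄)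
  replace hv := hv.mono (World.le_trans k₃ k₄)
  replace hh' := hh'.mono k₄
  have hn' := hn.mono k₁₄
  have ha {w : World M} {t u : NTerm} {x y : M.Num} (hw : w₄ ≤ w) (ht : DenT J s w t x)
      (hu : DenT J s w u y) := (((DenB.bits hX).row ht).row hu).apply
        (hz.mono (World.le_trans k₁₄ hw))
  refine ((DenF.eq (hp.mono k₁₄) ((hh.mul (hV k₁₄)).add hv)).and
    (.eq (hq.mono k₁₄) ((hh'.mul (hV k₁₄)).add hv'))).and (.or ?_ (.and ?_ (.or ?_ ?_)))
  · exact ((DenF.eq hh hn').and (.eq hv ((two.mul hn').add .one))).and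
      ((DenF.eq hv' (two.mul hh')).and (.eq (hz.mono k₁₄) .one))
  · exact (DenF.lt hh hn').and (.lt hv (two.mul hn'))
  · exact ((DenF.lt hh hh').and (.eq hv' (two.mul hh'))).and
      (ha (World.le_refl _) hv ((two.mul hh).add .one))
  · refine (DenF.eq hh' hh).and (.exLt hn' fun w₅ k₅ _ c hc => ?_)
    exact (DenF.lt (hh.mono k₅) hc).and
      (((DenF.eq (hv'.mono k₅) (two.mul hc)).and (ha k₅ ((two.mul hc).add .one) (hv.mono k₅))).or
      ((DenF.eq (hv'.mono k₅) ((two.mul hc).add .one)).and (ha k₅ (hv.mono k₅) (two.mul hc))))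

theorem DenB.transfer {X : ℕ} {t : NTerm} {n : M.Num} (hX : X ∈ J) (hn : DenT J s w t n) :
    DenB J s w (transfer t X) (sTransfer n (M.len (s X)) (M.mem · (s X))) := by
  intro w₁ k₁ _ x hx
  have hn := hn.mono k₁
  refine .exLe hn.dimTerm fun w₂ k₂ _ p hp => .exLe (hn.mono k₂).dimTerm fun w₃ k₃ _ q hq =>
    .exLe ((DenT.len hX).add .one) fun w₄ k₄ _ z hz => ?_
  have k₂₄ := World.le_trans k₃ k₄
  exact (DenF.eq (hx.mono (World.le_trans k₂ k₂₄)) ((hp.mono k₂₄).pair ((hq.mono k₄).pair hz))).and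
    (.transition hX (hn.mono (World.le_trans k₂ k₂₄)) (hp.mono k₂₄) (hq.mono k₄) hz)

theorem DenF.isSkew {X : ℕ} {t : NTerm} {d : M.Num} (hX : X ∈ J) (hd : DenT J s w t d) :
    DenF J s w (isSkew t X) (sIsSkew d (M.len (s X)) (M.mem · (s X))) := by
  refine .allLt hd fun w₁ k₁ _ i hi => .allLt (hd.mono k₁) fun w₂ k₂ _ j hj => ?_
  replace hi := hi.mono k₂
  have h := (((DenB.bits hX).row hi).row hj).int
  have h' := (((DenB.bits hX).row hj).row hi).int
  exact (DenF.sameBits (.len hX) h.2 h'.2).and ((DenF.isZero (.len hX) h.2).or (h.1.xor h'.1))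

theorem DenB.pfaffianBits {X Q : ℕ} {t : NTerm} {n : M.Num} (hX : X ∈ J) (hQ : Q ∈ J)
    (hn : DenT J s w t n) : DenB J s w (pfaffianBits t X Q)
      (sPfaffianBits n (M.len (s X)) (M.mem · (s X)) (M.mem · (s Q))) := by
  intro w₁ k₁ _ x hx
  have hn := hn.mono k₁
  have two {w : World M} : DenT J s w (1 + 1) (1 + 1 : M.Num) := DenT.one.add .one
  exact (DenF.isSkew hX (two.mul hn)).and (((((DenB.bits hQ).row (hn.add .one)).row
    ((hn.mul ((two.mul hn).add two)).add ((two.mul hn).add .one))).row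
    ((hn.mul ((two.mul hn).add two)).add (two.mul hn))).apply hx)

theorem DenF.pfaffianBody {X Y P Q S U : ℕ} {t : NTerm} {n : M.Num} (hX : X ∈ J) (hY : Y ∈ J)
    (hP : P ∈ J) (hQ : Q ∈ J) (hS : S ∈ J) (hU : U ∈ J) (hn : DenT J s w t n) :
    DenF J s w (pfaffianBody t X Y P Q S U (transferBound t X))
      (PfaffianBody M n (s X) (s Y) (s P) (s Q) (s S) (s U)) :=
  (DenF.allLt (hn.transferBound hX) fun _ k _ _ hx => (DenF.mem hx hP).iff
      (DenB.transfer hX hn _ k _ _ hx)).and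
    ((DenF.isPowSeq hn.dimTerm (hn.add .one) hP hQ hS hU).and
      ((DenF.le (.len hY) (.len hQ)).and (DenF.allLt (.len hQ) fun _ k _ _ hx =>
        (DenF.mem hx hY).iff (DenB.pfaffianBits hX hQ hn _ k _ _ hx))))

/-- The bridge to comprehension: the formula is taken at one fresh variable, which becomes the
argument, while the other variables become parameters. -/
theorem DenB.isSig {a : Bits} {A : M.Num → Prop} (h : DenB J s w a A) :
    IsSig M (fun e => A (e 0)) := by
  have key : ∀ x : M.Num, w ≤ ⟨w.next + 1, Function.update w.val w.next x⟩ := fun x =>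
    ⟨Nat.le_succ _, fun k hk => Function.update_of_ne (ne_of_lt hk) _ _⟩
  by_cases hJ : ∀ x : M.Num, DenT J s ⟨w.next + 1, Function.update w.val w.next x⟩
      (.var w.next) x
  swap
  · exact absurd (fun x => ⟨Set.singleton_subset_iff.2 (Nat.lt_succ_self _), Set.empty_subset _,
      Function.update_self _ _ _⟩) hJ
  have h1 := fun x => h _ (key x) _ _ (hJ x) _ (World.le_refl _) 0
  let f : ℕ → ℕ := fun k => if k = w.next then 0 else 2 * k + 1
  have hf : f.Injective := by
    intro a b h; simp only [f] at h; split_ifs at h <;> omega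
  refine ⟨w.val, s, (a (.var w.next) (w.next + 1) 0).rename f id, (h1 M.zero).1.rename hf,
    fun e => ?_⟩
  refine (h1 (e 0)).2.2.2.symm.trans ?_
  rw [Formula.sat_rename _ hf Function.injective_id]
  have : interleave e w.val ∘ f = Function.update w.val w.next (e 0) := by
    funext k
    by_cases hk : k = w.next
    · simp [f, hk, interleave]
    · have h2 : (2 * k + 1) / 2 = k := by omega
      simp [f, hk, interleave, h2]
  rw [this]
  rfl

theorem Formula.mem_freeStr_bexS {X k : ℕ} {t : NTerm} {φ : Formula}
    (h : k ∈ (Formula.bexS X t φ).freeStr) : k ≠ X ∧ (k ∈ t.strVars ∨ k ∈ φ.freeStr) := by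
  obtain ⟨((h | h) | h), h'⟩ := h
  · exact absurd h h'
  · exact ⟨h', .inl h⟩
  · exact ⟨h', .inr h⟩

/-- The meaning of the formula for the Pfaffian in a structure. -/
theorem sat_pfaffianFormula (v : ℕ → M.Num) (s : ℕ → M.Str) :
    pfaffianFormula.Sat M v s ↔ ∃ P Q S U : M.Str,
      M.len P ≤ sTransferBound (v 0) (M.len (s 0)) ∧
      (M.len Q ≤ sPowBound (sDim (v 0)) (v 0 + 1) (sTransferBound (v 0) (M.len (s 0))) ∧
      M.len S ≤ sPowBound (sDim (v 0)) (v 0 + 1) (sTransferBound (v 0) (M.len (s 0))) ∧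
      M.len U ≤ sPowBound (sDim (v 0)) (v 0 + 1) (sTransferBound (v 0) (M.len (s 0)))) ∧
      PfaffianBody M (v 0) (s 0) (s 1) P Q S U := by
  have hn (s' : ℕ → M.Str) : DenT Set.univ s' ⟨1, v⟩ (.var 0) (v 0) :=
    ⟨Set.singleton_subset_iff.2 Nat.zero_lt_one, Set.empty_subset _, rfl⟩
  have h1 (s' : ℕ → M.Str) (h : s' 0 = s 0) :
      (transferBound (.var 0) 0).eval M v s' = sTransferBound (v 0) (M.len (s 0)) := by
    rw [← h]; exact ((hn s').transferBound (Set.mem_univ _)).2.2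
  have h2 (s' : ℕ → M.Str) (h : s' 0 = s 0) :
      (powBound (dimTerm (.var 0)) (.var 0 + 1) (transferBound (.var 0) 0)).eval M v s' =
        sPowBound (sDim (v 0)) (v 0 + 1) (sTransferBound (v 0) (M.len (s 0))) := by
    rw [← h]
    exact ((hn s').dimTerm.powBound ((hn s').add .one) ((hn s').transferBound (Set.mem_univ _))).2.2
  have h3 (s' : ℕ → M.Str) :=
    (DenF.pfaffianBody (X := 0) (Y := 1) (P := 2) (Q := 3) (S := 4) (U := 5) (Set.mem_univ _)
      (Set.mem_univ _) (Set.mem_univ _) (Set.mem_univ _) (Set.mem_univ _) (Set.mem_univ _) (hn s') _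
      (World.le_refl _) 6).2.2.2
  simp only [pfaffianFormula, Formula.bexS, Formula.Sat, h3, NTerm.eval]
  simp only [h1, h2, ne_eq, Nat.reduceEqDiff, not_false_eq_true,
    Function.update_of_ne, OfNat.zero_ne_ofNat, OfNat.one_ne_ofNat, Function.update_self]
  constructor
  · rintro ⟨P, hP, Q, hQ, S, hS, U, hU, h⟩
    exact ⟨P, Q, S, U, hP, ⟨hQ, hS, hU⟩, h⟩
  · rintro ⟨P, Q, S, U, hP, ⟨hQ, hS, hU⟩, h⟩
    exact ⟨P, hP, Q, hQ, S, hS, U, hU, h⟩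

/-- The syntactic half of the denotation lemmas does not depend on the structure, so one assignment
in the standard model suffices. For the bounds, {0} serves as the set of admissible strings, which
shows that they mention no quantified string. -/
theorem isSigmaB1_pfaffianFormula : pfaffianFormula.IsSigmaB1 ∧
    pfaffianFormula.freeNum ⊆ Set.Iio 1 ∧ pfaffianFormula.freeStr ⊆ Set.Iic 1 := by
  let v : ℕ → ℕ := fun _ => 0
  let s : ℕ → Finset ℕ := fun _ => ∅
  have hn : DenT (M := stdModel) (Set.Iio 6) s ⟨1, v⟩ (.var 0) 0 :=
    ⟨Set.singleton_subset_iff.2 Nat.zero_lt_one, Set.empty_subset _, rfl⟩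
  have hn' : DenT (M := stdModel) {0} s ⟨1, v⟩ (.var 0) 0 :=
    ⟨Set.singleton_subset_iff.2 Nat.zero_lt_one, Set.empty_subset _, rfl⟩
  obtain ⟨h1, h2, h3, -⟩ := DenF.pfaffianBody (X := 0) (Y := 1) (P := 2) (Q := 3) (S := 4)
    (U := 5) (by simp) (by simp) (by simp) (by simp) (by simp) (by simp) hn _ (World.le_refl _) 6
  obtain ⟨h4, h5, -⟩ := hn'.transferBound (Set.mem_singleton 0)
  obtain ⟨h6, h7, -⟩ := hn'.dimTerm.powBound (hn'.add .one)
    (hn'.transferBound (Set.mem_singleton 0))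
  refine ⟨⟨[(2, _), (3, _), (4, _), (5, _)], _, h1, ?_, rfl⟩, ?_, ?_⟩
  · have h5' : ∀ k ∈ (transferBound (.var 0) 0).strVars, k = 0 := h5
    have h7' : ∀ k ∈ (powBound (dimTerm (.var 0)) (.var 0 + 1)
      (transferBound (.var 0) 0)).strVars, k = 0 := h7
    intro p hp q hq hpq
    have : p.1 = 0 := by
      simp only [List.mem_cons, List.not_mem_nil, or_false] at hq
      rcases hq with rfl | rfl | rfl | rfl
      · exact h5' _ hpq
      all_goals exact h7' _ hpq
    simp only [List.mem_cons, List.not_mem_nil, or_false] at hp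
    rcases hp with rfl | rfl | rfl | rfl <;> cases this
  · have he : ∀ X : ℕ, (NTerm.len X).numVars ⊆ Set.Iio 1 := fun X => Set.empty_subset _
    exact Set.union_subset (Set.union_subset (he _) h4) (Set.union_subset
      (Set.union_subset (he _) h6) (Set.union_subset (Set.union_subset (he _) h6)
        (Set.union_subset (Set.union_subset (he _) h6) h2)))
  · intro k hk
    by_contra hk'
    have h50 : k ∉ (transferBound (.var 0) 0).strVars := fun h => hk' (by
      rw [show k = 0 from h5 h]; exact Nat.zero_le 1)
    have h70 : k ∉ (powBound (dimTerm (.var 0)) (.var 0 + 1)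
      (transferBound (.var 0) 0)).strVars := fun h => hk' (by
      rw [show k = 0 from h7 h]; exact Nat.zero_le 1)
    obtain ⟨n2, hk⟩ := Formula.mem_freeStr_bexS hk
    obtain ⟨n3, hk⟩ := Formula.mem_freeStr_bexS (hk.resolve_left h50)
    obtain ⟨n4, hk⟩ := Formula.mem_freeStr_bexS (hk.resolve_left h70)
    obtain ⟨n5, hk⟩ := Formula.mem_freeStr_bexS (hk.resolve_left h70)
    have : k < 6 := h3 (hk.resolve_left h70)
    rw [Set.mem_Iic] at hk'
    omega

end PfaffianDenotation

end TwoSorted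

namespace TwoSorted

/-! ### Existence and uniqueness of the value of the formula -/

section

variable {M : Struct} [IsV0 M]

open IsV0

/-- The transition from the start directly to the final state is always present, so the transfer
matrix has a nonempty code. Uniqueness of powers requires this: for an empty code the digit bound
could be 0, and the digit 1 of the identity matrix would go unchecked. -/
theorem sTransfer_start (n l : M.Num) (X : M.Num → Prop) :
    ∃ w < sTransferBound n l, sTransfer n l X w := by
  have h1 : (1 + 1) * n < (1 + 1) * n + (1 + 1) := by
    rw [← add_assoc, lt_add_one_iff]; exact le_self_add
  have h2 : (1 + 1) * n + 1 < (1 + 1) * n + (1 + 1) := by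
    rw [← add_assoc, lt_add_one_iff]
  have h3 (v : M.Num) (hv : v < (1 + 1) * n + (1 + 1)) :
      n * ((1 + 1) * n + (1 + 1)) + v ≤ sDim n := by
    rw [sDim, add_mul n 1, one_mul]; gcongr
  have h4 : (1 : M.Num) ≤ l + 1 := le_add_self
  refine ⟨spair (n * ((1 + 1) * n + (1 + 1)) + ((1 + 1) * n + 1))
    (spair (n * ((1 + 1) * n + (1 + 1)) + (1 + 1) * n) 1), ?_, ?_⟩
  · exact lt_add_one_iff.2 (spair_mono (h3 _ h2) (spair_mono (h3 _ h1) h4))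
  · exact ⟨_, h3 _ h2, _, h3 _ h1, 1, h4, rfl, n, le_rfl, _, h2.le, slt_iff.2 h2, n, le_rfl, _,
      h1.le, slt_iff.2 h1, ⟨rfl, rfl⟩, .inl ⟨⟨rfl, rfl⟩, rfl, rfl⟩⟩

theorem PfaffianBody.pos {n : M.Num} {X Y P Q S U : M.Str}
    (h : PfaffianBody M n X Y P Q S U) : 0 < M.len P := by
  obtain ⟨w, hw, hw'⟩ := sTransfer_start n (M.len X) (M.mem · X)
  exact zero_le.trans_lt (mem_lt ((h.1 w hw.le (slt_iff.2 hw)).2 hw'))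

/-- `P` is fixed by its bound and its elements, the relevant row of `Q` by uniqueness of powers, and
`Y` by that row. -/
theorem PfaffianBody.unique {n : M.Num} {X Y P Q S U Y' P' Q' S' U' : M.Str}
    (hP : M.len P ≤ sTransferBound n (M.len X)) (hP' : M.len P' ≤ sTransferBound n (M.len X))
    (h : PfaffianBody M n X Y P Q S U) (h' : PfaffianBody M n X Y' P' Q' S' U') : Y = Y' := by
  have hpos := h.pos
  obtain rfl : P = P' := by
    refine str_ext fun w => ?_
    by_cases hw : w < sTransferBound n (M.len X)
    · exact (h.1 w hw.le (slt_iff.2 hw)).trans (h'.1 w hw.le (slt_iff.2 hw)).symm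
    · exact iff_of_false (fun hm => hw ((mem_lt hm).trans_le hP))
        fun hm => hw ((mem_lt hm).trans_le hP')
  have mem_iff {Y P Q S U : M.Str} (h : PfaffianBody M n X Y P Q S U) (z : M.Num) :
      M.mem z Y ↔ sPfaffianBits n (M.len X) (M.mem · X) (M.mem · Q) z := by
    by_cases hz : z < M.len Q
    · exact h.2.2.2 z hz.le (slt_iff.2 hz)
    · refine iff_of_false (fun hm => hz ((mem_lt hm).trans_le h.2.2.1)) fun hm => hz ?_
      exact srow_lt (srow_lt (srow_lt (fun _ => mem_lt) _) _) _ _ hm.2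
  have h1 : (1 + 1) * n < (1 + 1) * n + (1 + 1) := by
    rw [← add_assoc, lt_add_one_iff]; exact le_self_add
  have h2 : (1 + 1) * n + 1 < (1 + 1) * n + (1 + 1) := by
    rw [← add_assoc, lt_add_one_iff]
  have h3 (v : M.Num) (hv : v < (1 + 1) * n + (1 + 1)) :
      n * ((1 + 1) * n + (1 + 1)) + v < sDim n := by
    rw [sDim, add_mul n 1, one_mul]; gcongr
  refine str_ext fun z => ?_
  rw [mem_iff h, mem_iff h', sPfaffianBits, sPfaffianBits,
    h.2.1.unique hpos h'.2.1 le_rfl (h3 _ h2) (h3 _ h1)]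

/-- The powering axiom bounds its witnesses in terms of `|P|`, but in a `Σ^B_1` formula the bounds
may not contain the quantified `P`. Monotonicity replaces `|P|` by its own bound. -/
theorem sPowBound_mono {n k l l' : M.Num} (h : l ≤ l') : sPowBound n k l ≤ sPowBound n k l' := by
  have hB : (k + 1) * (n + l + 1) ≤ (k + 1) * (n + l' + 1) := by gcongr
  unfold sPowBound
  gcongr
  exact spair_mono hB (spair_mono hB (spair_mono hB (spair_mono hB (spair_mono hB hB))))

end

theorem exists_isPowSeq {M : Struct} (hM : M.Models powAxiom) (n k : M.Num) (X : M.Str) :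
    ∃ Y S U : M.Str, (M.len Y ≤ sPowBound n k (M.len X) ∧ M.len S ≤ sPowBound n k (M.len X) ∧
      M.len U ≤ sPowBound n k (M.len X)) ∧
      sIsPowSeq (M.len X + M.len Y + M.len S + M.len U) (M.len X) n k (M.mem · X)
        (M.mem · Y) (M.mem · S) (M.mem · U) := by
  let v : ℕ → M.Num := consSeq n fun _ => k
  have hn (s : ℕ → M.Str) : DenT Set.univ s ⟨2, v⟩ (.var 0) n :=
    ⟨Set.singleton_subset_iff.2 Nat.zero_lt_two, Set.subset_univ _, rfl⟩
  have hk (s : ℕ → M.Str) : DenT Set.univ s ⟨2, v⟩ (.var 1) k :=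
    ⟨Set.singleton_subset_iff.2 Nat.one_lt_two, Set.subset_univ _, rfl⟩
  have h1 (s : ℕ → M.Str) (h : s 0 = X) :
      (powBound (.var 0) (.var 1) (.len 0)).eval M v s = sPowBound n k (M.len X) := by
    rw [← h]; exact ((hn s).powBound (hk s) (.len (Set.mem_univ _))).2.2
  have h2 (s : ℕ → M.Str) :=
    (DenF.isPowSeq (X := 0) (Y := 1) (S := 2) (U := 3) (hn s) (hk s) (Set.mem_univ _)
      (Set.mem_univ _) (Set.mem_univ _) (Set.mem_univ _) _ (World.le_refl _) 4).2.2.2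
  obtain ⟨Y, hY, S, hS, U, hU, h⟩ := hM v fun _ => X
  replace h := (h2 _).1 h
  refine ⟨Y, S, U, ⟨?_, ?_, ?_⟩, h⟩
  · rw [← h1 (Function.update (fun _ => X) 1 Y) rfl]; exact hY
  · rw [← h1 (Function.update (Function.update (fun _ => X) 1 Y) 2 S) rfl]; exact hS
  · rw [← h1 (Function.update (Function.update (Function.update (fun _ => X) 1 Y) 2 S) 3 U) rfl]
    exact hU

section

variable {M : Struct} [IsV0 M]

open IsV0

/-- Comprehension gives `P`, the powering axiom its powers, and comprehension again `Y`. -/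
theorem exists_pfaffianBody (hM : M.Models powAxiom) (n : M.Num) (X : M.Str) :
    ∃ Y P Q S U : M.Str, M.len P ≤ sTransferBound n (M.len X) ∧
      (M.len Q ≤ sPowBound (sDim n) (n + 1) (sTransferBound n (M.len X)) ∧
      M.len S ≤ sPowBound (sDim n) (n + 1) (sTransferBound n (M.len X)) ∧
      M.len U ≤ sPowBound (sDim n) (n + 1) (sTransferBound n (M.len X))) ∧
      PfaffianBody M n X Y P Q S U := by
  have hn (s : ℕ → M.Str) : DenT Set.univ s ⟨1, fun _ => n⟩ (.var 0) n :=
    ⟨Set.singleton_subset_iff.2 Nat.zero_lt_one, Set.subset_univ _, rfl⟩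
  obtain ⟨P, hP, h⟩ := comprehension'
    (DenB.transfer (Set.mem_univ 0) (hn fun _ => X)).isSig (sTransferBound n (M.len X))
  obtain ⟨Q, S, U, ⟨hQ, hS, hU⟩, h'⟩ := exists_isPowSeq hM (sDim n) (n + 1) P
  obtain ⟨Y, hY, h''⟩ := comprehension'
    (DenB.pfaffianBits (Set.mem_univ 0) (Set.mem_univ 1) (hn (consSeq X fun _ => Q))).isSig
    (M.len Q)
  have hb := sPowBound_mono (n := sDim n) (k := n + 1) hP
  refine ⟨Y, P, Q, S, U, hP, ⟨hQ.trans hb, hS.trans hb, hU.trans hb⟩, fun w _ hw' => ?_, h', hY,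
    fun z _ hz' => ?_⟩
  · rw [h, and_iff_right (slt_iff.1 hw')]
  · rw [h'', and_iff_right (slt_iff.1 hz')]
    rfl

end

/-- No property of Pfaffians enters: in every model the computation exists and its result is unique.
-/
theorem proves_pfaffianFormula :
    Proves VSharpL (.exS 2 (.allS 1 (pfaffianFormula.iff (.eqS 1 2)))) := by
  intro M hM v s
  have : IsV0 M := ⟨fun φ h => hM φ (.inl (.inl h)), fun φ h => hM φ (.inl (.inr h))⟩
  obtain ⟨Y, P, Q, S, U, hP, hQ, h⟩ := exists_pfaffianBody
    (hM powAxiom (.inr (.inr rfl))) (v 0) (s 0)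
  refine ⟨Y, fun Y' => ?_⟩
  have e0 : Function.update (Function.update s 2 Y) 1 Y' 0 = s 0 := rfl
  have e1 : Function.update (Function.update s 2 Y) 1 Y' 1 = Y' := Function.update_self _ _ _
  have e2 : Function.update (Function.update s 2 Y) 1 Y' 2 = Y := rfl
  simp only [Formula.iff, Formula.imp, Formula.Sat]
  rw [← imp_iff_not_or, ← imp_iff_not_or, sat_pfaffianFormula, e0, e1, e2]
  constructor
  · rintro ⟨P', Q', S', U', hP', -, h'⟩
    exact h'.unique hP' hP h
  · rintro rfl
    exact ⟨P, Q, S, U, hP, hQ, h⟩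

end TwoSorted

namespace TwoSorted

/-! ### The standard model -/

theorem NTerm.eval_congr_str {M : Struct} (v : ℕ → M.Num) {s s' : ℕ → M.Str} {t : NTerm}
    (h : ∀ k ∈ t.strVars, s k = s' k) : t.eval M v s = t.eval M v s' := by
  induction t with
  | var x => rfl
  | zero => rfl
  | one => rfl
  | add t u iht ihu =>
    exact congrArg₂ M.add (iht fun k hk => h k (.inl hk)) (ihu fun k hk => h k (.inr hk))
  | mul t u iht ihu =>
    exact congrArg₂ M.mul (iht fun k hk => h k (.inl hk)) (ihu fun k hk => h k (.inr hk))
  | len X => exact congrArg M.len (h X rfl)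

theorem Formula.sat_congr_str {M : Struct} {φ : Formula} (v : ℕ → M.Num) {s s' : ℕ → M.Str}
    (h : ∀ k ∈ φ.freeStr, s k = s' k) : φ.Sat M v s ↔ φ.Sat M v s' := by
  have term (t u : NTerm) {v : ℕ → M.Num} {s s' : ℕ → M.Str}
      (h : ∀ k ∈ t.strVars ∪ u.strVars, s k = s' k) :
      t.eval M v s = t.eval M v s' ∧ u.eval M v s = u.eval M v s' :=
    ⟨NTerm.eval_congr_str v fun k hk => h k (.inl hk),
      NTerm.eval_congr_str v fun k hk => h k (.inr hk)⟩
  have bound {X : ℕ} {φ : Formula} {s s' : ℕ → M.Str} (h : ∀ k ∈ φ.freeStr \ {X}, s k = s' k)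
      (A : M.Str) (k : ℕ) (hk : k ∈ φ.freeStr) :
      Function.update s X A k = Function.update s' X A k := by
    by_cases hX : k = X
    · rw [hX, Function.update_self, Function.update_self]
    · rw [Function.update_of_ne hX, Function.update_of_ne hX, h k ⟨hk, hX⟩]
  induction φ generalizing v s s' with
  | eqN t u => rw [Sat, Sat, (term t u h).1, (term t u h).2]
  | eqS X Y => rw [Sat, Sat, h X (.inl rfl), h Y (.inr rfl)]
  | le t u => rw [Sat, Sat, (term t u h).1, (term t u h).2]
  | mem t X =>
    rw [Sat, Sat, NTerm.eval_congr_str v fun k hk => h k (.inl hk), h X (.inr rfl)]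
  | neg φ ih => exact not_congr (ih v h)
  | and φ ψ ih₁ ih₂ =>
    exact and_congr (ih₁ v fun k hk => h k (.inl hk)) (ih₂ v fun k hk => h k (.inr hk))
  | or φ ψ ih₁ ih₂ =>
    exact or_congr (ih₁ v fun k hk => h k (.inl hk)) (ih₂ v fun k hk => h k (.inr hk))
  | allN x φ ih => exact forall_congr' fun a => ih _ h
  | exN x φ ih => exact exists_congr fun a => ih _ h
  | allS X φ ih => exact forall_congr' fun A => ih v (bound h A)
  | exS X φ ih => exact exists_congr fun A => ih v (bound h A)

/-- This makes the uniqueness proved for all models available in the standard one. -/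
instance : IsV0 stdModel where
  basic φ h v s := by
    cases h <;> simp only [Formula.imp, Formula.iff, Formula.lt, Formula.bexN, Formula.ballN,
      Formula.Sat]
    case B1 => exact Nat.succ_ne_zero _
    case B2 => exact (em _).symm.imp_right Nat.succ.inj
    case B3 => exact Nat.add_zero _
    case B4 => exact (Nat.add_assoc _ _ _).symm
    case B5 => exact Nat.mul_zero _
    case B6 => exact Nat.mul_succ _ _
    case B7 => exact or_iff_not_imp_left.2 fun h =>
      le_antisymm (not_not.1 h).1 (not_not.1 h).2
    case B8 => exact Nat.le_add_right _ _
    case B9 => exact Nat.zero_le _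
    case B10 => exact Nat.le_total _ _
    case B11 =>
      have key (a b : ℕ) : (¬ a ≤ b ∨ (a ≤ b + 1 ∧ ¬ a = b + 1)) ∧
          (¬ (a ≤ b + 1 ∧ ¬ a = b + 1) ∨ a ≤ b) := by omega
      exact key _ _
    case B12 =>
      refine or_iff_not_imp_left.2 fun h => ?_
      have h : v 0 ≠ 0 := not_not.1 h
      obtain ⟨m, hm⟩ := Nat.exists_eq_succ_of_ne_zero h
      exact ⟨m, (Nat.le_succ m).trans hm.ge, hm.symm⟩
    case L1 =>
      refine or_iff_not_imp_left.2 fun h => ?_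
      have h : v 0 < (s 0).sup Nat.succ :=
        Nat.lt_of_succ_le (Finset.le_sup (f := Nat.succ) (not_not.1 h))
      exact ⟨h.le, h.ne⟩
    case L2 =>
      refine or_iff_not_imp_left.2 fun h => ?_
      have h : v 0 + 1 = (s 0).sup Nat.succ := not_not.1 h
      have hne : (s 0).Nonempty := by
        rw [Finset.nonempty_iff_ne_empty]
        intro h0
        rw [h0, Finset.sup_empty] at h
        exact Nat.succ_ne_zero _ h
      obtain ⟨y, hy, hy'⟩ := Finset.exists_mem_eq_sup _ hne Nat.succ
      rw [hy'] at h
      rwa [← Nat.succ.inj h] at hy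
    case SE =>
      refine or_iff_not_imp_left.2 fun h => ?_
      obtain ⟨hl, hm⟩ := not_not.1 h
      have hl : (s 0).sup Nat.succ = (s 1).sup Nat.succ := hl
      have hlt (i : ℕ) (x : ℕ) (hx : x ∈ s i) : x < (s i).sup Nat.succ :=
        Nat.lt_of_succ_le (Finset.le_sup (f := Nat.succ) hx)
      refine Finset.ext fun x => ?_
      by_cases hx : x < (s 0).sup Nat.succ
      · have h1 := ((hm x).resolve_left (not_not.2 hx.le)).resolve_left
          (not_not.2 ⟨hx.le, hx.ne⟩)
        exact ⟨fun h => h1.1.resolve_left (not_not.2 h), fun h => h1.2.resolve_left (not_not.2 h)⟩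
      · exact iff_of_false (fun h => hx (hlt 0 x h)) fun h => hx (hl ▸ hlt 1 x h)
  comp φ h v s := by
    classical
    obtain ⟨φ, X, y, z, hφ, hX, hyz⟩ := h
    refine ⟨(Finset.range (v y)).filter fun a => φ.Sat stdModel (Function.update v z a) s, ?_,
      fun a => or_iff_not_imp_left.2 fun h1 => or_iff_not_imp_left.2 fun h2 => ?_⟩
    · change Finset.sup (Function.update s X _ X) Nat.succ ≤ v y
      rw [Function.update_self]
      exact Finset.sup_le fun a ha =>
        Nat.succ_le_of_lt (Finset.mem_range.1 (Finset.mem_filter.1 ha).1)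
    · obtain ⟨h2, h3⟩ := not_not.1 h2
      simp only [Formula.iff, Formula.imp, Formula.Sat, NTerm.eval, Function.update_self,
        Function.update_of_ne hyz] at h2 h3 ⊢
      have h4 : a < v y := lt_of_le_of_ne h2 h3
      rw [Formula.sat_congr_str (s' := s) _ fun k hk =>
        Function.update_of_ne (fun h : k = X => hX (h ▸ hk)) _ _]
      simp only [Finset.mem_filter, Finset.mem_range, h4, true_and]
      exact ⟨(em _).symm, (em _).symm⟩

/-! ### Binary digits of sums and products, and codes of integers -/

/-- The carries in the addition of bit vectors obey the recursion of `sCarry_succ`; width x + 1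
suffices to read digit x. -/
theorem testBit_add (m n x : ℕ) :
    ((m + n).testBit x ↔ ¬ (¬ (m.testBit x ↔ n.testBit x) ↔
      sCarry (fun y => m.testBit y) (fun y => n.testBit y) x)) := by
  have hb (w m y : ℕ) (hy : y < w) : (BitVec.ofNat w m).getLsbD y = m.testBit y := by
    rw [BitVec.getLsbD_ofNat, decide_eq_true hy, Bool.true_and]
  have hc (w y : ℕ) (hy : y ≤ w) :
      (BitVec.carry y (BitVec.ofNat w m) (BitVec.ofNat w n) false = true ↔
        sCarry (fun y => m.testBit y) (fun y => n.testBit y) y) := by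
    induction y with
    | zero => simp [sCarry, slt]
    | succ y ih =>
      rw [BitVec.carry_succ, hb _ _ _ hy, hb _ _ _ hy,
        sCarry_succ fun _ _ => Nat.lt_succ_iff, ← ih (Nat.le_of_succ_le hy)]
      cases m.testBit y <;> cases n.testBit y <;> simp [Bool.atLeastTwo]
  have h := BitVec.getLsbD_add (Nat.lt_succ_self x) (BitVec.ofNat (x + 1) m)
    (BitVec.ofNat (x + 1) n)
  rw [← BitVec.ofNat_add, hb _ _ _ (Nat.lt_succ_self x), hb _ _ _ (Nat.lt_succ_self x),
    hb _ _ _ (Nat.lt_succ_self x)] at h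
  rw [h, ← hc (x + 1) x (Nat.le_succ x)]
  cases m.testBit x <;> cases n.testBit x <;> simp

theorem sIsSum_testBit {b m n k : ℕ} (h : m + n = k) :
    sIsSum b (fun x => m.testBit x) (fun x => n.testBit x) (fun x => k.testBit x) :=
  fun x _ => h ▸ testBit_add m n x

theorem sShift_testBit (m i x : ℕ) :
    sShift (fun y => m.testBit y) i x ↔ (m * 2 ^ i).testBit x := by
  rw [sShift, Nat.testBit_mul_two_pow]
  constructor
  · rintro ⟨y, -, rfl, h⟩
    simpa using h
  · intro h
    rw [Bool.and_eq_true, decide_eq_true_eq] at h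
    exact ⟨x - i, Nat.sub_le _ _, Nat.sub_add_cancel h.1, h.2⟩

theorem mod_two_pow_succ (n i : ℕ) :
    n % 2 ^ (i + 1) = n % 2 ^ i + 2 ^ i * (n.testBit i).toNat := by
  rw [Nat.mod_pow_succ, Nat.toNat_testBit]

/-- The i lowest digits of n form n mod 2^i, and passing to i + 1 adds 2^i times digit i. Multiplied
by m, this is the shifted summand of the school algorithm. -/
theorem sIsMulRun_testBit {b l m n : ℕ} {A C : ℕ → Prop} {W : ℕ → ℕ → Prop}
    (hA : ∀ x, A x ↔ m.testBit x) (hC : ∀ x, C x ↔ n.testBit x)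
    (hW : ∀ i ≤ l, ∀ x, W i x ↔ (m * (n % 2 ^ i)).testBit x) : sIsMulRun b l A C W := by
  obtain rfl : A = fun x => m.testBit x = true := funext fun x => propext (hA x)
  obtain rfl : C = fun x => n.testBit x = true := funext fun x => propext (hC x)
  have hW' (i : ℕ) (hi : i ≤ l) : W i = fun x => (m * (n % 2 ^ i)).testBit x = true :=
    funext fun x => propext (hW i hi x)
  refine ⟨fun x _ => ?_, fun i hi hil => ?_⟩
  · rw [hW' 0 (Nat.zero_le l)]
    simp [Nat.mod_one]
  have hil := slt_iff.1 hil
  rw [hW' i hi, hW' (i + 1) hil,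
    show sShift (fun x => m.testBit x = true) i = fun x => (m * 2 ^ i).testBit x = true from
      funext fun x => propext (sShift_testBit m i x)]
  refine ⟨fun h => sIsSum_testBit ?_, fun h x _ => ?_⟩
  · rw [mod_two_pow_succ, h, ← mul_add]
    simp
  · rw [Bool.not_eq_true] at h
    rw [mod_two_pow_succ, h]
    simp

theorem mem_encodeInt_zero (z : ℤ) : 0 ∈ encodeInt z ↔ z < 0 := by
  by_cases h : z < 0 <;> simp [encodeInt, h]

theorem mem_encodeInt_succ (z : ℤ) (x : ℕ) : x + 1 ∈ encodeInt z ↔ z.natAbs.testBit x := by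
  by_cases h : z < 0 <;> simp [encodeInt, h]

theorem natAbs_decodeInt (D : Finset ℕ) (x : ℕ) :
    (decodeInt D).natAbs.testBit x ↔ x + 1 ∈ D := by
  let E : Finset ℕ := (D.erase 0).image Nat.pred
  have h1 : ∑ x ∈ D.erase 0, 2 ^ (x - 1) = ∑ i ∈ E, 2 ^ i := by
    rw [Finset.sum_image]
    · rfl
    · intro a ha b hb hab
      have ha : a ≠ 0 := Finset.ne_of_mem_erase ha
      have hb : b ≠ 0 := Finset.ne_of_mem_erase hb
      have : a - 1 = b - 1 := hab
      omega
  have h2 : (decodeInt D).natAbs = ∑ i ∈ E, 2 ^ i := by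
    rw [← h1, decodeInt, Int.natAbs_mul]
    have : (∑ x ∈ D.erase 0, (2 : ℤ) ^ (x - 1)) = ((∑ x ∈ D.erase 0, 2 ^ (x - 1) : ℕ) : ℤ) := by
      push_cast; rfl
    rw [this, Int.natAbs_natCast]
    split_ifs <;> simp
  rw [h2, ← Nat.mem_bitIndices, ← List.mem_toFinset, Finset.toFinset_bitIndices_sum_two_pow]
  simp only [E, Finset.mem_image, Finset.mem_erase]
  constructor
  · rintro ⟨y, ⟨hy, hy'⟩, rfl⟩
    rwa [← Nat.succ_pred_eq_of_ne_zero hy] at hy'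
  · exact fun h => ⟨x + 1, ⟨Nat.succ_ne_zero x, h⟩, rfl⟩

theorem decodeInt_eq (D : Finset ℕ) :
    decodeInt D = if 0 ∈ D then -((decodeInt D).natAbs : ℤ) else (decodeInt D).natAbs := by
  have h : (0 : ℤ) ≤ ∑ x ∈ D.erase 0, 2 ^ (x - 1) := Finset.sum_nonneg fun _ _ => by positivity
  rw [decodeInt, Int.natAbs_mul, Nat.cast_mul, Int.natAbs_of_nonneg h]
  split_ifs <;> simp

/-- The value of an integer that is given by its sign and its absolute value. -/
noncomputable def signed (σ : Prop) (m : ℕ) : ℤ := open Classical in if σ then -m else m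

/-- For opposite signs, comparing m with n decides which subtraction is recorded. By `hb` the digits
up to `b` suffice to tell whether the result is zero. -/
theorem sIsIntSum_signed {b m n k : ℕ} {σ τ ρ : Prop}
    (hρ : ρ ↔ signed σ m + signed τ n < 0) (h : k = (signed σ m + signed τ n).natAbs)
    (hb : k < 2 ^ b) :
    sIsIntSum b ⟨σ, fun x => m.testBit x⟩ ⟨τ, fun x => n.testBit x⟩
      ⟨ρ, fun x => k.testBit x⟩ := by
  have hz : sIsZero b (fun x => k.testBit x) ↔ k = 0 := by
    refine ⟨fun h => Nat.eq_of_testBit_eq fun x => ?_, fun h => ?_⟩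
    · rw [Nat.zero_testBit]
      rcases le_or_gt x b with hx | hx
      · simpa using h x hx
      · exact Nat.testBit_eq_false_of_lt (hb.trans (Nat.pow_lt_pow_right one_lt_two hx))
    · subst h; intro x _; simp
  unfold sIsIntSum
  dsimp only
  rw [hz]
  unfold signed at hρ h
  by_cases hσ : σ <;> by_cases hτ : τ <;> simp only [hσ, hτ, if_true, if_false] at h hρ ⊢
  · left
    refine ⟨trivial, sIsSum_testBit ?_, ?_⟩
    · omega
    · rw [hρ]; simp only [true_and]; omega
  · right
    rcases le_total m n with hmn | hmn
    · refine ⟨by simp, .inr ⟨sIsSum_testBit ?_, ?_⟩⟩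
      · omega
      · rw [hρ]; simp only [false_and, iff_false]; omega
    · refine ⟨by simp, .inl ⟨sIsSum_testBit ?_, ?_⟩⟩
      · omega
      · rw [hρ]; simp only [true_and]; omega
  · right
    rcases le_total m n with hmn | hmn
    · refine ⟨by simp, .inr ⟨sIsSum_testBit ?_, ?_⟩⟩
      · omega
      · rw [hρ]; simp only [true_and]; omega
    · refine ⟨by simp, .inl ⟨sIsSum_testBit ?_, ?_⟩⟩
      · omega
      · rw [hρ]; simp only [false_and, iff_false]; omega
  · left
    refine ⟨trivial, sIsSum_testBit ?_, ?_⟩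
    · omega
    · rw [hρ]; simp only [false_and, iff_false]; omega

/-- With s = x + y the value lies between s(s + 1) and s(s + 3) < (s + 1)(s + 2). So it determines
s, and then y. -/
theorem spair_injective {x y x' y' : ℕ} (h : spair x y = spair x' y') : x = x' ∧ y = y' := by
  unfold spair at h
  have key : ∀ {x y x' y' : ℕ}, (x + y) * (x + y + 1) + (1 + 1) * y =
      (x' + y') * (x' + y' + 1) + (1 + 1) * y' → x' + y' ≤ x + y := by
    intro x y x' y' h
    by_contra hlt
    push Not at hlt
    nlinarith
  have hs : x + y = x' + y' := le_antisymm (key h.symm) (key h)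
  rw [hs] at h
  omega

end TwoSorted

namespace TwoSorted

/-! ### Powers of matrices in the standard model -/

/-- The entry of the integer matrix that is coded by `X`. -/
def entry (X : Finset ℕ) (i j : ℕ) : ℤ :=
  decodeInt ((Finset.range (X.sup Nat.succ)).filter fun x => natPair i (natPair j x) ∈ X)

/-- The powers of an integer `n × n` matrix. -/
def intPow (n : ℕ) (e : ℕ → ℕ → ℤ) : ℕ → ℕ → ℕ → ℤ
  | 0, a, c => if a = c then 1 else 0
  | i + 1, a, c => ∑ l ∈ Finset.range n, intPow n e i a l * e l c

/-- The partial sums of the inner products in the computation of the powers. -/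
def intSum (n : ℕ) (e : ℕ → ℕ → ℤ) (i a c l : ℕ) : ℤ :=
  ∑ l' ∈ Finset.range l, intPow n e i a l' * e l' c

theorem nat_le_spair_right (x y : ℕ) : y ≤ spair x y := le_spair_right (M := stdModel) x y

theorem nat_spair_mono {x y x' y' : ℕ} (hx : x ≤ x') (hy : y ≤ y') : spair x y ≤ spair x' y' :=
  spair_mono (M := stdModel) hx hy

theorem lt_len {X : Finset ℕ} {x : ℕ} (h : x ∈ X) : x < X.sup Nat.succ :=
  Nat.lt_of_succ_le (Finset.le_sup (f := Nat.succ) h)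

theorem mem_entry_iff (X : Finset ℕ) (i j x : ℕ) :
    x ∈ (Finset.range (X.sup Nat.succ)).filter (fun x => natPair i (natPair j x) ∈ X) ↔
      srow (srow (· ∈ X) i) j x := by
  rw [Finset.mem_filter, Finset.mem_range, and_iff_right_of_imp]
  · rfl
  · exact fun h => ((nat_le_spair_right j x).trans (nat_le_spair_right i _)).trans_lt (lt_len h)

theorem entry_testBit (X : Finset ℕ) (i j x : ℕ) :
    (entry X i j).natAbs.testBit x ↔ (sInt (srow (srow (· ∈ X) i) j)).abs x := by
  rw [entry, natAbs_decodeInt, mem_entry_iff]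
  rfl

/-- A zero entry may carry the sign bit in its code; this is harmless, because `signed` gives 0 for
either sign. -/
theorem entry_eq_signed (X : Finset ℕ) (i j : ℕ) :
    entry X i j = signed (sInt (srow (srow (· ∈ X) i) j)).neg (entry X i j).natAbs := by
  have h : (sInt (srow (srow (· ∈ X) i) j)).neg ↔ 0 ∈ (Finset.range (X.sup Nat.succ)).filter
    (fun x => natPair i (natPair j x) ∈ X) := (mem_entry_iff X i j 0).symm
  rw [signed, h]
  conv_lhs => rw [entry, decodeInt_eq]
  congr

theorem entry_lt (X : Finset ℕ) (i j : ℕ) : (entry X i j).natAbs < 2 ^ X.sup Nat.succ := by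
  refine Nat.lt_pow_two_of_testBit _ fun x hx => ?_
  rw [← Bool.not_eq_true, entry_testBit]
  intro h
  have h1 : spair i (spair j (x + 1)) ∈ X := h
  have := ((nat_le_spair_right j (x + 1)).trans (nat_le_spair_right i _)).trans_lt (lt_len h1)
  omega

theorem natAbs_sum_mul_le {l : ℕ} {f g : ℕ → ℤ} {A B : ℕ} (hf : ∀ i, (f i).natAbs ≤ A)
    (hg : ∀ i, (g i).natAbs ≤ B) : (∑ i ∈ Finset.range l, f i * g i).natAbs ≤ l * (A * B) := by
  refine (Int.natAbs_sum_le _ _).trans ?_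
  refine (Finset.sum_le_card_nsmul _ _ (A * B) fun i _ => ?_).trans (by simp)
  rw [Int.natAbs_mul]
  exact Nat.mul_le_mul (hf i) (hg i)

/-- One more factor multiplies the bound by n · 2^L ≤ 2^(n + L). The number of digits thus grows
linearly with the exponent and stays within the bound `B` of the powering axiom. -/
theorem natAbs_intPow_le {n L : ℕ} {e : ℕ → ℕ → ℤ} (he : ∀ i j, (e i j).natAbs ≤ 2 ^ L)
    (i a c : ℕ) : (intPow n e i a c).natAbs ≤ 2 ^ ((n + L) * i) := by
  induction i generalizing c with
  | zero => unfold intPow; split_ifs <;> simp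
  | succ i ih =>
    rw [intPow]
    refine (natAbs_sum_mul_le ih fun l => he l c).trans ?_
    calc n * (2 ^ ((n + L) * i) * 2 ^ L) ≤ 2 ^ n * (2 ^ ((n + L) * i) * 2 ^ L) :=
          Nat.mul_le_mul_right _ Nat.lt_two_pow_self.le
      _ = 2 ^ ((n + L) * (i + 1)) := by ring

theorem natAbs_intSum_le {n L l : ℕ} {e : ℕ → ℕ → ℤ} (he : ∀ i j, (e i j).natAbs ≤ 2 ^ L)
    (hl : l ≤ n) (i a c : ℕ) : (intSum n e i a c l).natAbs ≤ 2 ^ ((n + L) * (i + 1)) := by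
  refine (natAbs_sum_mul_le (natAbs_intPow_le he i a) fun l => he l c).trans ?_
  calc l * (2 ^ ((n + L) * i) * 2 ^ L) ≤ 2 ^ n * (2 ^ ((n + L) * i) * 2 ^ L) :=
        Nat.mul_le_mul_right _ (hl.trans Nat.lt_two_pow_self.le)
    _ = 2 ^ ((n + L) * (i + 1)) := by ring

theorem sInt_eq {A : ℕ → Prop} {v : ℤ} (hA : ∀ z, A z ↔ z ∈ encodeInt v) :
    sInt A = ⟨v < 0, fun x => v.natAbs.testBit x⟩ := by
  unfold sInt
  congr 1
  · exact propext ((hA 0).trans (mem_encodeInt_zero v))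
  · exact funext fun x => propext ((hA (x + 1)).trans (mem_encodeInt_succ v x))

theorem signed_mul (σ τ : Prop) (m n : ℕ) :
    signed σ m * signed τ n = signed (¬ (σ ↔ τ)) (m * n) := by
  by_cases hσ : σ <;> by_cases hτ : τ <;> simp [signed, hσ, hτ]

theorem signed_natAbs (v : ℤ) : signed (v < 0) v.natAbs = v := by
  by_cases h : v < 0 <;> simp only [signed, h, if_true, if_false] <;> omega

theorem mem_encodeInt_le {v : ℤ} {z B : ℕ} (hv : v.natAbs < 2 ^ B) (hz : z ∈ encodeInt v) :
    z ≤ B := by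
  rcases z with _ | z
  · exact Nat.zero_le _
  · rw [mem_encodeInt_succ] at hz
    by_contra h
    rw [Nat.testBit_eq_false_of_lt (hv.trans_le (Nat.pow_le_pow_right two_pos (by omega)))] at hz
    exact Bool.noConfusion hz

theorem natAbs_lt_of_code {A : ℕ → Prop} {v : ℤ} {b : ℕ} (hA : ∀ z, A z ↔ z ∈ encodeInt v)
    (hb : ∀ z, A z → z < b) : v.natAbs < 2 ^ b := by
  refine Nat.lt_pow_two_of_testBit _ fun x hx => ?_
  rw [← Bool.not_eq_true, ← mem_encodeInt_succ, ← hA]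
  intro h
  have := hb _ h
  omega

/-- With the rows holding the true powers, partial sums and school products, each clause becomes an
identity of integers. `hb` bounds the partial sums, so that the test for zero is reliable. -/
theorem sIsPowSeq_of_rows {b n k : ℕ} {X : Finset ℕ} {Y S U : ℕ → Prop}
    (hY : ∀ i ≤ k, ∀ a < n, ∀ c < n, ∀ z,
      srow (srow (srow Y i) a) c z ↔ z ∈ encodeInt (intPow n (entry X) i a c))
    (hS : ∀ i < k, ∀ a < n, ∀ c < n, ∀ l ≤ n, ∀ z,
      srow (srow (srow (srow S i) a) c) l z ↔ z ∈ encodeInt (intSum n (entry X) i a c l))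
    (hU : ∀ i < k, ∀ a < n, ∀ c < n, ∀ l < n, ∀ m ≤ X.sup Nat.succ, ∀ z,
      srow (srow (srow (srow (srow U i) a) c) l) m z ↔
        ((intPow n (entry X) i a l).natAbs * ((entry X l c).natAbs % 2 ^ m)).testBit z)
    (hb : ∀ z, S z → z < b) :
    sIsPowSeq b (X.sup Nat.succ) n k (· ∈ X) Y S U := by
  unfold sIsPowSeq
  dsimp only
  simp only [slt_iff]
  refine ⟨fun a _ ha c _ hc z _ => ?_, fun i _ hi a _ ha c _ hc => ⟨?_, ?_, ?_⟩⟩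
  · rw [hY 0 (Nat.zero_le k) a ha c hc, intPow]
    by_cases hac : a = c
    · rcases z with _ | z
      · simp [hac, mem_encodeInt_zero]
      · rw [mem_encodeInt_succ, if_pos hac, Int.natAbs_one, Nat.testBit_one_eq_true_iff_self_eq_zero]
        simp [hac]
    · simp [hac, encodeInt]
  · intro z _
    rw [hS i hi a ha c hc 0 (Nat.zero_le n)]
    simp [intSum, encodeInt]
  · intro l _ hl
    have h1 := sInt_eq (hY i hi.le a ha l hl)
    have h2 := sInt_eq (hS i hi a ha c hc l hl.le)
    have h3 := sInt_eq (hS i hi a ha c hc (l + 1) hl)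
    have h4 : srow (srow (srow (srow (srow U i) a) c) l) (X.sup Nat.succ) = fun z =>
        ((intPow n (entry X) i a l).natAbs * (entry X l c).natAbs).testBit z = true := by
      funext z
      rw [hU i hi a ha c hc l hl _ le_rfl, Nat.mod_eq_of_lt (entry_lt X l c)]
    -- The recursion of the partial sums, with the product given by sign and absolute value; the
    -- sign of the entry of `X` is the bit found in the string.
    have h5 : intSum n (entry X) i a c (l + 1) =
        signed (intSum n (entry X) i a c l < 0) (intSum n (entry X) i a c l).natAbs +
        signed (¬ (intPow n (entry X) i a l < 0 ↔ (sInt (srow (srow (· ∈ X) l) c)).neg))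
          ((intPow n (entry X) i a l).natAbs * (entry X l c).natAbs) := by
      rw [← signed_mul, signed_natAbs, signed_natAbs, ← entry_eq_signed, intSum,
        Finset.sum_range_succ]
      rfl
    refine ⟨sIsMulRun_testBit (fun x => ?_) (fun x => (entry_testBit X l c x).symm)
      (hU i hi a ha c hc l hl), ?_⟩
    · rw [h1]
    · rw [h1, h2, h3, h4]
      refine sIsIntSum_signed ?_ ?_ ?_
      · rw [h5]
      · rw [h5]
      · refine natAbs_lt_of_code (hS i hi a ha c hc (l + 1) hl) fun z hz => ?_
        have := hb _ hz
        exact (((nat_le_spair_right _ z).trans (nat_le_spair_right _ _)).trans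
          ((nat_le_spair_right _ _).trans (nat_le_spair_right _ _))).trans_lt this
  · intro z _
    rw [hY (i + 1) hi a ha c hc, hS i hi a ha c hc n le_rfl]
    rfl

/-- `Y`, `S` and `U` collect the required positions below the common bound `T`. The growth estimates
show that nothing required is cut off, and injectivity of pairing that nothing foreign enters a row.
-/
theorem exists_isPowSeq_nat (n k : ℕ) (X : Finset ℕ) :
    ∃ Y S U : Finset ℕ, (Y.sup Nat.succ ≤ sPowBound n k (X.sup Nat.succ) ∧
      S.sup Nat.succ ≤ sPowBound n k (X.sup Nat.succ) ∧
      U.sup Nat.succ ≤ sPowBound n k (X.sup Nat.succ)) ∧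
      sIsPowSeq (X.sup Nat.succ + Y.sup Nat.succ + S.sup Nat.succ + U.sup Nat.succ)
        (X.sup Nat.succ) n k (· ∈ X) (· ∈ Y) (· ∈ S) (· ∈ U) ∧
      ∀ i ≤ k, ∀ a < n, ∀ c < n, ∀ z, srow (srow (srow (· ∈ Y) i) a) c z ↔
        z ∈ encodeInt (intPow n (entry X) i a c) := by
  classical
  set L := X.sup Nat.succ with hL
  set T := sPowBound n k L with hT
  set B := (k + 1) * (n + L + 1) with hB
  have he : ∀ i j, (entry X i j).natAbs ≤ 2 ^ L := fun i j => (entry_lt X i j).le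
  have hnB : n ≤ B := by rw [hB]; nlinarith
  have hLB : L ≤ B := by rw [hB]; nlinarith
  have hkB : k ≤ B := by rw [hB]; nlinarith
  have hlt (i : ℕ) (hi : i ≤ k) : (n + L) * i < B := by
    rw [hB]; nlinarith [Nat.mul_le_mul_left (n + L) hi]
  have hlt' (m i : ℕ) (hi : i ≤ k) (hm : m ≤ 2 ^ ((n + L) * i)) : m < 2 ^ B :=
    hm.trans_lt (Nat.pow_lt_pow_right one_lt_two (hlt i hi))
  have fit {i a c l m z : ℕ} (hi : i ≤ B) (ha : a ≤ B) (hc : c ≤ B) (hl : l ≤ B) (hm : m ≤ B)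
      (hz : z ≤ B) : spair i (spair a (spair c (spair l (spair m z)))) < T :=
    Nat.lt_succ_of_le (nat_spair_mono hi (nat_spair_mono ha (nat_spair_mono hc
      (nat_spair_mono hl (nat_spair_mono hm hz)))))
  -- Since z ≤ ⟨0, z⟩, a shorter tuple is padded by an index 0 and compared with the longest one.
  have fit₄ {i a c l z : ℕ} (hi : i ≤ B) (ha : a ≤ B) (hc : c ≤ B) (hl : l ≤ B)
      (hz : z ≤ B) : spair i (spair a (spair c (spair l z))) < T :=
    (nat_spair_mono le_rfl (nat_spair_mono le_rfl (nat_spair_mono le_rfl (nat_spair_mono le_rfl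
      (nat_le_spair_right 0 z))))).trans_lt (fit hi ha hc hl (Nat.zero_le B) hz)
  have fit₃ {i a c z : ℕ} (hi : i ≤ B) (ha : a ≤ B) (hc : c ≤ B) (hz : z ≤ B) :
      spair i (spair a (spair c z)) < T :=
    (nat_spair_mono le_rfl (nat_spair_mono le_rfl (nat_spair_mono le_rfl
      (nat_le_spair_right 0 z)))).trans_lt (fit₄ hi ha hc (Nat.zero_le B) hz)
  have bound (P : ℕ → Prop) : ((Finset.range T).filter P).sup Nat.succ ≤ T :=
    Finset.sup_le fun w hw =>
      Nat.succ_le_of_lt (Finset.mem_range.1 (Finset.mem_filter.1 hw).1)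
  let Y := (Finset.range T).filter fun w => ∃ i a c z,
    w = spair i (spair a (spair c z)) ∧ z ∈ encodeInt (intPow n (entry X) i a c)
  let S := (Finset.range T).filter fun w => ∃ i a c l z,
    w = spair i (spair a (spair c (spair l z))) ∧ z ∈ encodeInt (intSum n (entry X) i a c l)
  let U := (Finset.range T).filter fun w => ∃ i a c l m z,
    w = spair i (spair a (spair c (spair l (spair m z)))) ∧
      ((intPow n (entry X) i a l).natAbs * ((entry X l c).natAbs % 2 ^ m)).testBit z
  have hY : ∀ i ≤ k, ∀ a < n, ∀ c < n, ∀ z, srow (srow (srow (· ∈ Y) i) a) c z ↔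
      z ∈ encodeInt (intPow n (entry X) i a c) := by
    intro i hi a ha c hc z
    change spair i (spair a (spair c z)) ∈ Y ↔ _
    rw [Finset.mem_filter, Finset.mem_range]
    constructor
    · rintro ⟨-, i', a', c', z', h, h'⟩
      obtain ⟨rfl, h1⟩ := spair_injective h
      obtain ⟨rfl, h2⟩ := spair_injective h1
      obtain ⟨rfl, rfl⟩ := spair_injective h2
      exact h'
    · intro h
      refine ⟨fit₃ (hi.trans hkB) (ha.le.trans hnB) (hc.le.trans hnB)
        (mem_encodeInt_le (hlt' _ i hi (natAbs_intPow_le he i a c)) h), i, a, c, z, rfl, h⟩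
  refine ⟨Y, S, U, ⟨bound _, bound _, bound _⟩, sIsPowSeq_of_rows hY ?_ ?_ ?_, hY⟩
  · intro i hi a ha c hc l hl z
    change spair i (spair a (spair c (spair l z))) ∈ S ↔ _
    rw [Finset.mem_filter, Finset.mem_range]
    constructor
    · rintro ⟨-, i', a', c', l', z', h, h'⟩
      obtain ⟨rfl, h1⟩ := spair_injective h
      obtain ⟨rfl, h2⟩ := spair_injective h1
      obtain ⟨rfl, h3⟩ := spair_injective h2
      obtain ⟨rfl, rfl⟩ := spair_injective h3
      exact h'
    · intro h
      exact ⟨fit₄ (hi.le.trans hkB) (ha.le.trans hnB) (hc.le.trans hnB) (hl.trans hnB)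
        (mem_encodeInt_le (hlt' _ (i + 1) hi (natAbs_intSum_le he hl i a c)) h),
        i, a, c, l, z, rfl, h⟩
  · intro i hi a ha c hc l hl m hm z
    change spair i (spair a (spair c (spair l (spair m z)))) ∈ U ↔ _
    rw [Finset.mem_filter, Finset.mem_range]
    constructor
    · rintro ⟨-, i', a', c', l', m', z', h, h'⟩
      obtain ⟨rfl, h1⟩ := spair_injective h
      obtain ⟨rfl, h2⟩ := spair_injective h1
      obtain ⟨rfl, h3⟩ := spair_injective h2
      obtain ⟨rfl, h4⟩ := spair_injective h3
      obtain ⟨rfl, rfl⟩ := spair_injective h4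
      exact h'
    · intro h
      have h1 : (intPow n (entry X) i a l).natAbs * ((entry X l c).natAbs % 2 ^ m) <
          2 ^ B := by
        refine hlt' _ (i + 1) hi ?_
        calc _ ≤ 2 ^ ((n + L) * i) * 2 ^ L :=
              Nat.mul_le_mul (natAbs_intPow_le he i a l) ((Nat.mod_le _ _).trans (he l c))
          _ = 2 ^ ((n + L) * i + L) := (pow_add _ _ _).symm
          _ ≤ 2 ^ ((n + L) * (i + 1)) := Nat.pow_le_pow_right two_pos (by nlinarith)
      have h2 : z ≤ B := by
        by_contra hz
        rw [Nat.testBit_eq_false_of_lt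
          (h1.trans_le (Nat.pow_le_pow_right two_pos (by omega)))] at h
        exact Bool.noConfusion h
      exact ⟨fit (hi.le.trans hkB) (ha.le.trans hnB) (hc.le.trans hnB) (hl.le.trans hnB)
        (hm.trans hLB) h2, i, a, c, l, m, z, rfl, h⟩
  · intro z hz
    have := lt_len hz
    omega

end TwoSorted

namespace TwoSorted

/-! ### The Pfaffian as a sum over all permutations -/

section FullSum

variable {n : ℕ} {K : Type*} [CommRing K]

/-- The term of the permutation `σ` in the Pfaffian, for vertices in pairs `(i, false)`,
`(i, true)`. -/
def pfTerm (A : Matrix (Fin n × Bool) (Fin n × Bool) K) (σ : Equiv.Perm (Fin n × Bool)) : K :=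
  ((Equiv.Perm.sign σ : ℤ) : K) * ∏ i, A (σ (i, false)) (σ (i, true))

/-- The sum of the terms of all permutations. -/
def fullPf (A : Matrix (Fin n × Bool) (Fin n × Bool) K) : K := ∑ σ, pfTerm A σ

/-- Expanding all products gives a sum over maps g of the vertices. For fixed g, the sum over σ is
the determinant of `B` with its columns rearranged by g. It vanishes unless g is a permutation, and
then it is sgn(g) det B. -/
theorem fullPf_congruence (B N : Matrix (Fin n × Bool) (Fin n × Bool) K) :
    fullPf (B * N * B.transpose) = B.det * fullPf N := by
  let e : (Fin n × Bool → Fin n × Bool) ≃ (Fin n → (Fin n × Bool) × (Fin n × Bool)) :=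
    (Equiv.curry _ _ _).trans (Equiv.piCongrRight fun _ => Equiv.boolArrowEquivProd _)
  have h1 (p q : Fin n × Bool) : (B * N * B.transpose) p q =
      ∑ z : (Fin n × Bool) × (Fin n × Bool), B p z.1 * B q z.2 * N z.1 z.2 := by
    rw [Fintype.sum_prod_type_right, Matrix.mul_apply]
    refine Finset.sum_congr rfl fun y _ => ?_
    rw [Matrix.mul_apply, Matrix.transpose_apply, Finset.sum_mul]
    exact Finset.sum_congr rfl fun x _ => by ring
  have h2 (σ : Equiv.Perm (Fin n × Bool)) : pfTerm (B * N * B.transpose) σ =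
      ∑ g : Fin n × Bool → Fin n × Bool, (((Equiv.Perm.sign σ : ℤ) : K) * ∏ p, B (σ p) (g p)) *
        ∏ i, N (g (i, false)) (g (i, true)) := by
    rw [pfTerm]
    simp only [h1]
    rw [Finset.prod_univ_sum, Fintype.piFinset_univ, Finset.mul_sum, ← e.sum_comp]
    refine Finset.sum_congr rfl fun g _ => ?_
    rw [Fintype.prod_prod_type, mul_assoc, ← Finset.prod_mul_distrib]
    congr 1
    refine Finset.prod_congr rfl fun i _ => ?_
    rw [Fintype.prod_bool, mul_comm (B (σ (i, true)) _)]
    rfl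
  have h3 (g : Fin n × Bool → Fin n × Bool) :
      ∑ σ : Equiv.Perm (Fin n × Bool), ((Equiv.Perm.sign σ : ℤ) : K) * ∏ p, B (σ p) (g p) =
        (B.submatrix id g).det := by
    rw [Matrix.det_apply']
    rfl
  rw [fullPf, Finset.sum_congr rfl fun σ _ => h2 σ, Finset.sum_comm, fullPf, Finset.mul_sum]
  symm
  -- Only bijective g survive: a repeated value repeats a column of `B`.
  refine Fintype.sum_of_injective (fun τ : Equiv.Perm (Fin n × Bool) => (τ : _ → _))
    DFunLike.coe_injective _ _ (fun g hg => ?_) fun τ => ?_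
  · have hinj : ¬ g.Injective := fun h =>
      hg ⟨Equiv.ofBijective g (Finite.injective_iff_bijective.1 h), rfl⟩
    simp only [Function.Injective] at hinj
    push Not at hinj
    obtain ⟨p, q, hpq, hne⟩ := hinj
    rw [← Finset.sum_mul, h3, Matrix.det_zero_of_column_eq hne fun k => by
      simp only [Matrix.submatrix_apply, hpq], zero_mul]
  · rw [← Finset.sum_mul, h3, Matrix.det_permute', pfTerm]
    ring

/-- The permutation `(i, b) ↦ (τ i, b + ε i)`. -/
def pairPerm (τ : Equiv.Perm (Fin n)) (ε : Fin n → Bool) : Equiv.Perm (Fin n × Bool) :=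
  (Equiv.prodCongrRight fun i => if ε i then Equiv.swap false true else 1).trans
    (Equiv.prodCongrLeft fun _ => τ)

theorem pairPerm_apply (τ : Equiv.Perm (Fin n)) (ε : Fin n → Bool) (i : Fin n) (b : Bool) :
    pairPerm τ ε (i, b) = (τ i, xor b (ε i)) := by
  cases h : ε i <;> cases b <;> simp [pairPerm, h]

/-- Exchanging the two ends of a pair changes both the sign of the permutation and, by skew
symmetry, one factor. Permuting the pairs acts twice on the indices, so it is even, and it only
reorders the factors. -/
theorem pfTerm_mul_pairPerm {A : Matrix (Fin n × Bool) (Fin n × Bool) K}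
    (hA : A.transpose = -A) (σ : Equiv.Perm (Fin n × Bool)) (τ : Equiv.Perm (Fin n))
    (ε : Fin n → Bool) : pfTerm A (σ * pairPerm τ ε) = pfTerm A σ := by
  have hs : Equiv.Perm.sign (pairPerm τ ε) = ∏ i, if ε i then -1 else 1 := by
    rw [pairPerm, Equiv.Perm.sign_trans, Equiv.Perm.sign_prodCongrRight,
      Equiv.Perm.sign_prodCongrLeft, Fintype.prod_bool, ← sq, Int.units_sq, one_mul]
    exact Finset.prod_congr rfl fun i _ => by split_ifs <;> simp
  have hs' : ((Equiv.Perm.sign (pairPerm τ ε) : ℤ) : K) = ∏ i, if ε i then -1 else 1 := by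
    rw [hs]
    push_cast
    exact Finset.prod_congr rfl fun i _ => by split_ifs <;> simp
  have hA' (p q : Fin n × Bool) : A q p = - A p q := congrFun (congrFun hA p) q
  have hp : ∏ i, A ((σ * pairPerm τ ε) (i, false)) ((σ * pairPerm τ ε) (i, true)) =
      (∏ i, if ε i then (-1 : K) else 1) * ∏ i, A (σ (i, false)) (σ (i, true)) := by
    rw [← Equiv.prod_comp τ fun i => A (σ (i, false)) (σ (i, true)), ← Finset.prod_mul_distrib]
    refine Finset.prod_congr rfl fun i _ => ?_
    simp only [Equiv.Perm.mul_apply, pairPerm_apply]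
    cases h : ε i
    · simp
    · simp [hA' (σ (τ i, false)) (σ (τ i, true))]
  have h1 : (∏ i, if ε i then (-1 : K) else 1) * (∏ i, if ε i then (-1 : K) else 1) = 1 := by
    rw [← Finset.prod_mul_distrib]
    exact Finset.prod_eq_one fun i _ => by split_ifs <;> simp
  rw [pfTerm, hp, Equiv.Perm.sign_mul, pfTerm]
  push_cast
  rw [hs']
  linear_combination ((Equiv.Perm.sign σ : ℤ) : K) * (∏ i, A (σ (i, false)) (σ (i, true))) * h1

/-- The number of the vertex `(i, b)`. -/
def vertexEquiv (n : ℕ) : Fin n × Bool ≃ Fin (2 * n) where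
  toFun p := ⟨2 * p.1 + p.2.toNat, by
    have := p.1.isLt
    have := p.2.toNat_le
    omega⟩
  invFun v := (⟨v / 2, by omega⟩, decide (v.val % 2 = 1))
  left_inv p := by
    obtain ⟨i, b⟩ := p
    cases b <;> simp [Fin.ext_iff]
    omega
  right_inv v := by
    refine Fin.ext ?_
    by_cases h : v.val % 2 = 1 <;> simp [h] <;> omega

theorem vertexEquiv_val (i : Fin n) (b : Bool) :
    (vertexEquiv n (i, b) : ℕ) = 2 * i + b.toNat := rfl

/-- The permutations of the vertices that list a perfect matching in normal form. -/
def IsNormal (σ : Equiv.Perm (Fin n × Bool)) : Prop :=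
  (∀ i, vertexEquiv n (σ (i, false)) < vertexEquiv n (σ (i, true))) ∧
    StrictMono fun i => vertexEquiv n (σ (i, false))

/-- Each matching has one normal listing: orient every pair from its smaller to its larger vertex,
then sort the pairs by smaller vertex. Two sortings agree, because strictly monotone maps with the
same range are equal. -/
theorem existsUnique_isNormal (σ : Equiv.Perm (Fin n × Bool)) :
    ∃! x : Equiv.Perm (Fin n) × (Fin n → Bool), IsNormal (σ * pairPerm x.1 x.2) := by
  let f (p : Fin n × Bool) : Fin (2 * n) := vertexEquiv n (σ p)
  have hf : f.Injective := (vertexEquiv n).injective.comp σ.injective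
  let δ (i : Fin n) : Bool := decide (f (i, true) < f (i, false))
  let m (i : Fin n) : Fin (2 * n) := f (i, δ i)
  have hm : m.Injective := fun i j h => (Prod.ext_iff.1 (hf h)).1
  have hδ (i : Fin n) : f (i, δ i) < f (i, !δ i) := by
    have hne : f (i, true) ≠ f (i, false) := fun h => by simpa using hf h
    by_cases h : f (i, true) < f (i, false)
    · simp [δ, h]
    · simpa [δ, h] using lt_of_le_of_ne (not_lt.1 h) hne.symm
  have hδ' (i : Fin n) (b : Bool) (h : f (i, b) < f (i, !b)) : b = δ i := by
    cases b
    · simpa [δ] using h.le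
    · simpa [δ] using h
  have key (τ : Equiv.Perm (Fin n)) (ε : Fin n → Bool) (i : Fin n) (b : Bool) :
      vertexEquiv n ((σ * pairPerm τ ε) (i, b)) = f (τ i, xor b (ε i)) := by
    rw [Equiv.Perm.mul_apply, pairPerm_apply]
  refine ⟨(Tuple.sort m, fun i => δ (Tuple.sort m i)), ⟨fun i => ?_, ?_⟩, ?_⟩
  · rw [key, key]
    simpa using hδ (Tuple.sort m i)
  · simp only [key, Bool.false_xor]
    exact (Tuple.monotone_sort m).strictMono_of_injective (hm.comp (Tuple.sort m).injective)
  · rintro ⟨τ, ε⟩ ⟨h1, h2⟩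
    have hε (i : Fin n) : ε i = δ (τ i) := by
      have := h1 i
      rw [key, key] at this
      exact hδ' _ _ (by simpa using this)
    have h3 : StrictMono (m ∘ τ) := by
      intro i j hij
      have := h2 hij
      simp only [key, Bool.false_xor, hε] at this
      exact this
    have h4 : StrictMono (m ∘ Tuple.sort m) :=
      (Tuple.monotone_sort m).strictMono_of_injective (hm.comp (Tuple.sort m).injective)
    have h5 : m ∘ τ = m ∘ Tuple.sort m := (h3.range_inj h4).1 (by
      rw [Set.range_comp, Set.range_comp, τ.range_eq_univ, (Tuple.sort m).range_eq_univ])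
    have h6 : τ = Tuple.sort m := Equiv.ext fun i => hm (congrFun h5 i)
    exact Prod.ext h6 (funext fun i => (hε i).trans (by rw [h6]))

open Classical in
-- By `existsUnique_isNormal`, each σ has exactly one normal translate under the pair permutations,
-- and translation preserves the term. Summing over translates first counts every normal term once
-- for each pair permutation.
theorem fullPf_eq {A : Matrix (Fin n × Bool) (Fin n × Bool) K} (hA : A.transpose = -A) :
    fullPf A = (Fintype.card (Equiv.Perm (Fin n) × (Fin n → Bool)) : K) *
      ∑ σ with IsNormal σ, pfTerm A σ := by
  have h1 (σ : Equiv.Perm (Fin n × Bool)) : pfTerm A σ =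
      ∑ x : Equiv.Perm (Fin n) × (Fin n → Bool),
        if IsNormal (σ * pairPerm x.1 x.2) then pfTerm A (σ * pairPerm x.1 x.2) else 0 := by
    obtain ⟨x, hx, hx'⟩ := existsUnique_isNormal σ
    rw [Finset.sum_eq_single x (fun y _ hy => if_neg fun h => hy (hx' y h))
      (fun h => absurd (Finset.mem_univ x) h), if_pos hx, pfTerm_mul_pairPerm hA]
  rw [fullPf, Finset.sum_congr rfl fun σ _ => h1 σ, Finset.sum_comm]
  have h2 (x : Equiv.Perm (Fin n) × (Fin n → Bool)) :
      (∑ σ : Equiv.Perm (Fin n × Bool), if IsNormal (σ * pairPerm x.1 x.2) then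
        pfTerm A (σ * pairPerm x.1 x.2) else 0) = ∑ σ with IsNormal σ, pfTerm A σ := by
    rw [Finset.sum_filter]
    exact Equiv.sum_comp (Equiv.mulRight (pairPerm x.1 x.2))
      fun σ => if IsNormal σ then pfTerm A σ else 0
  rw [Finset.sum_congr rfl fun x _ => h2 x, Finset.sum_const, Finset.card_univ, nsmul_eq_mul]

/-- The block diagonal matrix of the standard symplectic form. -/
def sympl (n : ℕ) (K : Type*) [CommRing K] : Matrix (Fin n × Bool) (Fin n × Bool) K :=
  fun p q => if p.1 = q.1 then q.2.toNat - p.2.toNat else 0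

theorem sympl_transpose : (sympl n K).transpose = -sympl n K := by
  ext p q
  simp only [Matrix.transpose_apply, Matrix.neg_apply, sympl, eq_comm (a := q.1)]
  split_ifs <;> simp

open Classical in
-- A nonzero term must match each vertex with its partner in the same pair. The identity is the only
-- normal listing of this matching, and its term is 1.
theorem fullPf_sympl :
    fullPf (sympl n K) = Fintype.card (Equiv.Perm (Fin n) × (Fin n → Bool)) := by
  rw [fullPf_eq sympl_transpose]
  have hone : IsNormal (1 : Equiv.Perm (Fin n × Bool)) := by
    refine ⟨fun i => ?_, fun i j hij => ?_⟩
    · rw [Fin.lt_def, Equiv.Perm.one_apply, Equiv.Perm.one_apply, vertexEquiv_val,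
        vertexEquiv_val]
      simp
    · change (vertexEquiv n (i, false) : ℕ) < vertexEquiv n (j, false)
      rw [vertexEquiv_val, vertexEquiv_val]
      simpa using hij
  rw [Finset.sum_eq_single 1]
  · simp [pfTerm, sympl]
  · intro σ hσ hne
    obtain ⟨h1, h2⟩ := (Finset.mem_filter.1 hσ).2
    by_contra h0
    have h3 (i : Fin n) : (σ (i, false)).1 = (σ (i, true)).1 := by
      by_contra h
      refine h0 ?_
      rw [pfTerm, Finset.prod_eq_zero (Finset.mem_univ i), mul_zero]
      exact if_neg h
    have h4 (i : Fin n) : (σ (i, false)).2 = false ∧ (σ (i, true)).2 = true := by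
      have := h1 i
      rw [Fin.lt_def, ← Prod.mk.eta (p := σ (i, false)), ← Prod.mk.eta (p := σ (i, true)),
        vertexEquiv_val, vertexEquiv_val, h3 i] at this
      cases h5 : (σ (i, false)).2 <;> cases h6 : (σ (i, true)).2 <;> simp [h5, h6] at this ⊢
    have h5 : StrictMono fun i => (σ (i, false)).1 := by
      intro i j hij
      have := h2 hij
      simp only at this
      rw [Fin.lt_def, ← Prod.mk.eta (p := σ (i, false)), ← Prod.mk.eta (p := σ (j, false)),
        vertexEquiv_val, vertexEquiv_val, (h4 i).1, (h4 j).1] at this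
      change (σ (i, false)).1.val < (σ (j, false)).1.val
      omega
    have h6 : (fun i => (σ (i, false)).1) = id :=
      (h5.range_inj strictMono_id).1 (by
        rw [Set.range_id, (Finite.injective_iff_surjective.1 h5.injective).range_eq])
    refine hne (Equiv.ext fun p => ?_)
    obtain ⟨i, b⟩ := p
    have h7 : (σ (i, false)).1 = i := congrFun h6 i
    cases b
    · exact Prod.ext h7 (h4 i).1
    · exact Prod.ext ((h3 i).symm.trans h7) (h4 i).2
  · exact fun h => absurd (Finset.mem_filter.2 ⟨Finset.mem_univ _, hone⟩) h

open Classical in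
theorem pfaffian_eq_sum_isNormal (A : Matrix (Fin (2 * n)) (Fin (2 * n)) ℤ) :
    pfaffian A =
      ∑ σ with IsNormal σ, pfTerm (A.submatrix (vertexEquiv n) (vertexEquiv n)) σ := by
  have hv (i : Fin n) : vertexEquiv n (i, false) = ⟨2 * i, by omega⟩ := rfl
  have hv' (i : Fin n) : vertexEquiv n (i, true) = ⟨2 * i + 1, by omega⟩ := rfl
  rw [pfaffian]
  symm
  refine Finset.sum_equiv (Equiv.permCongr (vertexEquiv n)) (fun σ => ?_) fun σ _ => ?_
  · rw [Finset.mem_filter, Finset.mem_filter]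
    simp only [Finset.mem_univ, true_and, IsNormal, IsMatching, StrictMono,
      ← hv, ← hv', Equiv.permCongr_apply, Equiv.symm_apply_apply]
  · simp only [pfTerm, Equiv.Perm.sign_permCongr, ← hv, ← hv', Equiv.permCongr_apply,
      Equiv.symm_apply_apply, Matrix.submatrix_apply]
    rfl

end FullSum

end TwoSorted

namespace TwoSorted

/-! ### Elimination of one pair of vertices -/

section Elimination

variable {n : ℕ} {K : Type*} [CommRing K]

open Matrix

theorem sum_sympl_mul (p : Fin n × Bool) (f : Fin n × Bool → K) :
    ∑ q, sympl n K p q * f q = if p.2 then -f (p.1, false) else f (p.1, true) := by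
  obtain ⟨i, b⟩ := p
  rw [Fintype.sum_prod_type, Finset.sum_eq_single i]
  · cases b <;> simp [sympl]
  · intro j _ hj
    simp [sympl, hj.symm]
  · simp

/-- The columns of the unit vectors `(h, false)` and `(h, true)`. -/
def pairColumns (K : Type*) [CommRing K] (h : Fin n) : Matrix (Fin n × Bool) Bool K :=
  fun p b => if p = (h, b) then 1 else 0

/-- The standard symplectic form of rank two. -/
def symplTwo (K : Type*) [CommRing K] : Matrix Bool Bool K := fun b c => c.toNat - b.toNat

/-- Congruence clears the rows and columns `(h, b)` of a skew symmetric matrix, where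
the columns are recorded by `C`. -/
theorem fullPf_clear [IsDomain K] [CharZero K] {N : Matrix (Fin n × Bool) (Fin n × Bool) K}
    (hN : Nᵀ = -N) (hu : IsUnit N.det) {h : Fin n}
    (hh : ∀ b q, N (h, b) q = sympl n K (h, b) q) {C : Matrix (Fin n × Bool) Bool K}
    (hC : ∀ b c, C (h, b) c = 0) (α : K) :
    fullPf (N + pairColumns K h * Cᵀ - C * (pairColumns K h)ᵀ +
      α • (pairColumns K h * symplTwo K * (pairColumns K h)ᵀ)) =
      (1 + α + ∑ v, C v false * (N⁻¹ *ᵥ (fun v => C v true)) v) * fullPf N := by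
  set E : Matrix (Fin n × Bool) Bool K := pairColumns K h with hE
  -- `W` solves N W = -C. It vanishes on the pair h, where `N` is symplectic and `C` is zero; hence
  -- Wᵀ E = 0, and 1 + E Wᵀ has determinant 1.
  set W : Matrix (Fin n × Bool) Bool K := -(N⁻¹ * C) with hW
  have hNW : N * W = -C := by rw [hW, Matrix.mul_neg, mul_nonsing_inv_cancel_left _ _ hu]
  have hWN : Wᵀ * N = Cᵀ := by
    have := congrArg transpose hNW
    rw [transpose_mul, hN, Matrix.mul_neg, transpose_neg] at this
    exact neg_injective this
  have hW0 (b c : Bool) : W (h, b) c = 0 := by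
    have := congrFun (congrFun hNW (h, !b)) c
    rw [Matrix.mul_apply, Finset.sum_congr rfl fun q _ => by rw [hh], sum_sympl_mul, Matrix.neg_apply, hC] at this
    cases b <;> simpa using this
  have hWE : Wᵀ * E = 0 := by
    ext b c
    rw [Matrix.mul_apply, Matrix.zero_apply]
    refine Finset.sum_eq_zero fun q _ => ?_
    by_cases hq : q = (h, c)
    · rw [hq, transpose_apply, hW0, zero_mul]
    · simp [hE, pairColumns, hq]
  have hskew : (Cᵀ * W)ᵀ = -(Cᵀ * W) := by
    rw [← hWN, transpose_mul, transpose_mul, transpose_transpose, hN, Matrix.mul_assoc, Matrix.neg_mul,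
      Matrix.mul_neg]
  -- A skew symmetric 2 × 2 matrix is a multiple of the symplectic one.
  have hG : Cᵀ * W = (Cᵀ * W) false true • symplTwo K := by
    have hs (b c : Bool) : (Cᵀ * W) c b = -(Cᵀ * W) b c := congrFun (congrFun hskew b) c
    ext b c
    have hd : (Cᵀ * W) b b = 0 := self_eq_neg.1 (hs b b)
    cases b <;> cases c <;> simp [symplTwo, hd, hs false true]
  have hBE : (1 + E * Wᵀ) * E = E := by
    rw [Matrix.add_mul, Matrix.one_mul, Matrix.mul_assoc, hWE, Matrix.mul_zero, add_zero]
  have hEB : Eᵀ * (1 + E * Wᵀ)ᵀ = Eᵀ := by rw [← transpose_mul, hBE]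
  have hdet : (1 + E * Wᵀ).det = 1 := by rw [det_one_add_mul_comm, hWE, add_zero, det_one]
  set g := (Cᵀ * W) false true with hg
  have hg' : ∑ v, C v false * (N⁻¹ *ᵥ (fun v => C v true)) v = -g := by
    rw [hg, Matrix.mul_apply, ← Finset.sum_neg_distrib]
    refine Finset.sum_congr rfl fun v _ => ?_
    rw [hW, Matrix.neg_apply, mul_neg, neg_neg]
    rfl
  -- The congruence by 1 + E Wᵀ adds E Cᵀ - C Eᵀ to `N`, and also the quadratic term Wᵀ N W = Cᵀ W
  -- on the pair h. The latter is corrected by using α - g in place of α.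
  have h1 : N + E * Cᵀ - C * Eᵀ + α • (E * symplTwo K * Eᵀ) =
      (1 + E * Wᵀ) * (N + (α - g) • (E * symplTwo K * Eᵀ)) * (1 + E * Wᵀ)ᵀ := by
    have h2 : (1 + E * Wᵀ) * (E * symplTwo K * Eᵀ) * (1 + E * Wᵀ)ᵀ = E * symplTwo K * Eᵀ := by
      rw [← Matrix.mul_assoc, ← Matrix.mul_assoc, hBE, Matrix.mul_assoc, hEB]
    have h3 : (1 + E * Wᵀ) * N * (1 + E * Wᵀ)ᵀ =
        N + E * Cᵀ - C * Eᵀ + g • (E * symplTwo K * Eᵀ) := by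
      have h4 : g • (E * symplTwo K * Eᵀ) = E * (Cᵀ * W) * Eᵀ := by
        rw [hG, Matrix.mul_smul, Matrix.smul_mul]
      rw [h4, Matrix.add_mul, Matrix.one_mul, Matrix.mul_assoc E, hWN, transpose_add, transpose_one,
        transpose_mul, transpose_transpose, Matrix.mul_add, Matrix.mul_one, Matrix.add_mul, ← Matrix.mul_assoc N, hNW]
      simp only [Matrix.mul_assoc, Matrix.neg_mul]
      abel
    rw [Matrix.mul_add, Matrix.add_mul, Matrix.mul_smul, Matrix.smul_mul, h2, h3, sub_smul]
    abel
  -- The pair h is decoupled in `N`, so multiplying its block by 1 + α - g amounts to scaling the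
  -- row and column of (h, false).
  have h5 : N + (α - g) • (E * symplTwo K * Eᵀ) =
      diagonal (fun p => if p = (h, false) then 1 + (α - g) else 1) * N *
        (diagonal (fun p => if p = (h, false) then 1 + (α - g) else 1))ᵀ := by
    have hh' (q : Fin n × Bool) (b : Bool) : N q (h, b) = -sympl n K (h, b) q := by
      rw [← hh]
      exact (congrFun (congrFun hN (h, b)) q)
    have hEE (p q : Fin n × Bool) : (E * symplTwo K * Eᵀ) p q =
        if p.1 = h ∧ q.1 = h then (q.2.toNat - p.2.toNat : K) else 0 := by
      obtain ⟨i, b⟩ := p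
      obtain ⟨j, c⟩ := q
      simp only [Matrix.mul_apply, Fintype.sum_bool, hE, pairColumns, transpose_apply, symplTwo]
      by_cases hi : i = h <;> by_cases hj : j = h <;> cases b <;> cases c <;> simp [hi, hj]
    ext p q
    rw [diagonal_transpose, mul_diagonal, diagonal_mul, Matrix.add_apply, Matrix.smul_apply, hEE, smul_eq_mul]
    by_cases hp : p = (h, false)
    · rw [if_pos hp, hp, hh]
      obtain ⟨j, c⟩ := q
      by_cases hj : h = j
      · subst hj
        cases c <;> simp [sympl]
      · simp [sympl, hj, Ne.symm hj]
    · by_cases hq : q = (h, false)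
      · rw [if_pos hq, hq, hh']
        obtain ⟨j, c⟩ := p
        by_cases hj : h = j
        · subst hj
          cases c
          · exact absurd rfl hp
          · simp [sympl]; ring
        · simp [sympl, hj, Ne.symm hj]
      · rw [if_neg hp, if_neg hq]
        obtain ⟨i, b⟩ := p
        obtain ⟨j, c⟩ := q
        by_cases hi : i = h <;> by_cases hj : j = h <;> cases b <;> cases c <;>
          simp [hi, hj] at hp hq ⊢
  rw [h1, fullPf_congruence, hdet, one_mul, h5, fullPf_congruence, det_diagonal,
    Finset.prod_ite_eq' Finset.univ (h, false), if_pos (Finset.mem_univ _), hg']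
  ring

/-- The symplectic form plus the part of `a` on the vertices of the pairs `i ≥ h`. -/
def partialForm (a : Matrix (Fin n × Bool) (Fin n × Bool) K) (h : ℕ) :
    Matrix (Fin n × Bool) (Fin n × Bool) K :=
  sympl n K + Matrix.of fun p q => if h ≤ p.1 ∧ h ≤ q.1 then a p q else 0

theorem partialForm_zero (a : Matrix (Fin n × Bool) (Fin n × Bool) K) :
    partialForm a 0 = sympl n K + a := by
  ext p q
  simp [partialForm]

theorem partialForm_self (a : Matrix (Fin n × Bool) (Fin n × Bool) K) :
    partialForm a n = sympl n K := by
  ext p q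
  simp [partialForm]

theorem partialForm_transpose {a : Matrix (Fin n × Bool) (Fin n × Bool) K} (ha : aᵀ = -a)
    (h : ℕ) : (partialForm a h)ᵀ = -partialForm a h := by
  rw [partialForm, transpose_add, sympl_transpose, neg_add]
  congr 1
  ext p q
  have : a q p = -a p q := congrFun (congrFun ha p) q
  simp only [transpose_apply, Matrix.neg_apply, of_apply, and_comm (a := h ≤ q.1.val), this]
  split_ifs <;> simp

/-- `fullPf_clear` is applied to N = `partialForm a (h + 1)`, with `C` made of the entries of `a`
between the pair h and the later pairs. Put y = N⁻¹ C_true and let Z be column (h, true) of `a` plus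
the part of a y over later pairs. On later pairs the equation N y = C_true reads J y = -Z, which
expresses y by Z and turns the definition of Z into the recursion. -/
theorem exists_fullPf_step [IsDomain K] [CharZero K]
    {a : Matrix (Fin n × Bool) (Fin n × Bool) K} (ha : aᵀ = -a)
    (hu : ∀ h, IsUnit (partialForm a h).det) (h : Fin n) :
    ∃ Z : Fin n × Bool → K,
      (∀ v, Z v = a v (h, true) +
        ∑ c, if h < c then a v (c, false) * Z (c, true) - a v (c, true) * Z (c, false) else 0) ∧
      fullPf (partialForm a h) = (1 + Z (h, false)) * fullPf (partialForm a (h + 1)) := by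
  have has (p q : Fin n × Bool) : a q p = -a p q := congrFun (congrFun ha p) q
  let C : Matrix (Fin n × Bool) Bool K := fun v b => if h < v.1 then a (h, b) v else 0
  set N := partialForm a (h + 1) with hN
  set y := N⁻¹ *ᵥ (fun v => C v true) with hy
  let Z (v : Fin n × Bool) : K := a v (h, true) + ∑ u, if h < u.1 then a v u * y u else 0
  have hNy : N *ᵥ y = fun v => C v true := by
    rw [hy, mulVec_mulVec, mul_nonsing_inv _ (hu _), one_mulVec]
  have hyZ (c : Fin n) (hc : h < c) (b : Bool) :
      (if b then -y (c, false) else y (c, true)) = -Z (c, b) := by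
    have h1 := congrFun hNy (c, b)
    simp only [mulVec, dotProduct, hN, partialForm, Matrix.add_apply, of_apply, add_mul, Finset.sum_add_distrib,
      sum_sympl_mul] at h1
    rw [show C (c, b) true = -a (c, b) (h, true) by simp only [C, if_pos hc]; exact has _ _] at h1
    simp only [Z, neg_add]
    rw [← h1]
    have h2 : ∑ u : Fin n × Bool, (if (h : ℕ) + 1 ≤ c ∧ (h : ℕ) + 1 ≤ u.1 then a (c, b) u else 0) *
        y u = ∑ u : Fin n × Bool, if h < u.1 then a (c, b) u * y u else 0 :=
      Finset.sum_congr rfl fun u _ => by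
        have h3 : (h : ℕ) + 1 ≤ c := hc
        simp only [h3, true_and, ite_mul, zero_mul]
        rfl
    rw [h2]
    ring
  have hZ (v : Fin n × Bool) : Z v = a v (h, true) +
      ∑ c, if h < c then a v (c, false) * Z (c, true) - a v (c, true) * Z (c, false) else 0 := by
    simp only [Z]
    congr 1
    rw [Fintype.sum_prod_type]
    refine Finset.sum_congr rfl fun c _ => ?_
    rw [Fintype.sum_bool]
    by_cases hc : h < c
    · have h1 := hyZ c hc true
      have h2 := hyZ c hc false
      simp only [if_true, neg_inj, Bool.false_eq_true, if_false] at h1 h2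
      simp only [if_pos hc]
      rw [h1, h2]
      ring
    · simp only [if_neg hc, add_zero]
  refine ⟨Z, hZ, ?_⟩
  have hh (b : Bool) (q : Fin n × Bool) : N (h, b) q = sympl n K (h, b) q := by
    simp [hN, partialForm]
  have hd : partialForm a h = N + pairColumns K h * Cᵀ - C * (pairColumns K h)ᵀ +
      a (h, false) (h, true) • (pairColumns K h * symplTwo K * (pairColumns K h)ᵀ) := by
    have h0 (p : Fin n × Bool) : a p p = 0 := self_eq_neg.1 (has p p)
    have hlt (i : Fin n) : i < h ∧ ¬ (h : ℕ) ≤ i ∧ ¬ (h : ℕ) + 1 ≤ i ∧ ¬ h < i ∧ i ≠ h ∨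
        i = h ∨ h < i ∧ (h : ℕ) ≤ i ∧ (h : ℕ) + 1 ≤ i ∧ i ≠ h := by
      simp only [Fin.lt_def, Fin.ext_iff, ne_eq]
      omega
    have hCv (v : Fin n × Bool) (b : Bool) : C v b = if h < v.1 then a (h, b) v else 0 := rfl
    ext ⟨i, b⟩ ⟨j, c⟩
    simp only [hN, partialForm, Matrix.add_apply, Matrix.sub_apply, Matrix.smul_apply,
      Matrix.mul_apply, Fintype.sum_bool, pairColumns, transpose_apply, symplTwo, of_apply, hCv,
      smul_eq_mul, Prod.mk.injEq]
    rcases hlt i with ⟨-, i1, i2, i3, i4⟩ | rfl | ⟨i3, i1, i2, i4⟩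
    · simp [i1, i2, i3, i4]
    · rcases hlt j with ⟨-, j1, j2, j3, j4⟩ | rfl | ⟨j3, j1, j2, j4⟩
      · simp [j1, j2, j3, j4]
      · cases b <;> cases c <;> simp [h0]
        exact has _ _
      · cases b <;> simp [j1, j3, j4]
    · rcases hlt j with ⟨-, j1, j2, j3, j4⟩ | rfl | ⟨j3, j1, j2, j4⟩
      · simp [j1, j2, j3, j4]
      · cases c <;> simp [i1, i3, i4, has _ (i, b), sub_eq_add_neg]
      · simp [i1, i2, i4, j1, j2, j4]
  rw [hd, fullPf_clear (partialForm_transpose ha _) (hu _) hh (fun b c => by simp [C])]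
  congr 1
  simp only [Z, add_assoc, C, ite_mul, zero_mul]
  rfl

theorem fullPf_partialForm_zero [IsDomain K] [CharZero K]
    {a : Matrix (Fin n × Bool) (Fin n × Bool) K} (ha : aᵀ = -a)
    (hu : ∀ h, IsUnit (partialForm a h).det) :
    ∃ Z : Fin n → Fin n × Bool → K,
      (∀ h v, Z h v = a v (h, true) + ∑ c, if h < c then
        a v (c, false) * Z h (c, true) - a v (c, true) * Z h (c, false) else 0) ∧
      fullPf (sympl n K + a) = (∏ h, (1 + Z h (h, false))) * fullPf (sympl n K) := by
  choose Z hZ hZ' using exists_fullPf_step ha hu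
  refine ⟨Z, hZ, ?_⟩
  have key (k : ℕ) (hk : k ≤ n) : fullPf (partialForm a 0) =
      (∏ h ∈ Finset.range k, if hh : h < n then 1 + Z ⟨h, hh⟩ (⟨h, hh⟩, false) else 1) *
        fullPf (partialForm a k) := by
    induction k with
    | zero => simp
    | succ k ih =>
      rw [ih (by omega), Finset.prod_range_succ, dif_pos (show k < n by omega), mul_assoc]
      congr 1
      exact hZ' ⟨k, by omega⟩
  rw [← partialForm_zero, key n le_rfl, partialForm_self, Finset.prod_range]
  simp

end Elimination

/-! ### Passage to power series -/

section Series

open PowerSeries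

/-- Each term is a product of n factors of degree at most one, so its coefficient of degree n is the
product of the linear coefficients, and `N` drops out. -/
theorem coeff_fullPf {n : ℕ} (N A : Matrix (Fin n × Bool) (Fin n × Bool) ℤ) :
    coeff n (fullPf (N.map (C : ℤ →+* ℤ⟦X⟧) + (X : ℤ⟦X⟧) • A.map (C : ℤ →+* ℤ⟦X⟧))) = fullPf A := by
  rw [fullPf, map_sum, fullPf]
  refine Finset.sum_congr rfl fun σ _ => ?_
  have h1 : pfTerm (N.map (C : ℤ →+* ℤ⟦X⟧) + (X : ℤ⟦X⟧) • A.map (C : ℤ →+* ℤ⟦X⟧)) σ =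
      C (Equiv.Perm.sign σ : ℤ) * ((∏ i, (Polynomial.C (N (σ (i, false)) (σ (i, true))) +
        Polynomial.X * Polynomial.C (A (σ (i, false)) (σ (i, true)))) : Polynomial ℤ) : ℤ⟦X⟧) := by
    rw [pfTerm, ← Polynomial.coeToPowerSeries.ringHom_apply, map_prod]
    simp only [Polynomial.coeToPowerSeries.ringHom_apply, Polynomial.coe_add, Polynomial.coe_mul,
      Polynomial.coe_C, Polynomial.coe_X]
    exact congrArg₂ _ (map_intCast (C : ℤ →+* ℤ⟦X⟧) _).symm rfl
  rw [h1, coeff_C_mul, Polynomial.coeff_coe, pfTerm]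
  congr 1
  have h2 := Polynomial.coeff_prod_of_natDegree_le (s := Finset.univ)
    (fun i : Fin n => Polynomial.C (N (σ (i, false)) (σ (i, true))) +
        Polynomial.X * Polynomial.C (A (σ (i, false)) (σ (i, true)))) 1 (fun i _ => by
      compute_degree)
  rw [Finset.card_univ, Fintype.card_fin, mul_one] at h2
  rw [h2]
  exact Finset.prod_congr rfl fun i _ => by
    rw [Polynomial.coeff_add, Polynomial.coeff_C_succ, zero_add, Polynomial.coeff_X_mul,
      Polynomial.coeff_C_zero]

/-- Modulo `X` only the symplectic form remains, and its inverse is its negative. Hence the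
determinant has an invertible constant term. -/
theorem isUnit_det_partialForm {n : ℕ} (A : Matrix (Fin n × Bool) (Fin n × Bool) ℤ) (h : ℕ) :
    IsUnit (partialForm ((X : ℤ⟦X⟧) • A.map (C : ℤ →+* ℤ⟦X⟧)) h).det := by
  rw [isUnit_iff_constantCoeff, RingHom.map_det]
  have h1 : (constantCoeff : ℤ⟦X⟧ →+* ℤ).mapMatrix (partialForm ((X : ℤ⟦X⟧) • A.map (C : ℤ →+* ℤ⟦X⟧)) h) =
      sympl n ℤ := by
    ext p q
    simp only [RingHom.mapMatrix_apply, Matrix.map_apply, partialForm, Matrix.add_apply,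
      Matrix.of_apply, sympl, map_add]
    split_ifs <;> simp
  rw [h1]
  refine Matrix.isUnit_det_of_right_inverse (B := -sympl n ℤ) ?_
  ext p q
  rw [Matrix.mul_apply, sum_sympl_mul]
  obtain ⟨i, b⟩ := p
  obtain ⟨j, c⟩ := q
  by_cases hi : i = j <;> cases b <;> cases c <;> simp [sympl, hi, Matrix.one_apply]

/-- The Pfaffian of a skew symmetric matrix is a coefficient of a product of series that solve
linear recursions. -/
theorem exists_series {n : ℕ} {a : ℕ → ℕ → ℤ}
    (ha : ∀ i < 2 * n, ∀ j < 2 * n, a j i = -a i j) :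
    ∃ z : ℕ → ℕ → ℤ⟦X⟧,
      (∀ h < n, ∀ v < 2 * n, z h v = X * (C (a v (2 * h + 1)) + ∑ c ∈ Finset.range n, if h < c then
        C (a v (2 * c)) * z h (2 * c + 1) - C (a v (2 * c + 1)) * z h (2 * c) else 0)) ∧
      coeff n (∏ h ∈ Finset.range n, (1 + z h (2 * h))) =
        pfaffian (n := n) (Matrix.of fun i j => a i j) := by
  classical
  let A : Matrix (Fin n × Bool) (Fin n × Bool) ℤ := fun p q => a (vertexEquiv n p) (vertexEquiv n q)
  have hA : A.transpose = -A := by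
    ext p q
    exact ha _ (vertexEquiv n p).isLt _ (vertexEquiv n q).isLt
  have hXA : ((X : ℤ⟦X⟧) • A.map (C : ℤ →+* ℤ⟦X⟧)).transpose = -((X : ℤ⟦X⟧) • A.map (C : ℤ →+* ℤ⟦X⟧)) := by
    ext1 p q
    have : A q p = -A p q := congrFun (congrFun hA p) q
    simp [this]
  have : CharZero ℤ⟦X⟧ := charZero_of_injective_ringHom (C_injective (R := ℤ))
  obtain ⟨Z, hZ, hp⟩ := fullPf_partialForm_zero hXA (isUnit_det_partialForm A)
  let z (h v : ℕ) : ℤ⟦X⟧ := if hh : h < n ∧ v < 2 * n then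
    Z ⟨h, hh.1⟩ ((vertexEquiv n).symm ⟨v, hh.2⟩) else 0
  have hz (h : Fin n) (p : Fin n × Bool) : z h (vertexEquiv n p) = Z h p := by
    simp [z]
  have hz0 (h c : Fin n) : z h (2 * c) = Z h (c, false) := hz h (c, false)
  have hz1 (h c : Fin n) : z h (2 * c + 1) = Z h (c, true) := hz h (c, true)
  refine ⟨z, fun h hh v hv => ?_, ?_⟩
  · obtain ⟨p, hp⟩ := (vertexEquiv n).surjective ⟨v, hv⟩
    have hv' : v = vertexEquiv n p := by rw [hp]
    rw [hv', hz ⟨h, hh⟩ p, hZ, mul_add, Finset.mul_sum, Finset.sum_range]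
    refine congrArg₂ _ rfl (Finset.sum_congr rfl fun c _ => ?_)
    rw [hz0 ⟨h, hh⟩ c, hz1 ⟨h, hh⟩ c, mul_ite, mul_zero, mul_sub, ← mul_assoc, ← mul_assoc]
    rfl
  -- The factor 2^n n! appears on both sides: in `fullPf A` because `A` is skew symmetric, and from
  -- the symplectic form left by the elimination.
  · have h1 : fullPf A = (Fintype.card (Equiv.Perm (Fin n) × (Fin n → Bool)) : ℤ) *
        coeff n (∏ h ∈ Finset.range n, (1 + z h (2 * h))) := by
      have hs : sympl n ℤ⟦X⟧ = (sympl n ℤ).map (C : ℤ →+* ℤ⟦X⟧) := by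
        ext1 p q
        simp only [sympl, Matrix.map_apply]
        split_ifs <;> simp
      rw [← coeff_fullPf (sympl n ℤ) A, ← hs, hp, fullPf_sympl, mul_comm,
        ← map_natCast (C : ℤ →+* ℤ⟦X⟧), coeff_C_mul, Finset.prod_range]
      simp only [hz0]
    rw [fullPf_eq hA] at h1
    have h2 : (Fintype.card (Equiv.Perm (Fin n) × (Fin n → Bool)) : ℤ) ≠ 0 := by
      exact_mod_cast Fintype.card_ne_zero
    rw [← mul_left_cancel₀ h2 h1, pfaffian_eq_sum_isNormal]
    rfl

end Series

end TwoSorted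

namespace TwoSorted

/-! ### The Pfaffian counts walks of the transfer matrix -/

section Walks

open PowerSeries Finset

theorem intPow_succ' {D : ℕ} {e : ℕ → ℕ → ℤ} (k : ℕ) {a c : ℕ} (ha : a < D) (hc : c < D) :
    intPow D e (k + 1) a c = ∑ l ∈ range D, e a l * intPow D e k l c := by
  induction k generalizing c with
  | zero => simp [intPow, ha, hc]
  | succ k ih =>
    rw [intPow, sum_congr rfl fun l hl => by rw [ih (mem_range.1 hl)]]
    simp only [sum_mul, intPow, mul_sum, mul_assoc]
    exact sum_comm

/-- The coefficients of the solution of a linear system are entries of powers of its matrix. -/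
theorem coeff_eq_intPow {D f : ℕ} {e : ℕ → ℕ → ℤ} {Ψ : ℕ → ℤ⟦X⟧} (hf : f < D)
    (h : ∀ p < D, Ψ p = (if p = f then 1 else 0) + X * ∑ q ∈ range D, C (e p q) * Ψ q)
    (k : ℕ) {p : ℕ} (hp : p < D) : coeff k (Ψ p) = intPow D e k p f := by
  induction k generalizing p with
  | zero =>
    rw [h p hp, map_add, coeff_zero_X_mul, add_zero, intPow]
    split_ifs <;> simp
  | succ k ih =>
    rw [h p hp, map_add, coeff_succ_X_mul, map_sum, intPow_succ' k hp hf,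
      sum_congr rfl fun q hq => by rw [coeff_C_mul, ih (mem_range.1 hq)]]
    split_ifs <;> simp [coeff_one]

theorem sum_range_mul_eq {N : Type*} [AddCommMonoid N] (m V : ℕ) (f : ℕ → N) :
    ∑ q ∈ range (m * V), f q = ∑ i ∈ range m, ∑ j ∈ range V, f (i * V + j) := by
  induction m with
  | zero => simp
  | succ m ih => rw [Nat.succ_mul, sum_range_add, ih, sum_range_succ]

theorem state_div {V v : ℕ} (h : ℕ) (hv : v < V) : (h * V + v) / V = h := by
  rw [mul_comm, Nat.mul_add_div (by omega), Nat.div_eq_of_lt hv, add_zero]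

theorem state_mod {V v : ℕ} (h : ℕ) (hv : v < V) : (h * V + v) % V = v := by
  rw [mul_comm, Nat.mul_add_mod, Nat.mod_eq_of_lt hv]

/-- The entry of the transfer matrix at the states `(h, v)` and `(h', v')`. -/
def walkWeight (n : ℕ) (a : ℕ → ℕ → ℤ) (h v h' v' : ℕ) : ℤ :=
  if h = n ∧ v = 2 * n + 1 then if v' = 2 * h' then 1 else 0
  else if h < n ∧ v < 2 * n then
    if h < h' then if v' = 2 * h' then a v (2 * h + 1) else 0
    else if h' = h ∧ h < v' / 2 ∧ v' < 2 * n then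
      if v' % 2 = 0 then a (v' + 1) v else a v (v' - 1)
    else 0
  else 0

/-- The products of the factors of the Pfaffian. -/
noncomputable def tailProd (n : ℕ) (z : ℕ → ℕ → ℤ⟦X⟧) (m : ℕ) : ℤ⟦X⟧ := ∏ j ∈ Ico m n, (1 + z j (2 * j))

/-- The generating function of the walks from `(h, v)` to the final state. -/
noncomputable def walkSeries (n : ℕ) (z : ℕ → ℕ → ℤ⟦X⟧) (h v : ℕ) : ℤ⟦X⟧ :=
  if h < n ∧ v < 2 * n then z h v * tailProd n z (h + 1)
  else if h = n ∧ v = 2 * n + 1 then X * tailProd n z 0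
  else if h = n ∧ v = 2 * n then 1 else 0

/-- The first head h ≥ m of a sequence of walks is chosen, where h = n means the empty sequence.
Choosing h = m corresponds to the summand z_m(2m) in the factor 1 + z_m(2m). -/
theorem sum_walkSeries {n m : ℕ} (z : ℕ → ℕ → ℤ⟦X⟧) (hm : m ≤ n) :
    ∑ h ∈ range (n + 1), (if m ≤ h then walkSeries n z h (2 * h) else 0) = tailProd n z m := by
  have h1 : walkSeries n z n (2 * n) = 1 := by simp [walkSeries]
  rw [← sum_filter, show (range (n + 1)).filter (m ≤ ·) = Ico m (n + 1) by
    ext; simp only [mem_filter, mem_range, mem_Ico]; omega, sum_Ico_succ_top hm, h1]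
  induction hm using Nat.decreasingInduction with
  | self => simp [tailProd]
  | of_succ m hm ih =>
    have h2 : tailProd n z m = (1 + z m (2 * m)) * tailProd n z (m + 1) :=
      prod_eq_prod_Ico_succ_bot hm _
    rw [sum_eq_sum_Ico_succ_bot hm, add_assoc, ih, h2, walkSeries, if_pos ⟨hm, by omega⟩]
    ring

variable {n : ℕ} {a : ℕ → ℕ → ℤ}

/-- Steps that close the walk contribute all continuations with later heads, that is, `tailProd n z
(h + 1)` by `sum_walkSeries`. Steps that keep the head have the same tail as a factor and give the
sum in the recursion of z_h. -/
theorem sum_walkWeight (ha : ∀ i < 2 * n, ∀ j < 2 * n, a j i = -a i j) {z : ℕ → ℕ → ℤ⟦X⟧}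
    {h v : ℕ} (hh : h < n) (hv : v < 2 * n) :
    ∑ h' ∈ range (n + 1), ∑ v' ∈ range (2 * n + 2),
        C (walkWeight n a h v h' v') * walkSeries n z h' v' =
      (C (a v (2 * h + 1)) + ∑ c ∈ range n, if h < c then
        C (a v (2 * c)) * z h (2 * c + 1) - C (a v (2 * c + 1)) * z h (2 * c) else 0) *
        tailProd n z (h + 1) := by
  have h0 : ¬ (h = n ∧ v = 2 * n + 1) := by omega
  have hw (h' v' : ℕ) : walkWeight n a h v h' v' =
      (if h + 1 ≤ h' then if v' = 2 * h' then a v (2 * h + 1) else 0 else 0) +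
      if h' = h then if h < v' / 2 ∧ v' < 2 * n then
        if v' % 2 = 0 then a (v' + 1) v else a v (v' - 1) else 0 else 0 := by
    rw [walkWeight, if_neg h0, if_pos ⟨hh, hv⟩]
    rcases lt_trichotomy h h' with h1 | rfl | h1
    · rw [if_pos h1, if_pos (show h + 1 ≤ h' from h1), if_neg (show h' ≠ h by omega), add_zero]
    · simp
    · rw [if_neg (show ¬ h < h' by omega), if_neg (show ¬ h + 1 ≤ h' by omega),
        if_neg (show ¬ (h' = h ∧ _) by omega), if_neg (show h' ≠ h by omega), add_zero]
  have hw' (h' v' : ℕ) : C (walkWeight n a h v h' v') * walkSeries n z h' v' =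
      (if h + 1 ≤ h' then if v' = 2 * h' then
        C (a v (2 * h + 1)) * walkSeries n z h' v' else 0 else 0) +
      if h' = h then if h < v' / 2 ∧ v' < 2 * n then
        C (if v' % 2 = 0 then a (v' + 1) v else a v (v' - 1)) * walkSeries n z h' v'
        else 0 else 0 := by
    rw [hw, map_add, add_mul]
    congr 1
    · split_ifs <;> simp
    · by_cases h1 : h' = h
      · rw [if_pos h1, if_pos h1]
        by_cases h2 : h < v' / 2 ∧ v' < 2 * n
        · rw [if_pos h2, if_pos h2]
        · rw [if_neg h2, if_neg h2, map_zero, zero_mul]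
      · rw [if_neg h1, if_neg h1, map_zero, zero_mul]
  simp only [hw', sum_add_distrib, add_mul]
  congr 1
  · rw [← sum_walkSeries z (show h + 1 ≤ n from hh), mul_sum]
    refine sum_congr rfl fun h' hh' => ?_
    by_cases h1 : h + 1 ≤ h'
    · rw [mem_range] at hh'
      simp only [if_pos h1]
      rw [sum_ite_eq', if_pos (mem_range.2 (by omega))]
    · simp only [if_neg h1, sum_const_zero, mul_zero]
  · rw [sum_eq_single h (fun h' _ h1 => by simp [h1]) (fun h1 => absurd (mem_range.2 (by omega)) h1)]
    simp only [if_true]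
    -- The vertices are grouped in pairs; no walk enters the additional pair 2n, 2n + 1 while
    -- keeping its head.
    rw [show 2 * n + 2 = (n + 1) * 2 by ring, sum_range_mul_eq, sum_range_succ, sum_mul]
    have h1 : ∑ j ∈ range 2, (if h < (n * 2 + j) / 2 ∧ n * 2 + j < 2 * n then
        C (if (n * 2 + j) % 2 = 0 then a (n * 2 + j + 1) v else a v (n * 2 + j - 1)) *
          walkSeries n z h (n * 2 + j) else 0) = 0 :=
      sum_eq_zero fun j _ => if_neg (by omega)
    rw [h1, add_zero]
    refine sum_congr rfl fun c hc => ?_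
    rw [mem_range] at hc
    rw [sum_range_succ, sum_range_one, add_zero]
    by_cases h2 : h < c
    -- Skew symmetry turns the weight a(2c+1, v) back into -a(v, 2c+1).
    · rw [if_pos (by omega), if_pos (by omega), if_pos h2, if_pos (by omega), if_neg (by omega),
        walkSeries, if_pos (by omega), walkSeries, if_pos (by omega), mul_comm c 2,
        ha v hv (2 * c + 1) (by omega), Nat.add_sub_cancel, map_neg]
      ring
    · rw [if_neg (by omega), if_neg (by omega), if_neg h2]
      ring

/-- Inside a walk this is the recursion of z_h, and at the start state it is `sum_walkSeries` for m
= 0. All other states have no outgoing transitions; the final one contributes the constant 1. -/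
theorem walkSeries_eq (ha : ∀ i < 2 * n, ∀ j < 2 * n, a j i = -a i j) {z : ℕ → ℕ → ℤ⟦X⟧}
    (hz : ∀ h < n, ∀ v < 2 * n, z h v = X * (C (a v (2 * h + 1)) + ∑ c ∈ range n, if h < c then
      C (a v (2 * c)) * z h (2 * c + 1) - C (a v (2 * c + 1)) * z h (2 * c) else 0)) (h v : ℕ) :
    walkSeries n z h v = (if h = n ∧ v = 2 * n then 1 else 0) +
      X * ∑ h' ∈ range (n + 1), ∑ v' ∈ range (2 * n + 2),
        C (walkWeight n a h v h' v') * walkSeries n z h' v' := by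
  by_cases h1 : h < n ∧ v < 2 * n
  · rw [sum_walkWeight ha h1.1 h1.2, walkSeries, if_pos h1, if_neg (by omega), zero_add, ← mul_assoc,
      ← hz h h1.1 v h1.2]
  · by_cases h2 : h = n ∧ v = 2 * n + 1
    · rw [walkSeries, if_neg h1, if_pos h2, if_neg (by omega), zero_add,
        ← sum_walkSeries z (Nat.zero_le n)]
      congr 1
      refine sum_congr rfl fun h' hh' => ?_
      rw [mem_range] at hh'
      rw [if_pos (Nat.zero_le _), sum_eq_single (2 * h')]
      · simp [walkWeight, h2]
      · intro v' _ hv'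
        simp [walkWeight, h2, hv']
      · exact fun h3 => absurd (mem_range.2 (by omega)) h3
    · rw [walkSeries, if_neg h1, if_neg h2, left_eq_add]
      simp [walkWeight, h1, h2]

/-- The walk series solve the linear system of the transfer matrix, so their coefficients are
entries of its powers. The start state contributes one additional factor `X`, which is why the
exponent is n + 1. -/
theorem pfaffian_eq_intPow (ha : ∀ i < 2 * n, ∀ j < 2 * n, a j i = -a i j) {e : ℕ → ℕ → ℤ}
    (he : ∀ h ≤ n, ∀ v < 2 * n + 2, ∀ h' ≤ n, ∀ v' < 2 * n + 2,
      e (h * (2 * n + 2) + v) (h' * (2 * n + 2) + v') = walkWeight n a h v h' v') :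
    intPow ((n + 1) * (2 * n + 2)) e (n + 1) (n * (2 * n + 2) + (2 * n + 1))
      (n * (2 * n + 2) + 2 * n) = pfaffian (n := n) (Matrix.of fun i j => a i j) := by
  obtain ⟨z, hz, hp⟩ := exists_series ha
  have hlt (v : ℕ) (hv : v < 2 * n + 2) : n * (2 * n + 2) + v < (n + 1) * (2 * n + 2) := by
    rw [add_mul, one_mul]; omega
  have key := coeff_eq_intPow (e := e)
    (Ψ := fun p => walkSeries n z (p / (2 * n + 2)) (p % (2 * n + 2)))
    (hlt (2 * n) (by omega)) (fun p hp => ?_) (n + 1) (hlt (2 * n + 1) (by omega))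
  · simp only [state_div _ (show 2 * n + 1 < 2 * n + 2 by omega),
      state_mod _ (show 2 * n + 1 < 2 * n + 2 by omega)] at key
    rw [← key, walkSeries, if_neg (by omega), if_pos ⟨rfl, rfl⟩, coeff_succ_X_mul, tailProd,
      ← range_eq_Ico, hp]
  · have hh : p / (2 * n + 2) ≤ n := Nat.lt_succ_iff.1 (Nat.div_lt_of_lt_mul (by rwa [mul_comm]))
    have hv : p % (2 * n + 2) < 2 * n + 2 := Nat.mod_lt _ (by omega)
    have hpe : p = p / (2 * n + 2) * (2 * n + 2) + p % (2 * n + 2) := (Nat.div_add_mod' _ _).symm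
    rw [walkSeries_eq ha hz, sum_range_mul_eq]
    congr 1
    · refine if_congr ⟨fun h1 => ?_, fun h1 => ?_⟩ rfl rfl
      · rw [hpe, h1.1, h1.2]
      · rw [h1]
        exact ⟨state_div _ (by omega), state_mod _ (by omega)⟩
    · refine congrArg _ (sum_congr rfl fun h' hh' => sum_congr rfl fun v' hv' => ?_)
      rw [mem_range] at hh' hv'
      rw [state_div _ hv', state_mod _ hv', ← he _ hh _ hv _ (by omega) _ hv', ← hpe]

end Walks

end TwoSorted

namespace TwoSorted

/-! ### The formula in the standard model -/

theorem entry_eq_decodeInt {X F : Finset ℕ} {i j : ℕ}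
    (h : ∀ x, srow (srow (· ∈ X) i) j x ↔ x ∈ F) : entry X i j = decodeInt F := by
  rw [entry]
  congr 1
  ext x
  rw [mem_entry_iff, h]

theorem entry_congr {X Y : Finset ℕ} {i j i' j' : ℕ}
    (h : ∀ x, srow (srow (· ∈ X) i) j x ↔ srow (srow (· ∈ Y) i') j' x) :
    entry X i j = entry Y i' j' :=
  entry_eq_decodeInt fun x => by rw [mem_entry_iff, h]

theorem entry_eq_zero {X : Finset ℕ} {i j : ℕ} (h : ∀ x, ¬ srow (srow (· ∈ X) i) j x) :
    entry X i j = 0 :=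
  (entry_eq_decodeInt (F := ∅) fun x => by simpa using h x).trans (by simp [decodeInt])

theorem entry_eq_one {X : Finset ℕ} {i j : ℕ} (h : ∀ x, srow (srow (· ∈ X) i) j x ↔ x = 1) :
    entry X i j = 1 :=
  (entry_eq_decodeInt (F := {1}) fun x => by simpa using h x).trans (by simp [decodeInt])

/-- The transitions, for decoded states. -/
theorem sTransition_iff {n h v h' v' z : ℕ} {X : ℕ → Prop} (hh : h ≤ n) (hv : v < 2 * n + 2)
    (hh' : h' ≤ n) (hv' : v' < 2 * n + 2) :
    sTransition n X (h * (2 * n + 2) + v) (h' * (2 * n + 2) + v') z ↔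
      (((h = n ∧ v = 2 * n + 1) ∧ v' = 2 * h' ∧ z = 1) ∨
        ((h < n ∧ v < 2 * n) ∧
          (((h < h' ∧ v' = 2 * h') ∧ srow (srow X v) (2 * h + 1) z) ∨
            (h' = h ∧ ∃ c < n, h < c ∧
              ((v' = 2 * c ∧ srow (srow X (2 * c + 1)) v z) ∨
                (v' = 2 * c + 1 ∧ srow (srow X v) (2 * c) z)))))) := by
  have inj {h v k u : ℕ} (hv : v < 2 * n + 2) (hu : u < 2 * n + 2)
      (he : h * (2 * n + 2) + v = k * (2 * n + 2) + u) : h = k ∧ v = u := by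
    exact ⟨by rw [← state_div h hv, he, state_div k hu], by rw [← state_mod h hv, he, state_mod k hu]⟩
  have hlt {x y : ℕ} : slt x y ↔ x < y := lt_iff_le_and_ne.symm
  simp only [sTransition, hlt, Nat.reduceAdd]
  constructor
  · rintro ⟨k, -, u, -, hu, k', -, u', -, hu', ⟨h1, h2⟩, h3⟩
    obtain ⟨rfl, rfl⟩ := inj hv hu h1
    obtain ⟨rfl, rfl⟩ := inj hv' hu' h2
    refine h3.imp_right (And.imp_right (Or.imp_right (And.imp_right ?_)))
    exact fun ⟨c, _, h⟩ => ⟨c, h⟩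
  · intro h3
    refine ⟨h, hh, v, hv.le, hv, h', hh', v', hv'.le, hv', ⟨rfl, rfl⟩, ?_⟩
    refine h3.imp_right (And.imp_right (Or.imp_right (And.imp_right ?_)))
    exact fun ⟨c, hc, h⟩ => ⟨c, hc.le, hc, h⟩

/-- The bounds cut nothing off: states are numbered below the dimension, and every digit position is
either 1 or one that occurs in a row of `X`. -/
theorem mem_transfer_iff {n : ℕ} {X P : Finset ℕ}
    (hP : ∀ w, w ∈ P ↔ w < sTransferBound n (X.sup Nat.succ) ∧
      sTransfer n (X.sup Nat.succ) (· ∈ X) w) (p q z : ℕ) :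
    srow (srow (· ∈ P) p) q z ↔ sTransition n (· ∈ X) p q z := by
  change spair p (spair q z) ∈ P ↔ _
  rw [hP]
  constructor
  · rintro ⟨-, p', -, q', -, z', -, h1, h2⟩
    obtain ⟨rfl, h3⟩ := spair_injective h1
    obtain ⟨rfl, rfl⟩ := spair_injective h3
    exact h2
  · intro h
    have hD {h v : ℕ} (hh : h ≤ n) (hv : v < (1 + 1) * n + (1 + 1)) :
        h * ((1 + 1) * n + (1 + 1)) + v ≤ sDim n := by
      rw [sDim, add_mul n 1, one_mul]
      exact add_le_add (Nat.mul_le_mul_right _ hh) hv.le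
    have hpq : p ≤ sDim n ∧ q ≤ sDim n := by
      obtain ⟨k, hk, u, -, hu, k', hk', u', -, hu', ⟨rfl, rfl⟩, -⟩ := h
      exact ⟨hD hk (lt_iff_le_and_ne.2 hu), hD hk' (lt_iff_le_and_ne.2 hu')⟩
    have hz : z ≤ X.sup Nat.succ + 1 := by
      have hr {i j : ℕ} (h : srow (srow (· ∈ X) i) j z) : z ≤ X.sup Nat.succ + 1 :=
        (((nat_le_spair_right j z).trans (nat_le_spair_right i _)).trans_lt
          (lt_len (show spair i (spair j z) ∈ X from h))).le.trans (Nat.le_succ _)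
      obtain ⟨k, -, u, -, -, k', -, u', -, -, -, h⟩ := h
      rcases h with ⟨-, -, rfl⟩ | ⟨-, ⟨-, h⟩ | ⟨-, c, -, -, -, ⟨-, h⟩ | ⟨-, h⟩⟩⟩
      · exact Nat.le_add_left _ _
      all_goals exact hr h
    exact ⟨Nat.lt_succ_of_le (nat_spair_mono hpq.1 (nat_spair_mono hpq.2 hz)),
      p, hpq.1, q, hpq.2, z, hz, rfl, h⟩

/-- Each nonconstant weight is copied digit by digit from an entry of `X`, so equality of digit sets
suffices in every case. -/
theorem entry_transfer {n : ℕ} {X P : Finset ℕ}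
    (hP : ∀ w, w ∈ P ↔ w < sTransferBound n (X.sup Nat.succ) ∧
      sTransfer n (X.sup Nat.succ) (· ∈ X) w) {h v h' v' : ℕ} (hh : h ≤ n) (hv : v < 2 * n + 2)
    (hh' : h' ≤ n) (hv' : v' < 2 * n + 2) :
    entry P (h * (2 * n + 2) + v) (h' * (2 * n + 2) + v') = walkWeight n (entry X) h v h' v' := by
  have key (z : ℕ) := (mem_transfer_iff hP _ _ z).trans (sTransition_iff hh hv hh' hv')
  rw [walkWeight]
  by_cases h1 : h = n ∧ v = 2 * n + 1
  · rw [if_pos h1]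
    by_cases h3 : v' = 2 * h'
    · rw [if_pos h3]
      exact entry_eq_one fun z => by rw [key]; simp only [h1, h3]; simp
    · rw [if_neg h3]
      exact entry_eq_zero fun z => by rw [key]; simp only [h1, h3]; simp
  rw [if_neg h1]
  by_cases h2 : h < n ∧ v < 2 * n
  swap
  · rw [if_neg h2]
    exact entry_eq_zero fun z => by rw [key]; simp only [h1, h2]; simp
  rw [if_pos h2]
  by_cases h3 : h < h'
  · rw [if_pos h3]
    have h4 : h' ≠ h := h3.ne'
    by_cases h5 : v' = 2 * h'
    · rw [if_pos h5]
      exact entry_congr fun z => by rw [key]; simp only [h1, h2, h3, h4, h5]; simp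
    · rw [if_neg h5]
      exact entry_eq_zero fun z => by rw [key]; simp only [h1, h4, h5]; simp
  rw [if_neg h3]
  by_cases h4 : h' = h ∧ h < v' / 2 ∧ v' < 2 * n
  · rw [if_pos h4]
    by_cases h5 : v' % 2 = 0
    · rw [if_pos h5]
      refine entry_congr fun z => ?_
      rw [key]
      constructor
      · rintro (⟨h6, -⟩ | ⟨-, ⟨⟨h6, -⟩, -⟩ | ⟨-, c, -, -, ⟨rfl, h6⟩ | ⟨rfl, -⟩⟩⟩)
        · exact absurd h6 h1
        · exact absurd h6 h3
        · exact h6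
        · omega
      · intro h6
        refine .inr ⟨h2, .inr ⟨h4.1, v' / 2, by omega, h4.2.1, .inl ⟨by omega, ?_⟩⟩⟩
        rwa [show 2 * (v' / 2) = v' by omega]
    · rw [if_neg h5]
      refine entry_congr fun z => ?_
      rw [key]
      constructor
      · rintro (⟨h6, -⟩ | ⟨-, ⟨⟨h6, -⟩, -⟩ | ⟨-, c, -, -, ⟨rfl, -⟩ | ⟨rfl, h6⟩⟩⟩)
        · exact absurd h6 h1
        · exact absurd h6 h3
        · omega
        · exact h6
      · intro h6
        refine .inr ⟨h2, .inr ⟨h4.1, v' / 2, by omega, h4.2.1, .inr ⟨by omega, ?_⟩⟩⟩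
        rwa [show 2 * (v' / 2) = v' - 1 by omega]
  · rw [if_neg h4]
    refine entry_eq_zero fun z => ?_
    rw [key]
    rintro (⟨h6, -⟩ | ⟨-, ⟨⟨h6, -⟩, -⟩ | ⟨h6, c, hc, hc', ⟨h7, -⟩ | ⟨h7, -⟩⟩⟩)
    · exact h1 h6
    · exact h3 h6
    · exact h4 ⟨h6, by omega, by omega⟩
    · exact h4 ⟨h6, by omega, by omega⟩

/-- All digits of entries lie below `|X|`, so the bounded tests are complete. Zero entries are
exempt from the sign test, since their sign bits are arbitrary. -/
theorem sIsSkew_iff (d : ℕ) (X : Finset ℕ) : sIsSkew d (X.sup Nat.succ) (· ∈ X) ↔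
    ∀ i < d, ∀ j < d, entry X j i = -entry X i j := by
  have hlt {x y : ℕ} : slt x y ↔ x < y := lt_iff_le_and_ne.symm
  have h1 (i j : ℕ) : (sSameBits (X.sup Nat.succ) (sInt (srow (srow (· ∈ X) i) j)).abs
      (sInt (srow (srow (· ∈ X) j) i)).abs ∧
      (sIsZero (X.sup Nat.succ) (sInt (srow (srow (· ∈ X) i) j)).abs ∨
        ¬ ((sInt (srow (srow (· ∈ X) i) j)).neg ↔ (sInt (srow (srow (· ∈ X) j) i)).neg))) ↔
      entry X j i = -entry X i j := by
    have hs : sSameBits (X.sup Nat.succ) (sInt (srow (srow (· ∈ X) i) j)).abs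
        (sInt (srow (srow (· ∈ X) j) i)).abs ↔ (entry X i j).natAbs = (entry X j i).natAbs := by
      simp only [sSameBits, ← entry_testBit]
      refine ⟨fun h => Nat.eq_of_testBit_eq fun x => ?_, fun h x _ => by rw [h]⟩
      by_cases hx : x ≤ X.sup Nat.succ
      · exact Bool.eq_iff_iff.2 (h x hx)
      · have h2 (i j : ℕ) : (entry X i j).natAbs.testBit x = false :=
          Nat.testBit_lt_two_pow ((entry_lt X i j).trans_le
            (Nat.pow_le_pow_right two_pos (not_le.1 hx).le))
        rw [h2, h2]
    have hz : sIsZero (X.sup Nat.succ) (sInt (srow (srow (· ∈ X) i) j)).abs ↔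
        (entry X i j).natAbs = 0 := by
      simp only [sIsZero, ← entry_testBit]
      refine ⟨fun h => Nat.eq_of_testBit_eq fun x => ?_, fun h x _ => by simp [h]⟩
      rw [Nat.zero_testBit]
      by_cases hx : x ≤ X.sup Nat.succ
      · simpa using h x hx
      · exact Nat.testBit_lt_two_pow ((entry_lt X i j).trans_le
            (Nat.pow_le_pow_right two_pos (not_le.1 hx).le))
    rw [hs, hz]
    have e1 := entry_eq_signed X i j
    have e2 := entry_eq_signed X j i
    generalize (sInt (srow (srow (· ∈ X) i) j)).neg = s at e1 ⊢
    generalize (sInt (srow (srow (· ∈ X) j) i)).neg = t at e2 ⊢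
    unfold signed at e1 e2
    by_cases hs : s <;> by_cases ht : t <;>
      simp only [hs, ht, if_true, if_false, iff_true, iff_false, not_true_eq_false,
        not_false_eq_true, or_false, or_true, and_true] at e1 e2 ⊢ <;> omega
  simp only [sIsSkew, hlt, h1]
  exact ⟨fun h i hi j hj => h i hi.le hi j hj.le hj, fun h i _ hi j _ hj => h i hi j hj⟩

/-- The recorded powers are the true ones, and `pfaffian_eq_intPow` identifies the selected entry
with the Pfaffian. -/
theorem exists_pfaffianBody_nat (n : ℕ) (X : Finset ℕ) :
    ∃ P Q S U : Finset ℕ, P.sup Nat.succ ≤ sTransferBound n (X.sup Nat.succ) ∧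
      (Q.sup Nat.succ ≤ sPowBound (sDim n) (n + 1) (sTransferBound n (X.sup Nat.succ)) ∧
      S.sup Nat.succ ≤ sPowBound (sDim n) (n + 1) (sTransferBound n (X.sup Nat.succ)) ∧
      U.sup Nat.succ ≤ sPowBound (sDim n) (n + 1) (sTransferBound n (X.sup Nat.succ))) ∧
      PfaffianBody stdModel n X (pfaffianString n X) P Q S U := by
  classical
  let P : Finset ℕ := (Finset.range (sTransferBound n (X.sup Nat.succ))).filter
    (sTransfer n (X.sup Nat.succ) (· ∈ X))
  have hP (w : ℕ) : w ∈ P ↔ w < sTransferBound n (X.sup Nat.succ) ∧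
      sTransfer n (X.sup Nat.succ) (· ∈ X) w := by
    rw [Finset.mem_filter, Finset.mem_range]
  have hPl : P.sup Nat.succ ≤ sTransferBound n (X.sup Nat.succ) :=
    Finset.sup_le fun w hw => ((hP w).1 hw).1
  obtain ⟨Q, S, U, ⟨hQ, hS, hU⟩, hpow, hrow⟩ := exists_isPowSeq_nat (sDim n) (n + 1) P
  have hb : sPowBound (sDim n) (n + 1) (P.sup Nat.succ) ≤
      sPowBound (sDim n) (n + 1) (sTransferBound n (X.sup Nat.succ)) :=
    sPowBound_mono (M := stdModel) hPl
  have hbits (z : ℕ) : z ∈ pfaffianString n X ↔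
      sPfaffianBits n (X.sup Nat.succ) (· ∈ X) (· ∈ Q) z := by
    have hsk : sIsSkew ((1 + 1) * n) (X.sup Nat.succ) (· ∈ X) ↔
        (decodeMatrix (2 * n) X).transpose = -decodeMatrix (2 * n) X := by
      rw [sIsSkew_iff]
      refine ⟨fun h => ?_, fun h i hi j hj => congrFun (congrFun h ⟨i, hi⟩) ⟨j, hj⟩⟩
      ext i j
      exact h i i.isLt j j.isLt
    rw [sPfaffianBits, pfaffianString]
    by_cases h : (decodeMatrix (2 * n) X).transpose = -decodeMatrix (2 * n) X
    · have hs := (sIsSkew_iff _ X).1 (hsk.2 h)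
      have h1 := pfaffian_eq_intPow (n := n) (a := entry X) hs (e := entry P)
        fun h hh v hv h' hh' v' hv' => entry_transfer hP hh hv hh' hv'
      have hlt (v : ℕ) (hv : v < 2 * n + 2) : n * (2 * n + 2) + v < (n + 1) * (2 * n + 2) := by
        rw [add_mul, one_mul]; omega
      have h2 := hrow (n + 1) le_rfl (n * (2 * n + 2) + (2 * n + 1)) (hlt _ (by omega))
        (n * (2 * n + 2) + 2 * n) (hlt _ (by omega)) z
      simp only [if_pos h]
      rw [and_iff_right (hsk.2 h)]
      refine Iff.trans ?_ h2.symm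
      rw [show sDim n = (n + 1) * (2 * n + 2) from rfl, h1]
      rfl
    · simp only [if_neg h]
      exact iff_of_false (Finset.notMem_empty z) fun h' => h (hsk.1 h'.1)
  have hF : (pfaffianString n X).sup Nat.succ ≤ Q.sup Nat.succ := by
    refine Finset.sup_le fun z hz => ?_
    have h1 := ((hbits z).1 hz).2
    exact (((nat_le_spair_right _ z).trans (nat_le_spair_right _ _)).trans
      (nat_le_spair_right _ _)).trans_lt (lt_len h1)
  refine ⟨P, Q, S, U, hPl, ⟨hQ.trans hb, hS.trans hb, hU.trans hb⟩, fun w _ hw => ?_, hpow, hF,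
    fun z _ _ => hbits z⟩
  exact (hP w).trans (and_iff_right (lt_iff_le_and_ne.2 hw))

/-- One computation ends in the code of the Pfaffian, and uniqueness excludes any other result. -/
theorem pfaffianFormula_sat_stdModel (v : ℕ → ℕ) (s : ℕ → Finset ℕ) :
    pfaffianFormula.Sat stdModel v s ↔ s 1 = pfaffianString (v 0) (s 0) := by
  obtain ⟨P, Q, S, U, hP, hb, h⟩ := exists_pfaffianBody_nat (v 0) (s 0)
  rw [sat_pfaffianFormula]
  constructor
  · rintro ⟨P', Q', S', U', hP', -, h'⟩
    exact PfaffianBody.unique hP' hP h' h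
  · intro hY
    rw [hY]
    exact ⟨P, Q, S, U, hP, hb, h⟩

end TwoSorted

theorem mainTheorem6 :
    TwoSorted.SigmaB1Definable TwoSorted.VSharpL 1 1
      (fun x X => TwoSorted.pfaffianString (x 0) (X 0)) :=
  ⟨TwoSorted.pfaffianFormula, TwoSorted.isSigmaB1_pfaffianFormula.1,
    TwoSorted.isSigmaB1_pfaffianFormula.2.1, TwoSorted.isSigmaB1_pfaffianFormula.2.2,
    TwoSorted.pfaffianFormula_sat_stdModel, TwoSorted.proves_pfaffianFormula⟩
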